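/- **Setting.** Let $n\ge 1$, $m\ge 0$, $r=n+m$; $\theta_i=0$ for $i<n$ and $\theta_i=1$ for $i\ge n$; $[x]=\frac{q^x-q^{-x}}{q-q^{-1}}$ with $q=e^{h/2}$. The parameter $h$ is either an indeterminate (formal case, ground ring $\mathbf C[[h]]$, everything $h$-adically complete) or a complex number such that $q$ is not a root of $1$ (numerical case, ground field $\mathbf C$). $U_q[gl(n/m)]$ is the (topological, in the formal case) superalgebra with generators $h_j$ ($1\le j\le r$), $e_i,f_i$ ($1\le i\le r-1$), where $e_n,f_n$ are odd and all the others even, and relations: $[h_i,h_j]=0$; $[h_i,e_j]=(\delta_{ij}-\delta_{i,j+1})e_j$; $[h_i,f_j]=(-\delta_{ij}+\delta_{i,j+1})f_j$; $e_if_j=f_je_i$ for $i\ne j$; $e_if_i-f_ie_i=[h_i-h_{i+1}]$ for $i\ne n$; $e_nf_n+f_ne_n=[h_n+h_{n+1}]$; the Serre relations $e_ie_j=e_je_i$ for $|i-j|\ne1$, $e_n^2=0$, $e_i^2e_{i+1}-(q+q^{-1})e_ie_{i+1}e_i+e_{i+1}e_i^2=0$ for $i\ne n$, $e_{i+1}^2e_i-(q+q^{-1})e_{i+1}e_ie_{i+1}+e_ie_{i+1}^2=0$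 for $i+1\neq n$, and $$e_ne_{n-1}e_ne_{n+1}+e_{n-1}e_ne_{n+1}e_n+e_ne_{n+1}e_ne_{n-1}+e_{n+1}e_ne_{n-1}e_n-(q+q^{-1})e_ne_{n-1}e_{n+1}e_n=0,$$ and the same Serre relations for the $f_i$. In the numerical case the invertible elements $q^{h_j}$ are adjoined as generators; they commute with each other and with the $h_i$, and $q^{h_i}e_j=q^{\delta_{ij}-\delta_{i,j+1}}e_jq^{h_i}$, $q^{h_i}f_j=q^{-\delta_{ij}+\delta_{i,j+1}}f_jq^{h_i}$. Let $A_i^\pm$, $1\le i\le r-1$, be creation and annihilation operators of parity $\theta_i$, that is $A_i^-A_j^+-(-1)^{\theta_i\theta_j}A_j^+A_i^-=\delta_{ij}$, $A_i^\pm A_j^\pm-(-1)^{\theta_i\theta_j}A_j^\pm A_i^\pm=0$, acting in the Fock space $\mathcal F$ with orthonormal basis $$|l)=\frac{(A_1^+)^{l_1}\cdots(A_{r-1}^+)^{l_{r-1}}}{\sqrt{l_1!\cdots l_{r-1}!}}|0\rangle,\qquad l_i\in\mathbf Z_{\ge0}\ (i<n),\quad l_i\in\{0,1\}\ (i\ge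 n).$$ Put $N_i=A_i^+A_i^-$, $N=N_1+\dots+N_{r-1}$. $W(n-1/m)$ denotes the algebra generated by the $A_i^\pm$ and all functions of $N_1,\dots,N_{r-1}$, as operators in $\mathcal F$ (in the formal case: the power series in $h$ with coefficients in it). Put $\langle N_i+c\rangle=\big(\frac{[N_i+c]}{N_i+c}\big)^{(1-\theta_i)/2}$. Fix any square roots of the numbers (formal case: power series) $[p-k]$, $k\in\mathbf Z$, and $[k]/k$, $k\ge 1$; they exist. **Proposition (Holstein–Primakoff realization).** (a) In the formal and in the numerical case, for every $p\in\mathbf C$ there is a unique homomorphism $\pi$ of $U_q[gl(n/m)]$ into $W(n-1/m)$ with $$\pi(h_1)=p-N,\quad \pi(h_i)=N_{i-1}\ (2\le i\le r),$$ $$\pi(e_1)=\sqrt{[p-N]}\,\langle N_1+1\rangle A_1^-,\qquad \pi(f_1)=\sqrt{[p-N+1]}\,\langle N_1\rangle A_1^+,$$ $$\pi(e_i)=\langle N_{i-1}\rangle\langle N_i+1\rangle A_{i-1}^+A_i^-,\qquad \pi(f_i)=\langle N_{i-1}+1\rangle\langle N_i\rangle A_i^+A_{i-1}^-\quad(2\le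 i\le r-1)$$ (and, in the numerical case, $\pi(q^{h_j})=q^{\pi(h_j)}$); it preserves the $\mathbf Z_2$-degree. (b) Let $p\in\mathbf N$. Then $\mathcal F$ is the direct sum of $\mathcal F_0(p)=\mathrm{span}\{|l): l_1+\dots+l_{r-1}\le p\}$ and $\mathcal F_1(p)=\mathrm{span}\{|l): l_1+\dots+l_{r-1}>p\}$, and both are invariant under $\pi$ (in the formal case: under all coefficients of all $\pi(a)$). Let now $h$ be a number with $q$ not a root of $1$. (c) For $p\in\mathbf N$ the space $\mathcal F_0(p)$ is finite-dimensional and carries an irreducible representation. (d) If $h\in\mathbf R$, there is an antilinear anti-involution $\omega$ of $U_q[gl(n/m)]$ with $\omega(h_i)=h_i$, $\omega(q^{h_i})=q^{h_i}$, $\omega(e_i)=f_i$, and $(\pi(a)x,y)=(x,\pi(\omega(a))y)$ for all $p\in\mathbf N$, $a\in U_q[gl(n/m)]$, $x,y\in\mathcal F_0(p)$. (e) The representations in $\mathcal F_0(p)$ and $\mathcal F_0(p')$ with $p\ne p'$, $p,p'\in\mathbf N$, are inequivalent. -/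

import Mathlib

open scoped PowerSeries ComplexConjugate

noncomputable section

namespace HP

/-! ### Relations of the quantum superalgebra, over an arbitrary ring

Indices are natural numbers counted from `1`, as usual: `h j` for `1 ≤ j ≤ n + m`, and
`e i`, `f i` for `1 ≤ i < n + m`. -/

/-- The Serre relations for a family `x i`, `1 ≤ i < n + m`; `c` stands for `q + q⁻¹`. -/
inductive SerreRel {B : Type*} [Ring B] (n m : ℕ) (c : B) (x : ℕ → B) : B → B → Prop
  | comm (i j : ℕ) (hi : 1 ≤ i ∧ i < n + m) (hj : 1 ≤ j ∧ j < n + m)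
      (hij : i ≠ j + 1 ∧ j ≠ i + 1) : SerreRel n m c x (x i * x j) (x j * x i)
  | sq (hnm : 1 ≤ n ∧ n < n + m) : SerreRel n m c x (x n ^ 2) 0
  | up (i : ℕ) (hi : 1 ≤ i ∧ i + 1 < n + m) (hin : i ≠ n) :
      SerreRel n m c x
        (x i ^ 2 * x (i + 1) - c * (x i * x (i + 1) * x i) + x (i + 1) * x i ^ 2) 0
  | down (i : ℕ) (hi : 1 ≤ i ∧ i + 1 < n + m) (hin : i + 1 ≠ n) :
      SerreRel n m c x
        (x (i + 1) ^ 2 * x i - c * (x (i + 1) * x i * x (i + 1)) + x i * x (i + 1) ^ 2) 0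
  | quartic (hn : 2 ≤ n) (hm : n + 1 < n + m) :
      SerreRel n m c x
        (x n * x (n - 1) * x n * x (n + 1) + x (n - 1) * x n * x (n + 1) * x n
          + x n * x (n + 1) * x n * x (n - 1) + x (n + 1) * x n * x (n - 1) * x n
          - c * (x n * x (n - 1) * x (n + 1) * x n)) 0

/-- All defining relations. `c` stands for `q + q⁻¹`; `b i` stands for the right-hand side of
the relation between `e i` and `f i`, that is `(q ^ (h i - h (i+1)) - q ^ (h (i+1) - h i))/(q - q⁻¹)`
for `i ≠ n` and `(q ^ (h n + h (n+1)) - q ^ (- h n - h (n+1)))/(q - q⁻¹)` for `i = n`. -/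
inductive GlRel {B : Type*} [Ring B] (n m : ℕ) (c : B) (h e f b : ℕ → B) : B → B → Prop
  | hh (i j : ℕ) (hi : 1 ≤ i ∧ i ≤ n + m) (hj : 1 ≤ j ∧ j ≤ n + m) :
      GlRel n m c h e f b (h i * h j) (h j * h i)
  | he (i j : ℕ) (hi : 1 ≤ i ∧ i ≤ n + m) (hj : 1 ≤ j ∧ j < n + m) :
      GlRel n m c h e f b (h i * e j - e j * h i)
        (((if i = j then 1 else 0) - (if i = j + 1 then 1 else 0)) * e j)
  | hf (i j : ℕ) (hi : 1 ≤ i ∧ i ≤ n + m) (hj : 1 ≤ j ∧ j < n + m) :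
      GlRel n m c h e f b (h i * f j - f j * h i)
        ((-(if i = j then 1 else 0) + (if i = j + 1 then 1 else 0)) * f j)
  | ef_ne (i j : ℕ) (hi : 1 ≤ i ∧ i < n + m) (hj : 1 ≤ j ∧ j < n + m) (hij : i ≠ j) :
      GlRel n m c h e f b (e i * f j - f j * e i) 0
  | ef_even (i : ℕ) (hi : 1 ≤ i ∧ i < n + m) (hin : i ≠ n) :
      GlRel n m c h e f b (e i * f i - f i * e i) (b i)
  | ef_odd (hnm : 1 ≤ n ∧ n < n + m) :
      GlRel n m c h e f b (e n * f n + f n * e n) (b n)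
  | serre_e (x y : B) (hxy : SerreRel n m c e x y) : GlRel n m c h e f b x y
  | serre_f (x y : B) (hxy : SerreRel n m c f x y) : GlRel n m c h e f b x y

/-! ### Formal parameter: power series in `h`, with `q = exp (h/2)` -/

/-- `q ^ x = exp (h x / 2)` as a power series in the central variable `h = X`. -/
def qPow {A : Type*} [Ring A] [Algebra ℂ A] (x : A) : A⟦X⟧ :=
  PowerSeries.mk fun k => ((1 : ℂ) / (2 ^ k * (k.factorial : ℂ))) • x ^ k

/-- `(q ^ x - q ^ (-x)) / h`, that is `∑ h ^ k x ^ (k+1) / (2 ^ k (k+1)!)` over even `k`. -/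
def qSinh {A : Type*} [Ring A] [Algebra ℂ A] (x : A) : A⟦X⟧ :=
  PowerSeries.mk fun k =>
    if Even k then ((1 : ℂ) / (2 ^ k * ((k + 1).factorial : ℂ))) • x ^ (k + 1) else 0

/-- `[x] = (q ^ x - q ^ (-x)) / (q - q⁻¹)`; numerator and denominator are both divided by `h`,
and `(q - q⁻¹) / h` is then an invertible power series. -/
def fBracket {A : Type*} [Ring A] [Algebra ℂ A] (x : A) : A⟦X⟧ :=
  PowerSeries.map (algebraMap ℂ A) (qSinh (1 : ℂ))⁻¹ * qSinh x

lemma qPow_sub {A : Type*} [Ring A] [Algebra ℂ A] (x : A) :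
    qPow x - qPow (-x) = PowerSeries.X * qSinh x := by
  ext k
  rcases k with _ | k
  · simp [qPow]
  · rw [PowerSeries.coeff_succ_X_mul]
    simp only [qPow, qSinh, map_sub, PowerSeries.coeff_mk]
    have h2 : (2 : ℂ) ^ (k + 1) = 2 ^ k * 2 := pow_succ _ _
    rcases Nat.even_or_odd k with hk | hk
    · rw [if_pos hk, (hk.add_one).neg_pow, smul_neg, sub_neg_eq_add, ← add_smul, h2]
      congr 1
      have : ((k + 1).factorial : ℂ) ≠ 0 := by exact_mod_cast (Nat.factorial_pos _).ne'
      field_simp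
      norm_num
    · rw [if_neg (by simpa using hk), (hk.add_one).neg_pow, sub_self]

/-- The defining property of the `q`-bracket: `(q - q⁻¹) [x] = q ^ x - q ^ (-x)`. -/
lemma fBracket_spec {A : Type*} [Ring A] [Algebra ℂ A] (x : A) :
    PowerSeries.map (algebraMap ℂ A) (qPow 1 - qPow (-1)) * fBracket x
      = qPow x - qPow (-x) := by
  have h0 : PowerSeries.constantCoeff (qSinh (1 : ℂ)) ≠ 0 := by
    rw [← PowerSeries.coeff_zero_eq_constantCoeff_apply]
    simp [qSinh]
  rw [fBracket, ← mul_assoc, ← map_mul, qPow_sub, qPow_sub, mul_assoc,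
    PowerSeries.mul_inv_cancel _ h0, mul_one, PowerSeries.map_X]

/-- The canonical `ℂ⟦X⟧`-algebra structure of `A⟦X⟧` for a possibly noncommutative `A`. -/
abbrev psAlgebra (A : Type*) [Ring A] [Algebra ℂ A] : Algebra ℂ⟦X⟧ A⟦X⟧ :=
  (PowerSeries.map (algebraMap ℂ A)).toAlgebra' fun c x => by
    ext k
    simp only [PowerSeries.coeff_mul, PowerSeries.coeff_map]
    rw [← Finset.Nat.sum_antidiagonal_swap]
    exact Finset.sum_congr rfl fun _ _ => Algebra.commutes _ _

/-- The generators of the algebra over `ℂ⟦X⟧`. -/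
inductive Gen (n m : ℕ) : Type
  | h (j : ℕ) (hj : 1 ≤ j ∧ j ≤ n + m) : Gen n m
  | e (i : ℕ) (hi : 1 ≤ i ∧ i < n + m) : Gen n m
  | f (i : ℕ) (hi : 1 ≤ i ∧ i < n + m) : Gen n m

namespace Gen

/-- Free generator `h j` (zero, and never used, for `j` out of range). -/
def hF (n m j : ℕ) : FreeAlgebra ℂ (Gen n m) :=
  if hj : 1 ≤ j ∧ j ≤ n + m then FreeAlgebra.ι ℂ (Gen.h j hj) else 0

/-- Free generator `e i` (zero, and never used, for `i` out of range). -/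
def eF (n m i : ℕ) : FreeAlgebra ℂ (Gen n m) :=
  if hi : 1 ≤ i ∧ i < n + m then FreeAlgebra.ι ℂ (Gen.e i hi) else 0

/-- Free generator `f i` (zero, and never used, for `i` out of range). -/
def fF (n m i : ℕ) : FreeAlgebra ℂ (Gen n m) :=
  if hi : 1 ≤ i ∧ i < n + m then FreeAlgebra.ι ℂ (Gen.f i hi) else 0

end Gen

/-- The `X`-adically complete free `ℂ⟦X⟧`-algebra on the generators. -/
abbrev FreeH (n m : ℕ) : Type := (FreeAlgebra ℂ (Gen n m))⟦X⟧

instance (n m : ℕ) : Algebra ℂ⟦X⟧ (FreeH n m) := psAlgebra (FreeAlgebra ℂ (Gen n m))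

/-- The defining relations inside the completed free algebra. -/
def relH (n m : ℕ) : FreeH n m → FreeH n m → Prop :=
  GlRel n m (PowerSeries.map (algebraMap ℂ (FreeAlgebra ℂ (Gen n m))) (qPow 1 + qPow (-1)))
    (fun j => PowerSeries.C (Gen.hF n m j))
    (fun i => PowerSeries.C (Gen.eF n m i))
    (fun i => PowerSeries.C (Gen.fF n m i))
    (fun i => if i = n then fBracket (Gen.hF n m i + Gen.hF n m (i + 1))
      else fBracket (Gen.hF n m i - Gen.hF n m (i + 1)))

/-- Congruence modulo the `X`-adic closure of the two-sided ideal generated by the relations. -/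
def closedRelH (n m : ℕ) (a b : FreeH n m) : Prop :=
  ∀ k : ℕ, ∃ d : FreeH n m,
    a - b - PowerSeries.X ^ k * d ∈ TwoSidedIdeal.span {z | ∃ x y, relH n m x y ∧ z = x - y}

/-- `U_q[gl(n/m)]` over `ℂ⟦X⟧`, `q = exp (X/2)`: the completed free algebra modulo the closure
of the ideal generated by the relations. -/
abbrev UH (n m : ℕ) : Type := RingQuot (closedRelH n m)

namespace UH

/-- The quotient map. -/
def mk (n m : ℕ) : FreeH n m →ₐ[ℂ⟦X⟧] UH n m := RingQuot.mkAlgHom ℂ⟦X⟧ (closedRelH n m)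

/-- The generators `h j`. -/
def h (n m j : ℕ) : UH n m := mk n m (PowerSeries.C (Gen.hF n m j))
/-- The generators `e i`. -/
def e (n m i : ℕ) : UH n m := mk n m (PowerSeries.C (Gen.eF n m i))
/-- The generators `f i`. -/
def f (n m i : ℕ) : UH n m := mk n m (PowerSeries.C (Gen.fF n m i))

end UH

/-! ### Numerical parameter: `h ∈ ℂ`, `q = exp (h/2)` -/

/-- The number `q ^ x = exp (h x / 2)`. -/
def nPow (h x : ℂ) : ℂ := Complex.exp (h * x / 2)

/-- The number `[x] = (q ^ x - q ^ (-x)) / (q - q⁻¹)`. -/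
def nBracket (h x : ℂ) : ℂ := (nPow h x - nPow h (-x)) / (nPow h 1 - nPow h (-1))

/-- For a number `q` the elements `k j = q ^ (h j)` and their inverses are adjoined. -/
inductive GenN (n m : ℕ) : Type
  | h (j : ℕ) (hj : 1 ≤ j ∧ j ≤ n + m) : GenN n m
  | k (j : ℕ) (hj : 1 ≤ j ∧ j ≤ n + m) : GenN n m
  | kinv (j : ℕ) (hj : 1 ≤ j ∧ j ≤ n + m) : GenN n m
  | e (i : ℕ) (hi : 1 ≤ i ∧ i < n + m) : GenN n m
  | f (i : ℕ) (hi : 1 ≤ i ∧ i < n + m) : GenN n m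

namespace GenN

/-- Free generator `h j` (zero, and never used, for `j` out of range). -/
def hF (n m j : ℕ) : FreeAlgebra ℂ (GenN n m) :=
  if hj : 1 ≤ j ∧ j ≤ n + m then FreeAlgebra.ι ℂ (GenN.h j hj) else 0

/-- Free generator `q ^ (h j)` (zero, and never used, for `j` out of range). -/
def kF (n m j : ℕ) : FreeAlgebra ℂ (GenN n m) :=
  if hj : 1 ≤ j ∧ j ≤ n + m then FreeAlgebra.ι ℂ (GenN.k j hj) else 0

/-- Free generator `q ^ (-h j)` (zero, and never used, for `j` out of range). -/
def kinvF (n m j : ℕ) : FreeAlgebra ℂ (GenN n m) :=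
  if hj : 1 ≤ j ∧ j ≤ n + m then FreeAlgebra.ι ℂ (GenN.kinv j hj) else 0

/-- Free generator `e i` (zero, and never used, for `i` out of range). -/
def eF (n m i : ℕ) : FreeAlgebra ℂ (GenN n m) :=
  if hi : 1 ≤ i ∧ i < n + m then FreeAlgebra.ι ℂ (GenN.e i hi) else 0

/-- Free generator `f i` (zero, and never used, for `i` out of range). -/
def fF (n m i : ℕ) : FreeAlgebra ℂ (GenN n m) :=
  if hi : 1 ≤ i ∧ i < n + m then FreeAlgebra.ι ℂ (GenN.f i hi) else 0

end GenN

/-- Defining relations for a numerical parameter. -/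
inductive relN (n m : ℕ) (h : ℂ) : FreeAlgebra ℂ (GenN n m) → FreeAlgebra ℂ (GenN n m) → Prop
  | gl (x y : FreeAlgebra ℂ (GenN n m))
      (hxy : GlRel n m (algebraMap ℂ _ (nPow h 1 + nPow h (-1)))
        (GenN.hF n m) (GenN.eF n m) (GenN.fF n m)
        (fun i => (nPow h 1 - nPow h (-1))⁻¹ •
          (if i = n then
            GenN.kF n m i * GenN.kF n m (i + 1) - GenN.kinvF n m i * GenN.kinvF n m (i + 1)
          else
            GenN.kF n m i * GenN.kinvF n m (i + 1) - GenN.kinvF n m i * GenN.kF n m (i + 1)))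
        x y) : relN n m h x y
  | k_kinv (j : ℕ) (hj : 1 ≤ j ∧ j ≤ n + m) : relN n m h (GenN.kF n m j * GenN.kinvF n m j) 1
  | kinv_k (j : ℕ) (hj : 1 ≤ j ∧ j ≤ n + m) : relN n m h (GenN.kinvF n m j * GenN.kF n m j) 1
  | kk (i j : ℕ) (hi : 1 ≤ i ∧ i ≤ n + m) (hj : 1 ≤ j ∧ j ≤ n + m) :
      relN n m h (GenN.kF n m i * GenN.kF n m j) (GenN.kF n m j * GenN.kF n m i)
  | kh (i j : ℕ) (hi : 1 ≤ i ∧ i ≤ n + m) (hj : 1 ≤ j ∧ j ≤ n + m) :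
      relN n m h (GenN.kF n m i * GenN.hF n m j) (GenN.hF n m j * GenN.kF n m i)
  | ke (i j : ℕ) (hi : 1 ≤ i ∧ i ≤ n + m) (hj : 1 ≤ j ∧ j < n + m) :
      relN n m h (GenN.kF n m i * GenN.eF n m j)
        (nPow h ((if i = j then 1 else 0) - (if i = j + 1 then 1 else 0)) •
          (GenN.eF n m j * GenN.kF n m i))
  | kf (i j : ℕ) (hi : 1 ≤ i ∧ i ≤ n + m) (hj : 1 ≤ j ∧ j < n + m) :
      relN n m h (GenN.kF n m i * GenN.fF n m j)
        (nPow h (-(if i = j then 1 else 0) + (if i = j + 1 then 1 else 0)) •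
          (GenN.fF n m j * GenN.kF n m i))

/-- The complex algebra `U_q[gl(n/m)]` for the number `q = exp (h/2)`. -/
abbrev UN (n m : ℕ) (h : ℂ) : Type := RingQuot (relN n m h)

namespace UN

/-- The quotient map. -/
def mk (n m : ℕ) (h : ℂ) : FreeAlgebra ℂ (GenN n m) →ₐ[ℂ] UN n m h :=
  RingQuot.mkAlgHom ℂ (relN n m h)

/-- The generators `h j`. -/
def h (n m : ℕ) (h : ℂ) (j : ℕ) : UN n m h := mk n m h (GenN.hF n m j)
/-- The generators `q ^ (h j)`. -/
def k (n m : ℕ) (h : ℂ) (j : ℕ) : UN n m h := mk n m h (GenN.kF n m j)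
/-- The generators `e i`. -/
def e (n m : ℕ) (h : ℂ) (i : ℕ) : UN n m h := mk n m h (GenN.eF n m i)
/-- The generators `f i`. -/
def f (n m : ℕ) (h : ℂ) (i : ℕ) : UN n m h := mk n m h (GenN.fF n m i)

end UN

/-! ### Creation and annihilation operators -/

/-- The generators `A_i^+` and `A_i^-` for `1 ≤ i < n + m`. -/
inductive CAO (n m : ℕ) : Type
  | plus (i : ℕ) (hi : 1 ≤ i ∧ i < n + m) : CAO n m
  | minus (i : ℕ) (hi : 1 ≤ i ∧ i < n + m) : CAO n m

/-- `(-1) ^ (θ_i θ_j)` with `θ_i = 0` for `i < n` and `θ_i = 1` for `i ≥ n`. -/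
def superSign (n i j : ℕ) : ℂ := if n ≤ i ∧ n ≤ j then -1 else 1

/-- The relations of `n - 1` pairs of Bose and `m` pairs of Fermi operators. -/
inductive relW (n m : ℕ) : FreeAlgebra ℂ (CAO n m) → FreeAlgebra ℂ (CAO n m) → Prop
  | mp (i j : ℕ) (hi : 1 ≤ i ∧ i < n + m) (hj : 1 ≤ j ∧ j < n + m) :
      relW n m (FreeAlgebra.ι ℂ (CAO.minus i hi) * FreeAlgebra.ι ℂ (CAO.plus j hj)
          - superSign n i j •
            (FreeAlgebra.ι ℂ (CAO.plus j hj) * FreeAlgebra.ι ℂ (CAO.minus i hi)))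
        (if i = j then 1 else 0)
  | pp (i j : ℕ) (hi : 1 ≤ i ∧ i < n + m) (hj : 1 ≤ j ∧ j < n + m) :
      relW n m (FreeAlgebra.ι ℂ (CAO.plus i hi) * FreeAlgebra.ι ℂ (CAO.plus j hj)
          - superSign n i j •
            (FreeAlgebra.ι ℂ (CAO.plus j hj) * FreeAlgebra.ι ℂ (CAO.plus i hi))) 0
  | mm (i j : ℕ) (hi : 1 ≤ i ∧ i < n + m) (hj : 1 ≤ j ∧ j < n + m) :
      relW n m (FreeAlgebra.ι ℂ (CAO.minus i hi) * FreeAlgebra.ι ℂ (CAO.minus j hj)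
          - superSign n i j •
            (FreeAlgebra.ι ℂ (CAO.minus j hj) * FreeAlgebra.ι ℂ (CAO.minus i hi))) 0

/-- The complex algebra of `n - 1` Bose and `m` Fermi pairs (polynomials in the operators). -/
abbrev Weyl (n m : ℕ) : Type := RingQuot (relW n m)

/-! ### The Fock space -/

/-- Occupation numbers `(l_1, …, l_{n+m-1})`, with `l_i ∈ {0, 1}` for `i ≥ n`; they are
extended by zero to all of `ℕ`. -/
def Occ (n m : ℕ) : Type :=
  {l : ℕ → ℕ // (∀ i, l i ≠ 0 → 1 ≤ i ∧ i < n + m) ∧ ∀ i, n ≤ i → l i ≤ 1}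

/-- The Fock space, with basis `|l) = Finsupp.single l 1`. -/
abbrev Fock (n m : ℕ) : Type := Occ n m →₀ ℂ

/-- Linear operators on the Fock space. -/
abbrev Op (n m : ℕ) : Type := Module.End ℂ (Fock n m)

instance (n m : ℕ) : Algebra ℂ⟦X⟧ (Op n m)⟦X⟧ := psAlgebra (Op n m)

namespace Occ

variable {n m : ℕ}

/-- The total occupation number `l_1 + … + l_{n+m-1}`. -/
def total (l : Occ n m) : ℕ := ∑ i ∈ Finset.Ico 1 (n + m), l.1 i

/-- The occupation number of the Fermi operators. -/
def fermi (l : Occ n m) : ℕ := ∑ i ∈ Finset.Ico n (n + m), l.1 i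

/-- A particle of type `i` can be added to `l`. -/
def CanRaise (l : Occ n m) (i : ℕ) : Prop := (1 ≤ i ∧ i < n + m) ∧ (n ≤ i → l.1 i = 0)

/-- Add a particle of type `i`. -/
def raise (l : Occ n m) (i : ℕ) (hi : l.CanRaise i) : Occ n m :=
  ⟨Function.update l.1 i (l.1 i + 1), by
    constructor
    · intro j hj
      rcases eq_or_ne j i with rfl | hji
      · exact hi.1
      · rw [Function.update_of_ne hji] at hj
        exact l.2.1 j hj
    · intro j hj
      rcases eq_or_ne j i with rfl | hji
      · simp [hi.2 hj]
      · rw [Function.update_of_ne hji]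
        exact l.2.2 j hj⟩

/-- Remove a particle of type `i` (no change if there is none). -/
def lower (l : Occ n m) (i : ℕ) : Occ n m :=
  ⟨Function.update l.1 i (l.1 i - 1), by
    constructor
    · intro j hj
      rcases eq_or_ne j i with rfl | hji
      · rw [Function.update_self] at hj
        exact l.2.1 j (by omega)
      · rw [Function.update_of_ne hji] at hj
        exact l.2.1 j hj
    · intro j hj
      rcases eq_or_ne j i with rfl | hji
      · rw [Function.update_self]
        have := l.2.2 j hj
        omega
      · rw [Function.update_of_ne hji]
        exact l.2.2 j hj⟩

/-- The sign `(-1) ^ (l_n + … + l_{i-1})` for a Fermi index `i`, and `1` for a Bose index. -/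
def sgn (l : Occ n m) (i : ℕ) : ℂ :=
  if n ≤ i then (-1) ^ (∑ j ∈ Finset.Ico n i, l.1 j) else 1

end Occ

open Classical in
/-- The creation operator `A_i^+` in the orthonormal basis
`|l) = (A_1^+)^{l_1} ⋯ (A_{n+m-1}^+)^{l_{n+m-1}} |0) / √(l_1! ⋯ l_{n+m-1}!)`. -/
def Ap (n m i : ℕ) : Op n m :=
  Finsupp.linearCombination ℂ fun l : Occ n m =>
    if hi : l.CanRaise i then
      Finsupp.single (l.raise i hi) (l.sgn i * ((Real.sqrt (l.1 i + 1) : ℝ) : ℂ))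
    else 0

/-- The annihilation operator `A_i^-`. -/
def Am (n m i : ℕ) : Op n m :=
  Finsupp.linearCombination ℂ fun l : Occ n m =>
    Finsupp.single (l.lower i) (l.sgn i * ((Real.sqrt (l.1 i) : ℝ) : ℂ))

/-- The operator `φ(N_1, …, N_{n+m-1})`: multiplication of `|l)` by `φ l`. -/
def diag {n m : ℕ} (φ : Occ n m → ℂ) : Op n m :=
  Finsupp.linearCombination ℂ fun l : Occ n m => Finsupp.single l (φ l)

/-- The same for functions with values in `ℂ⟦X⟧`. -/
def diagH {n m : ℕ} (φ : Occ n m → ℂ⟦X⟧) : (Op n m)⟦X⟧ :=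
  PowerSeries.mk fun k => diag fun l => PowerSeries.coeff k (φ l)

/-! ### The Fock representation of the creation and annihilation operators -/

section FockRep

variable {n m : ℕ}

lemma Occ.raise_self (l : Occ n m) (i : ℕ) (hi : l.CanRaise i) :
    (l.raise i hi).1 i = l.1 i + 1 := Function.update_self ..

lemma Occ.raise_ne (l : Occ n m) (i j : ℕ) (hi : l.CanRaise i) (hij : j ≠ i) :
    (l.raise i hi).1 j = l.1 j := Function.update_of_ne hij ..

lemma Occ.lower_self (l : Occ n m) (i : ℕ) : (l.lower i).1 i = l.1 i - 1 :=
  Function.update_self ..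

lemma Occ.lower_ne (l : Occ n m) (i j : ℕ) (hij : j ≠ i) : (l.lower i).1 j = l.1 j :=
  Function.update_of_ne hij ..

lemma Occ.ext' {l l' : Occ n m} (hl : ∀ i, l.1 i = l'.1 i) : l = l' := Subtype.ext (funext hl)

/-- The sign picked up by `A_i^±` after the occupation number `l_j` has changed by one. -/
def swapSign (n j i : ℕ) : ℂ := if n ≤ j ∧ j < i then -1 else 1

lemma superSign_mul_swapSign (n i j : ℕ) (hij : i ≠ j) :
    superSign n i j * swapSign n i j = swapSign n j i := by
  unfold superSign swapSign
  split_ifs <;> first | omega | norm_num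

lemma Occ.sgn_of_succ (l l' : Occ n m) (i j : ℕ) (hj : l'.1 j = l.1 j + 1)
    (hne : ∀ k, k ≠ j → l'.1 k = l.1 k) : l'.sgn i = swapSign n j i * l.sgn i := by
  unfold Occ.sgn swapSign
  by_cases hi : n ≤ i
  · rw [if_pos hi, if_pos hi]
    by_cases hji : n ≤ j ∧ j < i
    · have hmem : j ∈ Finset.Ico n i := Finset.mem_Ico.2 hji
      rw [if_pos hji, ← Finset.add_sum_erase _ _ hmem, ← Finset.add_sum_erase _ l.1 hmem, hj,
        Finset.sum_congr rfl fun k hk => hne k (Finset.ne_of_mem_erase hk)]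
      ring
    · rw [if_neg hji, one_mul,
        Finset.sum_congr rfl fun k hk => hne k (by rintro rfl; exact hji (Finset.mem_Ico.1 hk))]
  · rw [if_neg hi, if_neg hi, if_neg (by omega), one_mul]

lemma Occ.sgn_raise (l : Occ n m) (i j : ℕ) (hj : l.CanRaise j) :
    (l.raise j hj).sgn i = swapSign n j i * l.sgn i :=
  l.sgn_of_succ _ i j (l.raise_self j hj) fun k hk => l.raise_ne j k hj hk

lemma swapSign_mul_self (n i j : ℕ) : swapSign n i j * swapSign n i j = 1 := by
  unfold swapSign; split_ifs <;> norm_num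

lemma Occ.sgn_lower (l : Occ n m) (i j : ℕ) (hj : l.1 j ≠ 0) :
    (l.lower j).sgn i = swapSign n j i * l.sgn i := by
  rw [(l.lower j).sgn_of_succ l i j (by rw [Occ.lower_self]; omega)
    fun k hk => (l.lower_ne j k hk).symm, ← mul_assoc, swapSign_mul_self, one_mul]

lemma Occ.sgn_mul_self (l : Occ n m) (i : ℕ) : l.sgn i * l.sgn i = 1 := by
  unfold Occ.sgn
  split_ifs
  · rw [← mul_pow]; norm_num
  · norm_num

lemma Ap_pos (l : Occ n m) (i : ℕ) (hi : l.CanRaise i) (z : ℂ) :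
    Ap n m i (Finsupp.single l z)
      = Finsupp.single (l.raise i hi) (z * (l.sgn i * ((Real.sqrt (l.1 i + 1) : ℝ) : ℂ))) := by
  rw [Ap, Finsupp.linearCombination_single, dif_pos hi, Finsupp.smul_single, smul_eq_mul]

lemma Ap_neg (l : Occ n m) (i : ℕ) (hi : ¬ l.CanRaise i) (z : ℂ) :
    Ap n m i (Finsupp.single l z) = 0 := by
  simp [Ap, hi]

lemma Am_single (l : Occ n m) (i : ℕ) (z : ℂ) :
    Am n m i (Finsupp.single l z)
      = Finsupp.single (l.lower i) (z * (l.sgn i * ((Real.sqrt (l.1 i) : ℝ) : ℂ))) := by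
  rw [Am, Finsupp.linearCombination_single, Finsupp.smul_single, smul_eq_mul]

lemma Am_zero (l : Occ n m) (i : ℕ) (hi : l.1 i = 0) (z : ℂ) :
    Am n m i (Finsupp.single l z) = 0 := by
  simp [Am_single, hi]

lemma sqrt_cast_mul_self (k : ℝ) (hk : 0 ≤ k) :
    ((Real.sqrt k : ℝ) : ℂ) * ((Real.sqrt k : ℝ) : ℂ) = (k : ℂ) := by
  rw [← Complex.ofReal_mul, Real.mul_self_sqrt hk]

/-- `N_i |l) = l_i |l)`. -/
lemma number_single (l : Occ n m) (i : ℕ) (z : ℂ) :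
    (Ap n m i * Am n m i) (Finsupp.single l z) = Finsupp.single l (l.1 i * z) := by
  rw [Module.End.mul_apply]
  by_cases h0 : l.1 i = 0
  · rw [Am_zero l i h0, map_zero, h0]; simp
  · have hi := l.2.1 i h0
    have hr : (l.lower i).CanRaise i :=
      ⟨hi, fun hn => by rw [Occ.lower_self]; have := l.2.2 i hn; omega⟩
    have hs : swapSign n i i = 1 := by simp [swapSign]
    rw [Am_single, Ap_pos _ _ hr, Occ.sgn_lower _ _ _ h0, hs, one_mul]
    have h1 : (((l.lower i).1 i : ℕ) : ℝ) + 1 = l.1 i := by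
      rw [Occ.lower_self]; exact_mod_cast (by omega : l.1 i - 1 + 1 = l.1 i)
    have hl : (l.lower i).raise i hr = l := Occ.ext' fun k => by
      rcases eq_or_ne k i with rfl | hk
      · rw [Occ.raise_self, Occ.lower_self]; omega
      · rw [Occ.raise_ne _ _ _ _ hk, Occ.lower_ne _ _ _ hk]
    rw [h1, hl]
    congr 1
    have := sqrt_cast_mul_self (l.1 i : ℝ) (Nat.cast_nonneg _)
    push_cast at this
    linear_combination (z * (l.sgn i * l.sgn i)) * this + (z * l.1 i) * l.sgn_mul_self i

/-- `A_i^- A_i^+ |l) = (l_i + 1) |l)` if the particle can be added. -/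
lemma am_ap_single (l : Occ n m) (i : ℕ) (hi : l.CanRaise i) (z : ℂ) :
    (Am n m i * Ap n m i) (Finsupp.single l z) = Finsupp.single l ((l.1 i + 1) * z) := by
  have hs : swapSign n i i = 1 := by simp [swapSign]
  rw [Module.End.mul_apply, Ap_pos _ _ hi, Am_single, Occ.sgn_raise, hs, one_mul, Occ.raise_self]
  have hl : (l.raise i hi).lower i = l := Occ.ext' fun k => by
    rcases eq_or_ne k i with rfl | hk
    · rw [Occ.lower_self, Occ.raise_self]; omega
    · rw [Occ.lower_ne _ _ _ hk, Occ.raise_ne _ _ _ _ hk]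
  rw [hl]
  congr 1
  have := sqrt_cast_mul_self (l.1 i + 1 : ℝ) (by positivity)
  push_cast at this ⊢
  linear_combination (z * (l.sgn i * l.sgn i)) * this + (z * (l.1 i + 1)) * l.sgn_mul_self i

lemma op_ext {S T : Op n m} (hST : ∀ l, S (Finsupp.single l 1) = T (Finsupp.single l 1)) :
    S = T := Finsupp.lhom_ext' fun l => LinearMap.ext_ring (hST l)

lemma fock_mp (i j : ℕ) (hi : 1 ≤ i ∧ i < n + m) :
    Am n m i * Ap n m j - superSign n i j • (Ap n m j * Am n m i) = if i = j then 1 else 0 := by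
  refine op_ext fun l => ?_
  by_cases hij : i = j
  · subst hij
    rw [if_pos rfl, LinearMap.sub_apply, LinearMap.smul_apply, number_single]
    by_cases hr : l.CanRaise i
    · rw [am_ap_single l i hr, Module.End.one_apply, Finsupp.smul_single, ← Finsupp.single_sub]
      congr 1
      unfold superSign
      split_ifs with hn
      · simp [hr.2 hn.1]
      · simp
    · have hn : n ≤ i := by by_contra hc; exact hr ⟨hi, fun h => absurd h hc⟩
      have h1 : l.1 i = 1 := by
        have := l.2.2 i hn
        have h0 : l.1 i ≠ 0 := fun h0 => hr ⟨hi, fun _ => h0⟩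
        omega
      rw [Module.End.mul_apply, Ap_neg _ _ hr, Module.End.one_apply, h1]
      simp [superSign, hn]
  · rw [if_neg hij, LinearMap.sub_apply, LinearMap.smul_apply, Module.End.mul_apply,
      Module.End.mul_apply, LinearMap.zero_apply]
    by_cases h0 : l.1 i = 0
    · rw [Am_zero l i h0, map_zero, smul_zero, sub_zero]
      by_cases hr : l.CanRaise j
      · rw [Ap_pos _ _ hr, Am_zero _ _ (by rw [Occ.raise_ne _ _ _ _ hij, h0])]
      · rw [Ap_neg _ _ hr, map_zero]
    · by_cases hr : l.CanRaise j
      · have hr' : (l.lower i).CanRaise j :=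
          ⟨hr.1, fun hn => by rw [Occ.lower_ne _ _ _ (Ne.symm hij)]; exact hr.2 hn⟩
        rw [Ap_pos _ _ hr, Am_single, Am_single, Ap_pos _ _ hr', Occ.sgn_raise,
          Occ.sgn_lower _ _ _ h0, Occ.raise_ne _ _ _ _ hij, Occ.lower_ne _ _ _ (Ne.symm hij),
          Finsupp.smul_single]
        have hl : (l.raise j hr).lower i = (l.lower i).raise j hr' := Occ.ext' fun k => by
          rcases eq_or_ne k i with rfl | hk
          · rw [Occ.lower_self, Occ.raise_ne _ _ _ _ hij, Occ.raise_ne _ _ _ _ hij,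
              Occ.lower_self]
          · rw [Occ.lower_ne _ _ _ hk]
            rcases eq_or_ne k j with rfl | hkj
            · rw [Occ.raise_self, Occ.raise_self, Occ.lower_ne _ _ _ hk]
            · rw [Occ.raise_ne _ _ _ _ hkj, Occ.raise_ne _ _ _ _ hkj, Occ.lower_ne _ _ _ hk]
        rw [hl, ← Finsupp.single_sub, ← superSign_mul_swapSign n i j hij, smul_eq_mul]
        rw [Finsupp.single_eq_zero]
        ring
      · have hr' : ¬ (l.lower i).CanRaise j := fun h =>
          hr ⟨h.1, fun hn => by rw [← Occ.lower_ne l i j (Ne.symm hij)]; exact h.2 hn⟩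
        rw [Ap_neg _ _ hr, Am_single, Ap_neg _ _ hr', map_zero, smul_zero, sub_zero]

lemma fock_pp (i j : ℕ) :
    Ap n m i * Ap n m j - superSign n i j • (Ap n m j * Ap n m i) = 0 := by
  refine op_ext fun l => ?_
  rw [LinearMap.sub_apply, LinearMap.smul_apply, Module.End.mul_apply, Module.End.mul_apply,
    LinearMap.zero_apply]
  by_cases hij : i = j
  · subst hij
    by_cases hn : n ≤ i
    · suffices h : Ap n m i (Ap n m i (Finsupp.single l 1)) = 0 by rw [h, smul_zero, sub_zero]
      by_cases hr : l.CanRaise i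
      · rw [Ap_pos _ _ hr, Ap_neg]
        intro h
        have := h.2 hn
        rw [Occ.raise_self] at this
        omega
      · rw [Ap_neg _ _ hr, map_zero]
    · simp [superSign, hn]
  · by_cases hr : l.CanRaise i <;> by_cases hs : l.CanRaise j
    · have hr' : (l.raise j hs).CanRaise i :=
        ⟨hr.1, fun hn => by rw [Occ.raise_ne _ _ _ _ hij]; exact hr.2 hn⟩
      have hs' : (l.raise i hr).CanRaise j :=
        ⟨hs.1, fun hn => by rw [Occ.raise_ne _ _ _ _ (Ne.symm hij)]; exact hs.2 hn⟩
      rw [Ap_pos _ _ hr, Ap_pos _ _ hs, Ap_pos _ _ hr', Ap_pos _ _ hs', Occ.sgn_raise,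
        Occ.sgn_raise, Occ.raise_ne _ _ _ _ hij, Occ.raise_ne _ _ _ _ (Ne.symm hij),
        Finsupp.smul_single]
      have hl : (l.raise j hs).raise i hr' = (l.raise i hr).raise j hs' := Occ.ext' fun k => by
        rcases eq_or_ne k i with rfl | hk
        · rw [Occ.raise_self, Occ.raise_ne _ _ _ _ hij, Occ.raise_ne _ _ _ _ hij,
            Occ.raise_self]
        · rw [Occ.raise_ne _ _ _ _ hk]
          rcases eq_or_ne k j with rfl | hkj
          · rw [Occ.raise_self, Occ.raise_self, Occ.raise_ne _ _ _ _ hk]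
          · rw [Occ.raise_ne _ _ _ _ hkj, Occ.raise_ne _ _ _ _ hkj, Occ.raise_ne _ _ _ _ hk]
      rw [hl, ← Finsupp.single_sub, ← superSign_mul_swapSign n i j hij, smul_eq_mul,
        Finsupp.single_eq_zero]
      ring
    · have hs' : ¬ (l.raise i hr).CanRaise j := fun h =>
        hs ⟨h.1, fun hn => by rw [← Occ.raise_ne l i j hr (Ne.symm hij)]; exact h.2 hn⟩
      rw [Ap_neg _ _ hs, Ap_pos _ _ hr, Ap_neg _ _ hs', map_zero, smul_zero, sub_zero]
    · have hr' : ¬ (l.raise j hs).CanRaise i := fun h =>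
        hr ⟨h.1, fun hn => by rw [← Occ.raise_ne l j i hs hij]; exact h.2 hn⟩
      rw [Ap_neg _ _ hr, Ap_pos _ _ hs, Ap_neg _ _ hr', map_zero, smul_zero, sub_zero]
    · rw [Ap_neg _ _ hr, Ap_neg _ _ hs, map_zero, map_zero, smul_zero, sub_zero]

lemma fock_mm (i j : ℕ) :
    Am n m i * Am n m j - superSign n i j • (Am n m j * Am n m i) = 0 := by
  refine op_ext fun l => ?_
  rw [LinearMap.sub_apply, LinearMap.smul_apply, Module.End.mul_apply, Module.End.mul_apply,
    LinearMap.zero_apply]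
  by_cases hij : i = j
  · subst hij
    by_cases hn : n ≤ i
    · suffices h : Am n m i (Am n m i (Finsupp.single l 1)) = 0 by rw [h, smul_zero, sub_zero]
      rw [Am_single, Am_zero]
      rw [Occ.lower_self]
      have := l.2.2 i hn
      omega
    · simp [superSign, hn]
  · by_cases hr : l.1 i = 0
    · rw [Am_zero _ _ hr, map_zero, smul_zero, sub_zero, Am_single, Am_zero]
      rw [Occ.lower_ne _ _ _ hij, hr]
    · by_cases hs : l.1 j = 0
      · rw [Am_zero _ _ hs, map_zero, zero_sub, Am_single, Am_zero, smul_zero, neg_zero]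
        rw [Occ.lower_ne _ _ _ (Ne.symm hij), hs]
      · rw [Am_single, Am_single, Am_single, Am_single, Occ.sgn_lower _ _ _ hr,
          Occ.sgn_lower _ _ _ hs, Occ.lower_ne _ _ _ hij, Occ.lower_ne _ _ _ (Ne.symm hij),
          Finsupp.smul_single]
        have hl : (l.lower j).lower i = (l.lower i).lower j := Occ.ext' fun k => by
          rcases eq_or_ne k i with rfl | hk
          · rw [Occ.lower_self, Occ.lower_ne _ _ _ hij, Occ.lower_ne _ _ _ hij,
              Occ.lower_self]
          · rw [Occ.lower_ne _ _ _ hk]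
            rcases eq_or_ne k j with rfl | hkj
            · rw [Occ.lower_self, Occ.lower_self, Occ.lower_ne _ _ _ hk]
            · rw [Occ.lower_ne _ _ _ hkj, Occ.lower_ne _ _ _ hkj, Occ.lower_ne _ _ _ hk]
        rw [hl, ← Finsupp.single_sub, ← superSign_mul_swapSign n i j hij, smul_eq_mul,
          Finsupp.single_eq_zero]
        ring

end FockRep

/-- The Fock representation: `A_i^±` acts by the operators above. -/
def fockRep (n m : ℕ) : Weyl n m →ₐ[ℂ] Op n m :=
  RingQuot.liftAlgHom ℂ
    ⟨FreeAlgebra.lift ℂ fun g : CAO n m =>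
      match g with
      | CAO.plus i _ => Ap n m i
      | CAO.minus i _ => Am n m i, by
      intro x y hxy
      cases hxy with
      | mp i j hi hj =>
        have h := fock_mp (n := n) (m := m) i j hi
        split_ifs at h ⊢ <;> simpa using h
      | pp i j hi hj => simpa using fock_pp (n := n) (m := m) i j
      | mm i j hi hj => simpa using fock_mm (n := n) (m := m) i j⟩

/-- The algebra `W(n-1/m)` of the creation and annihilation operators, realized in the Fock
space and enlarged by all functions of the number operators `N_1, …, N_{n+m-1}`. -/
def W (n m : ℕ) : Subalgebra ℂ (Op n m) :=
  Algebra.adjoin ℂ (Set.range (fockRep n m) ∪ Set.range (diag (n := n) (m := m)))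

/-- The grading operator: `|l)` is even or odd together with its number of Fermi particles. -/
def parityOp (n m : ℕ) : Op n m := diag fun l => (-1) ^ l.fermi

/-- The span of the `|l)` with `l_1 + … + l_{n+m-1} ≤ p`. -/
def F0 (n m p : ℕ) : Submodule ℂ (Fock n m) :=
  Submodule.span ℂ {v | ∃ l : Occ n m, l.total ≤ p ∧ v = Finsupp.single l 1}

/-- The span of the `|l)` with `l_1 + … + l_{n+m-1} > p`. -/
def F1 (n m p : ℕ) : Submodule ℂ (Fock n m) :=
  Submodule.span ℂ {v | ∃ l : Occ n m, p < l.total ∧ v = Finsupp.single l 1}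

/-- The scalar product for which the `|l)` are orthonormal (antilinear in the first argument). -/
def fockInner {n m : ℕ} (x y : Fock n m) : ℂ := x.sum fun l z => conj z * y l

/-! ### The Holstein-Primakoff formulas -/

/-- `s k` is a square root of `[p - k]` for every integer `k`, and `t k` is a square root of
`[k] / k` for every integer `k ≥ 1`. (There is no condition on `t 0`.) -/
structure IsRoots {R : Type*} [CommRing R] (br : ℂ → R) (p : ℂ) (s : ℤ → R) (t : ℕ → R) :
    Prop where
  s_sq : ∀ k : ℤ, s k ^ 2 = br (p - k)
  t_sq : ∀ k : ℕ, t k ^ 2 * (k : R) = br k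

section Formulas

variable {R B : Type*} [CommRing R] [Ring B] [Algebra ℂ B] {n m : ℕ}

/-- The value of `⟨N_i + c⟩ = ([N_i + c] / (N_i + c)) ^ ((1 - θ_i) / 2)` at `N_i + c = k`. -/
def ang (n : ℕ) (t : ℕ → R) (i k : ℕ) : R := if i < n then t k else 1

/-- `π (h_1) = p - N` and `π (h_j) = N_{j-1}` for `j ≥ 2`, where `N_i = A_i^+ A_i^-`. -/
def hpH (n m : ℕ) (ap am : ℕ → B) (p : ℂ) (j : ℕ) : B :=
  if j = 1 then algebraMap ℂ B p - ∑ i ∈ Finset.Ico 1 (n + m), ap i * am i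
  else ap (j - 1) * am (j - 1)

/-- `π (e_1) = √[p-N] ⟨N_1+1⟩ A_1^-` and `π (e_i) = ⟨N_{i-1}⟩ ⟨N_i+1⟩ A_{i-1}^+ A_i^-`;
`D φ` is the function `φ` of the number operators. -/
def hpE (D : (Occ n m → R) → B) (ap am : ℕ → B) (s : ℤ → R) (t : ℕ → R) (i : ℕ) : B :=
  if i = 1 then D (fun l => s l.total) * D (fun l => ang n t 1 (l.1 1 + 1)) * am 1
  else D (fun l => ang n t (i - 1) (l.1 (i - 1))) * D (fun l => ang n t i (l.1 i + 1))
    * ap (i - 1) * am i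

/-- `π (f_1) = √[p-N+1] ⟨N_1⟩ A_1^+` and `π (f_i) = ⟨N_{i-1}+1⟩ ⟨N_i⟩ A_i^+ A_{i-1}^-`. -/
def hpF (D : (Occ n m → R) → B) (ap am : ℕ → B) (s : ℤ → R) (t : ℕ → R) (i : ℕ) : B :=
  if i = 1 then D (fun l => s (l.total - 1)) * D (fun l => ang n t 1 (l.1 1)) * ap 1
  else D (fun l => ang n t (i - 1) (l.1 (i - 1) + 1)) * D (fun l => ang n t i (l.1 i))
    * ap i * am (i - 1)

end Formulas

/-- `π` is given on the generators by the Holstein-Primakoff formulas (formal parameter). -/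
structure IsHPH {n m : ℕ} (p : ℂ) (s : ℤ → ℂ⟦X⟧) (t : ℕ → ℂ⟦X⟧)
    (π : UH n m →ₐ[ℂ⟦X⟧] (Op n m)⟦X⟧) : Prop where
  map_h : ∀ j, 1 ≤ j ∧ j ≤ n + m → π (UH.h n m j)
    = hpH n m (fun i => PowerSeries.C (Ap n m i)) (fun i => PowerSeries.C (Am n m i)) p j
  map_e : ∀ i, 1 ≤ i ∧ i < n + m → π (UH.e n m i)
    = hpE diagH (fun i => PowerSeries.C (Ap n m i)) (fun i => PowerSeries.C (Am n m i)) s t i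
  map_f : ∀ i, 1 ≤ i ∧ i < n + m → π (UH.f n m i)
    = hpF diagH (fun i => PowerSeries.C (Ap n m i)) (fun i => PowerSeries.C (Am n m i)) s t i

/-- `π` is given on the generators by the Holstein-Primakoff formulas (numerical parameter);
on `q ^ (h_1)` and `q ^ (h_j)` it takes the values `q ^ (p - N)` and `q ^ (N_{j-1})`. -/
structure IsHPN {n m : ℕ} {h : ℂ} (p : ℂ) (s : ℤ → ℂ) (t : ℕ → ℂ)
    (π : UN n m h →ₐ[ℂ] Op n m) : Prop where
  map_h : ∀ j, 1 ≤ j ∧ j ≤ n + m → π (UN.h n m h j) = hpH n m (Ap n m) (Am n m) p j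
  map_k : ∀ j, 1 ≤ j ∧ j ≤ n + m → π (UN.k n m h j)
    = diag fun l => nPow h (if j = 1 then p - l.total else l.1 (j - 1))
  map_e : ∀ i, 1 ≤ i ∧ i < n + m → π (UN.e n m h i) = hpE diag (Ap n m) (Am n m) s t i
  map_f : ∀ i, 1 ≤ i ∧ i < n + m → π (UN.f n m h i) = hpF diag (Ap n m) (Am n m) s t i

/-- The images `x j`, `y i`, `z i` of `h j`, `e i`, `f i` have the same degree as these
generators (`e n` and `f n` are odd, all others even) for the grading operator `P`. -/
def RespectsDegree {B : Type*} [Ring B] (n m : ℕ) (P : B) (x y z : ℕ → B) : Prop :=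
  (∀ j, 1 ≤ j ∧ j ≤ n + m → P * x j = x j * P) ∧
  ∀ i, 1 ≤ i ∧ i < n + m →
    P * y i = (if i = n then -1 else 1) * (y i * P) ∧
    P * z i = (if i = n then -1 else 1) * (z i * P)

/-- `ω` is the antilinear anti-involution with `ω (h_j) = h_j` and `ω (e_i) = f_i`
(hence `ω (q ^ (h_j)) = q ^ (h_j)` for real `q`, and `ω (f_i) = e_i`). -/
structure IsAntiInvolution {n m : ℕ} {h : ℂ} (ω : UN n m h → UN n m h) : Prop where
  map_add : ∀ a b, ω (a + b) = ω a + ω b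
  map_smul : ∀ (c : ℂ) (a), ω (c • a) = conj c • ω a
  map_mul : ∀ a b, ω (a * b) = ω b * ω a
  invol : ∀ a, ω (ω a) = a
  map_h : ∀ j, 1 ≤ j ∧ j ≤ n + m → ω (UN.h n m h j) = UN.h n m h j
  map_k : ∀ j, 1 ≤ j ∧ j ≤ n + m → ω (UN.k n m h j) = UN.k n m h j
  map_e : ∀ i, 1 ≤ i ∧ i < n + m → ω (UN.e n m h i) = UN.f n m h i

/-- The subspace `V` is invariant under all operators of the representation `π`. -/
def IsInvariant {n m : ℕ} {h : ℂ} (π : UN n m h →ₐ[ℂ] Op n m) (V : Submodule ℂ (Fock n m)) :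
    Prop :=
  ∀ a, ∀ x ∈ V, π a x ∈ V

/-- `V` is an invariant subspace of `π`, nonzero, without proper nonzero invariant subspaces. -/
def IsIrreducible {n m : ℕ} {h : ℂ} (π : UN n m h →ₐ[ℂ] Op n m) (V : Submodule ℂ (Fock n m)) :
    Prop :=
  IsInvariant π V ∧ V ≠ ⊥ ∧ ∀ V' ≤ V, IsInvariant π V' → V' = ⊥ ∨ V' = V

/-- The restrictions of `π` to `V` and of `π'` to `V'` are equivalent. -/
def AreEquivalent {n m : ℕ} {h : ℂ} (π π' : UN n m h →ₐ[ℂ] Op n m)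
    (V V' : Submodule ℂ (Fock n m)) : Prop :=
  ∃ T : V ≃ₗ[ℂ] V', ∀ (a : UN n m h) (x y : V),
    (y : Fock n m) = π a x → (T y : Fock n m) = π' a (T x)

end HP

end

/-!
The proof adjoins to the `n + m - 1` pairs of creation and annihilation operators one more site `0`
whose occupation number is `-N`, so that a basis vector `|l)` becomes a configuration
`x : ℕ → ℤ` of total occupation zero (`Occ.config`). Every pair of Holstein-Primakoff formulas then
has the same shape: `π (e_i)` moves one particle from site `i` to site `i - 1`, `π (f_i)` moves it
back, and the matrix elements are products `ρ (i-1) (·) * ρ i (·)` of one-site amplitudes. At a Bose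
site `ρ i k` is a square root of `[k]`, at a Fermi site it is `1` for `k = 1` and `0` otherwise, and
`ρ 0 (-N)` is `√[p - N]` (`IsAmplitude`, `opE`, `opF`). The signs of the Fermi operators cancel in
the products `A_{i-1}^+ A_i^-`, and `√[p - N]` makes the site `0` behave like the other Bose sites.

In the relations (`glRel_op`) every monomial displaces a configuration by the same vector, so that
each relation is an identity between amplitudes at a configuration. The ones that are not trivial
follow from `[x+1] + [x-1] = (q + q⁻¹) [x]` and `[x] [y+1] - [x+1] [y] = [x-y]`, two consequences of
`q ^ (x+y) = q ^ x q ^ y` (`IsBracket.of_exp`). They hold for the numbers `[x]` and for the power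
series `[x]`, so that both cases are treated at once, over a commutative ring `R`.

For the formal parameter this gives operators on the space over `ℂ⟦X⟧`, which are expanded into
power series of operators over `ℂ` (`expand`). A homomorphism of the free algebra extends uniquely
to power series, and its kernel is automatically closed (`extend`, `eq_extend`); this yields
existence and uniqueness on the completed algebra `UH n m`.

The amplitude `√[p - N]` vanishes at `N = p`, so no particle enters or leaves between `N = p` and
`N = p + 1` (`IsAmplitude.zero_neg_natCast`); this is the invariance of `F0` and `F1`. For `q` not
a root of unity no other amplitude between two configurations of `F0` vanishes. The eigenvalues of
the `h_j` separate the basis vectors, so an invariant subspace contains a basis vector, hence the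
vacuum and hence everything (`IsHPN.isIrreducible`). Inequivalence holds because the sum of all
`h_j` acts as the scalar `p`. For real `h` the numbers `[k]` with `k ≥ 0` are nonnegative, so all
the amplitudes within `F0` are real and `π (e_i)`, `π (f_i)` are adjoint to each other
(`IsHPN.fockInner_eq`).
-/

noncomputable section

namespace HP

/-! ### The `q`-bracket -/

/-- The identities of the `q`-bracket that enter the relations; `c` stands for `q + q⁻¹`. -/
structure IsBracket {R : Type*} [CommRing R] (br : ℂ → R) (c : R) : Prop where
  zero : br 0 = 0
  one : br 1 = 1
  neg_one : br (-1) = -1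
  add_sub : ∀ x, br (x + 1) + br (x - 1) = c * br x
  mul_sub : ∀ x y, br x * br (y + 1) - br (x + 1) * br y = br (x - y)

/-- The identities of the `q`-bracket follow from the exponential law of `Q x = q ^ x` after
multiplication by `q - q⁻¹`, which is not a zero divisor. -/
lemma IsBracket.of_exp {R : Type*} [CommRing R] [IsDomain R] (Q br : ℂ → R)
    (hadd : ∀ x y, Q (x + y) = Q x * Q y) (hne : Q 1 - Q (-1) ≠ 0)
    (hbr : ∀ x, (Q 1 - Q (-1)) * br x = Q x - Q (-x)) : IsBracket br (Q 1 + Q (-1)) := by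
  have hsub : ∀ x y, Q (x - y) = Q x * Q (-y) := fun x y => by rw [← hadd, sub_eq_add_neg]
  refine ⟨?_, ?_, ?_, fun x => ?_, fun x y => ?_⟩
  · refine mul_left_cancel₀ hne ?_
    rw [hbr, neg_zero, sub_self, mul_zero]
  · refine mul_left_cancel₀ hne ?_
    rw [hbr, mul_one]
  · refine mul_left_cancel₀ hne ?_
    rw [hbr, neg_neg]; ring
  · refine mul_left_cancel₀ hne ?_
    have h1 := hbr (x + 1)
    have h2 := hbr (x - 1)
    have h3 := hbr x
    rw [neg_add, hadd, hadd] at h1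
    rw [neg_sub, hsub, hsub] at h2
    linear_combination h1 + h2 - (Q 1 + Q (-1)) * h3
  · refine mul_left_cancel₀ hne (mul_left_cancel₀ hne ?_)
    have h1 := hbr (x + 1)
    have h2 := hbr (y + 1)
    have h3 := hbr x
    have h4 := hbr y
    have h5 := hbr (x - y)
    rw [neg_add, hadd, hadd] at h1 h2
    rw [neg_sub, hsub, hsub] at h5
    linear_combination h3 * ((Q 1 - Q (-1)) * br (y + 1)) + (Q x - Q (-x)) * h2
      - h1 * ((Q 1 - Q (-1)) * br y) - (Q x * Q 1 - Q (-x) * Q (-1)) * h4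
      - (Q 1 - Q (-1)) * h5

lemma nPow_add (h x y : ℂ) : nPow h (x + y) = nPow h x * nPow h y := by
  rw [nPow, nPow, nPow, ← Complex.exp_add]; congr 1; ring

lemma nPow_zero (h : ℂ) : nPow h 0 = 1 := by simp [nPow]

lemma nPow_neg (h x : ℂ) : nPow h (-x) = (nPow h x)⁻¹ := by
  rw [nPow, nPow, ← Complex.exp_neg]; congr 1; ring

lemma nPow_natCast (h : ℂ) (k : ℕ) : nPow h k = nPow h 1 ^ k := by
  rw [nPow, nPow, ← Complex.exp_nat_mul]; congr 1; ring

lemma nPow_ne_zero (h x : ℂ) : nPow h x ≠ 0 := Complex.exp_ne_zero _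

lemma nPow_sub_nPow_neg_ne_zero {h : ℂ} (hq : ∀ k : ℕ, 0 < k → nPow h 1 ^ k ≠ 1) {k : ℕ}
    (hk : 0 < k) : nPow h k - nPow h (-k) ≠ 0 := by
  intro h0
  refine hq (2 * k) (by omega) ?_
  rw [nPow_neg, nPow_natCast, sub_eq_zero] at h0
  have h1 : nPow h 1 ^ k ≠ 0 := pow_ne_zero _ (nPow_ne_zero _ _)
  rw [two_mul, pow_add]
  nth_rewrite 1 [h0]
  exact inv_mul_cancel₀ h1

lemma nPow_one_sub_ne_zero {h : ℂ} (hq : ∀ k : ℕ, 0 < k → nPow h 1 ^ k ≠ 1) :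
    nPow h 1 - nPow h (-1) ≠ 0 := by
  simpa using nPow_sub_nPow_neg_ne_zero hq one_pos

lemma nBracket_spec {h : ℂ} (hq : ∀ k : ℕ, 0 < k → nPow h 1 ^ k ≠ 1) (x : ℂ) :
    (nPow h 1 - nPow h (-1)) * nBracket h x = nPow h x - nPow h (-x) :=
  mul_div_cancel₀ _ (nPow_one_sub_ne_zero hq)

lemma isBracket_nBracket {h : ℂ} (hq : ∀ k : ℕ, 0 < k → nPow h 1 ^ k ≠ 1) :
    IsBracket (nBracket h) (nPow h 1 + nPow h (-1)) :=
  IsBracket.of_exp (nPow h) _ (nPow_add h) (nPow_one_sub_ne_zero hq)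
    (nBracket_spec hq)

lemma nBracket_natCast_ne_zero {h : ℂ} (hq : ∀ k : ℕ, 0 < k → nPow h 1 ^ k ≠ 1) {k : ℕ}
    (hk : 0 < k) : nBracket h k ≠ 0 :=
  div_ne_zero (nPow_sub_nPow_neg_ne_zero hq hk) (nPow_one_sub_ne_zero hq)

lemma qPow_eq_rescale (x : ℂ) :
    qPow x = PowerSeries.rescale (x / 2) (PowerSeries.exp ℂ) := by
  ext k
  rw [qPow, PowerSeries.coeff_mk, PowerSeries.coeff_rescale, PowerSeries.coeff_exp, div_pow]
  simp only [smul_eq_mul, map_div₀, map_one, map_natCast]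
  have : (k.factorial : ℂ) ≠ 0 := by exact_mod_cast k.factorial_ne_zero
  field_simp

lemma qPow_add (x y : ℂ) : qPow (x + y) = qPow x * qPow y := by
  rw [qPow_eq_rescale, qPow_eq_rescale, qPow_eq_rescale, add_div,
    PowerSeries.exp_mul_exp_eq_exp_add]

lemma qPow_one_sub_ne_zero : qPow (1 : ℂ) - qPow (-1) ≠ 0 := by
  rw [qPow_sub]
  refine mul_ne_zero PowerSeries.X_ne_zero fun h => ?_
  simpa [qSinh] using congrArg (PowerSeries.coeff 0) h

lemma isBracket_fBracket :
    IsBracket (fBracket (A := ℂ)) (qPow (1 : ℂ) + qPow (-1)) :=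
  IsBracket.of_exp qPow _ qPow_add qPow_one_sub_ne_zero fun x => by
    simpa using fBracket_spec x

lemma constantCoeff_fBracket (x : ℂ) : PowerSeries.constantCoeff (fBracket x) = x := by
  have h1 : PowerSeries.constantCoeff (qSinh x) = x := by
    rw [← PowerSeries.coeff_zero_eq_constantCoeff_apply]; simp [qSinh]
  have h2 : PowerSeries.constantCoeff (qSinh (1 : ℂ)) = 1 := by
    rw [← PowerSeries.coeff_zero_eq_constantCoeff_apply]; simp [qSinh]
  simp [fBracket, h1, h2]

/-- By Hensel's lemma a complex power series with nonzero constant term has a square root. -/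
lemma exists_sq_eq_powerSeries (F : ℂ⟦X⟧) (hF : PowerSeries.constantCoeff F ≠ 0) :
    ∃ G : ℂ⟦X⟧, G ^ 2 = F := by
  obtain ⟨z, hz⟩ := IsAlgClosed.exists_pow_nat_eq (PowerSeries.constantCoeff F) two_pos
  have hz0 : z ≠ 0 := by rintro rfl; exact hF (by rw [← hz]; simp)
  let P : Polynomial ℂ⟦X⟧ := Polynomial.X ^ 2 - Polynomial.C F
  obtain ⟨G, hG, -⟩ := HenselianRing.is_henselian (I := Ideal.span {(PowerSeries.X : ℂ⟦X⟧)}) P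
    (Polynomial.monic_X_pow_sub_C F two_ne_zero) (PowerSeries.C z)
    (by
      rw [Ideal.mem_span_singleton, PowerSeries.X_dvd_iff]
      simp [P, hz])
    (by
      refine IsUnit.map _ (PowerSeries.isUnit_iff_constantCoeff.2 ?_)
      simp [P, hz0])
  refine ⟨G, ?_⟩
  have : Polynomial.eval G P = 0 := hG
  simpa [P, sub_eq_zero] using this

lemma exists_isRoots_fBracket (p : ℂ) : ∃ s t, IsRoots (fBracket (A := ℂ)) p s t := by
  have hs : ∀ x : ℂ, ∃ G : ℂ⟦X⟧, G ^ 2 = fBracket x := fun x => by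
    by_cases hx : x = 0
    · exact ⟨0, by rw [hx, isBracket_fBracket.zero]; simp⟩
    · exact exists_sq_eq_powerSeries _ (by rwa [constantCoeff_fBracket])
  have ht : ∀ k : ℕ, ∃ G : ℂ⟦X⟧, G ^ 2 * (k : ℂ⟦X⟧) = fBracket (k : ℂ) := fun k => by
    rcases Nat.eq_zero_or_pos k with rfl | hk
    · exact ⟨0, by simp [isBracket_fBracket.zero]⟩
    · have hk0 : (k : ℂ) ≠ 0 := by exact_mod_cast hk.ne'
      obtain ⟨G, hG⟩ := exists_sq_eq_powerSeries (fBracket (k : ℂ) * PowerSeries.C ((k : ℂ)⁻¹))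
        (by simp [constantCoeff_fBracket, hk0])
      refine ⟨G, ?_⟩
      rw [hG, mul_assoc, ← map_natCast (PowerSeries.C (R := ℂ)), ← map_mul, inv_mul_cancel₀ hk0,
        map_one, mul_one]
  choose s hs using fun k : ℤ => hs (p - k)
  choose t ht using ht
  exact ⟨s, t, hs, ht⟩

lemma exists_isRoots_nBracket (h p : ℂ) : ∃ s t, IsRoots (nBracket h) p s t := by
  have hs : ∀ x : ℂ, ∃ z : ℂ, z ^ 2 = x := fun x => IsAlgClosed.exists_pow_nat_eq x two_pos
  have ht : ∀ k : ℕ, ∃ z : ℂ, z ^ 2 * (k : ℂ) = nBracket h (k : ℂ) := fun k => by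
    rcases Nat.eq_zero_or_pos k with rfl | hk
    · exact ⟨0, by simp [nBracket]⟩
    · obtain ⟨z, hz⟩ := hs (nBracket h k / k)
      exact ⟨z, by rw [hz, div_mul_cancel₀ _ (by exact_mod_cast hk.ne')]⟩
  choose s hs using fun k : ℤ => hs (nBracket h (p - k))
  choose t ht using ht
  exact ⟨s, t, hs, ht⟩

/-! ### Transport of the relations along ring homomorphisms -/

lemma ite_sub_ite_smul {R B : Type*} [CommRing R] [Ring B] [Algebra R B] (P Q : Prop) [Decidable P]
    [Decidable Q] (x : B) : ((if P then 1 else 0) - (if Q then 1 else 0) : R) • x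
      = ((if P then 1 else 0) - (if Q then 1 else 0)) * x := by
  split_ifs <;> simp

lemma neg_ite_add_ite_smul {R B : Type*} [CommRing R] [Ring B] [Algebra R B] (P Q : Prop)
    [Decidable P] [Decidable Q] (x : B) : (-(if P then 1 else 0) + (if Q then 1 else 0) : R) • x
      = (-(if P then 1 else 0) + (if Q then 1 else 0)) * x := by
  split_ifs <;> simp

lemma SerreRel.map_eq {A B E : Type*} [Ring A] [Ring B] [Ring E] {n m : ℕ} (φ : A →+* B)
    (Ψ : E →+* B) {c : A} {x : ℕ → A} {c' : E} {x' : ℕ → E} (hc : φ c = Ψ c')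
    (hx : ∀ i, 1 ≤ i ∧ i < n + m → φ (x i) = Ψ (x' i))
    (hrel : ∀ y z, SerreRel n m c' x' y z → y = z) {y z : A} (hyz : SerreRel n m c x y z) :
    φ y = φ z := by
  cases hyz with
  | comm i j hi hj hij =>
    simpa [hx i hi, hx j hj] using congrArg Ψ (hrel _ _ (.comm i j hi hj hij))
  | sq hnm => simpa [hx n hnm] using congrArg Ψ (hrel _ _ (.sq hnm))
  | up i hi hin =>
    simpa [hx i ⟨hi.1, by omega⟩, hx (i + 1) ⟨by omega, hi.2⟩, hc]
      using congrArg Ψ (hrel _ _ (.up i hi hin))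
  | down i hi hin =>
    simpa [hx i ⟨hi.1, by omega⟩, hx (i + 1) ⟨by omega, hi.2⟩, hc]
      using congrArg Ψ (hrel _ _ (.down i hi hin))
  | quartic hn hm =>
    simpa [hx n ⟨by omega, by omega⟩, hx (n + 1) ⟨by omega, hm⟩, hx (n - 1) ⟨by omega, by omega⟩,
      hc] using congrArg Ψ (hrel _ _ (.quartic hn hm))

/-- A homomorphism `φ` respects the relations if it takes the generators to the images under some
`Ψ` of elements that satisfy the relations. -/
lemma GlRel.map_eq {A B E : Type*} [Ring A] [Ring B] [Ring E] {n m : ℕ} (φ : A →+* B)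
    (Ψ : E →+* B) {c : A} {h e f b : ℕ → A} {c' : E} {h' e' f' b' : ℕ → E} (hc : φ c = Ψ c')
    (hh : ∀ j, 1 ≤ j ∧ j ≤ n + m → φ (h j) = Ψ (h' j))
    (he : ∀ i, 1 ≤ i ∧ i < n + m → φ (e i) = Ψ (e' i))
    (hf : ∀ i, 1 ≤ i ∧ i < n + m → φ (f i) = Ψ (f' i))
    (hb : ∀ i, 1 ≤ i ∧ i < n + m → φ (b i) = Ψ (b' i))
    (hrel : ∀ y z, GlRel n m c' h' e' f' b' y z → y = z) {y z : A}
    (hyz : GlRel n m c h e f b y z) : φ y = φ z := by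
  cases hyz with
  | hh i j hi hj => simpa [hh i hi, hh j hj] using congrArg Ψ (hrel _ _ (.hh i j hi hj))
  | he i j hi hj =>
    have := congrArg Ψ (hrel _ _ (.he i j hi hj))
    rw [map_sub, map_mul, map_mul] at this
    rw [map_sub, map_mul, map_mul, map_mul, map_sub, hh i hi, he j hj, this]
    split_ifs <;> simp
  | hf i j hi hj =>
    have := congrArg Ψ (hrel _ _ (.hf i j hi hj))
    rw [map_sub, map_mul, map_mul] at this
    rw [map_sub, map_mul, map_mul, map_mul, map_add, map_neg, hh i hi, hf j hj, this]
    split_ifs <;> simp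
  | ef_ne i j hi hj hij =>
    simpa [he i hi, hf j hj] using congrArg Ψ (hrel _ _ (.ef_ne i j hi hj hij))
  | ef_even i hi hin =>
    simpa [he i hi, hf i hi, hb i hi] using congrArg Ψ (hrel _ _ (.ef_even i hi hin))
  | ef_odd hnm =>
    simpa [he n hnm, hf n hnm, hb n hnm] using congrArg Ψ (hrel _ _ (.ef_odd hnm))
  | serre_e _ _ hxy => exact hxy.map_eq φ Ψ hc he fun y z h => hrel _ _ (.serre_e y z h)
  | serre_f _ _ hxy => exact hxy.map_eq φ Ψ hc hf fun y z h => hrel _ _ (.serre_f y z h)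

/-! ### Serre relations for hopping operators -/

/-- The displacement of a configuration when one particle hops from site `j` to site `i`. -/
def hop (i j : ℕ) : ℕ → ℤ :=
  fun k => (if k = i then 1 else 0) - (if k = j then 1 else 0)

lemma neg_hop (i j : ℕ) : -hop i j = hop j i := by
  ext k; simp [hop]

lemma hop_fst (a : ℕ) : hop a (a + 1) a = 1 := by simp [hop]

lemma hop_snd (a : ℕ) : hop a (a + 1) (a + 1) = -1 := by simp [hop]

lemma hop_of_ne {i j k : ℕ} (hi : k ≠ i) (hj : k ≠ j) : hop i j k = 0 := by simp [hop, hi, hj]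

/-- Operators that move one particle from site `i` to site `i - 1` satisfy the Serre relations, if
the matrix elements are products of amplitudes `σ` of the two sites which obey the three-term
identity of the `q`-bracket at the Bose sites `i < n` and the exclusion principle at the Fermi
sites `i ≥ n`. -/
lemma serreRel_eq_of_hop {R V : Type*} [CommRing R] [AddCommGroup V] [Module R V] {n m : ℕ}
    {c : R} {σ : ℕ → ℤ → R} (u : (ℕ → ℤ) → V)
    (hu : ∀ S T : Module.End R V, (∀ x, S (u x) = T (u x)) → S = T)
    (hbose : ∀ i, i < n → ∀ k, σ i k * (σ i (k + 1) ^ 2 + σ i (k - 1) ^ 2 - c * σ i k ^ 2) = 0)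
    (hfermi : ∀ i, n ≤ i → ∀ k, σ i k * σ i (k + 1) = 0)
    {X : ℕ → Module.End R V}
    (hX : ∀ i, 1 ≤ i ∧ i < n + m → ∀ x,
      X i (u x) = (σ (i - 1) (x (i - 1) + 1) * σ i (x i)) • u (x + hop (i - 1) i))
    {S T : Module.End R V} (hST : SerreRel n m (algebraMap R (Module.End R V) c) X S T) :
    S = T := by
  refine hu _ _ fun x => ?_
  cases hST with
  | comm i j hi hj hij =>
    rcases eq_or_ne i j with rfl | hne
    · rfl
    obtain ⟨a, rfl⟩ : ∃ a, i = a + 1 := ⟨i - 1, by omega⟩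
    obtain ⟨b, rfl⟩ : ∃ b, j = b + 1 := ⟨j - 1, by omega⟩
    have hab : a ≠ b := by omega
    have hab1 : a ≠ b + 1 := by omega
    have hba1 : b ≠ a + 1 := by omega
    rw [Module.End.mul_apply, Module.End.mul_apply, hX _ hj, hX _ hi, map_smul, map_smul, hX _ hi,
      hX _ hj, add_right_comm x]
    simp only [add_tsub_cancel_right, Pi.add_apply, hop, hab, hab.symm, hab1, hab1.symm, hba1,
      hba1.symm, if_false, add_left_inj, smul_smul, sub_zero, add_zero]
    congr 1
    ring
  | sq hnm =>
    rw [pow_two, Module.End.mul_apply, hX _ hnm, map_smul, hX _ hnm, smul_smul,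
      LinearMap.zero_apply]
    have h1 : (x + hop (n - 1) n) n = x n - 1 := by
      simp [hop, show n ≠ n - 1 by omega, sub_eq_add_neg]
    have h2 := hfermi n le_rfl (x n - 1)
    rw [sub_add_cancel] at h2
    rw [h1, show ∀ y z w : R, y * σ n (x n) * (z * w) = y * z * (w * σ n (x n)) by intros; ring,
      h2, mul_zero, zero_smul]
  | up i hi hin =>
    obtain ⟨a, rfl⟩ : ∃ a, i = a + 1 := ⟨i - 1, by omega⟩
    have hi' : 1 ≤ a + 1 ∧ a + 1 < n + m := ⟨hi.1, by omega⟩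
    have hi2 : 1 ≤ a + 1 + 1 ∧ a + 1 + 1 < n + m := ⟨by omega, hi.2⟩
    -- All monomials displace `x` by the same vector, so only the scalar factors are to be compared.
    have e1 : x + hop (a + 1) (a + 1 + 1) + hop a (a + 1) + hop a (a + 1)
      = x + hop a (a + 1) + hop a (a + 1) + hop (a + 1) (a + 1 + 1) := by abel
    have e2 : x + hop a (a + 1) + hop (a + 1) (a + 1 + 1) + hop a (a + 1)
      = x + hop a (a + 1) + hop a (a + 1) + hop (a + 1) (a + 1 + 1) := by abel
    simp only [pow_two, LinearMap.add_apply, LinearMap.sub_apply, Module.End.mul_apply,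
      Module.algebraMap_end_apply, LinearMap.zero_apply, map_smul, hX _ hi', hX _ hi2,
      add_tsub_cancel_right, e1, e2, smul_smul, ← sub_smul, ← add_smul]
    convert zero_smul R _
    simp only [Pi.add_apply, hop_fst, hop_snd, add_zero, neg_add_cancel_right,
      add_neg_cancel_right, hop_of_ne (show a ≠ a + 1 by omega) (show a ≠ a + 1 + 1 by omega),
      hop_of_ne (show a + 1 + 1 ≠ a by omega) (show a + 1 + 1 ≠ a + 1 by omega)]
    -- A Bose site `a + 1` gives the three-term identity; if it is a Fermi site, so is `a` because
    -- of `a + 1 ≠ n`, and two particles cannot enter `a`.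
    rcases lt_or_ge (a + 1) n with h | h
    · have := hbose _ h (x (a + 1))
      rw [sub_eq_add_neg (x (a + 1)) 1] at this
      linear_combination (σ a (x a + 1) * σ a (x a + 1 + 1) * σ (a + 2) (x (a + 2))) * this
    · have := hfermi a (by omega) (x a + 1)
      linear_combination (σ (a + 2) (x (a + 2)) * σ (a + 1) (x (a + 1)) *
        (σ (a + 1) (x (a + 1) + 1) ^ 2 + σ (a + 1) (x (a + 1) + -1) ^ 2
          - c * σ (a + 1) (x (a + 1)) ^ 2)) * this
  | down i hi hin =>
    obtain ⟨a, rfl⟩ : ∃ a, i = a + 1 := ⟨i - 1, by omega⟩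
    have hi' : 1 ≤ a + 1 ∧ a + 1 < n + m := ⟨hi.1, by omega⟩
    have hi2 : 1 ≤ a + 1 + 1 ∧ a + 1 + 1 < n + m := ⟨by omega, hi.2⟩
    have e1 : x + hop (a + 1) (a + 1 + 1) + hop (a + 1) (a + 1 + 1) + hop a (a + 1)
      = x + hop a (a + 1) + hop (a + 1) (a + 1 + 1) + hop (a + 1) (a + 1 + 1) := by abel
    have e2 : x + hop (a + 1) (a + 1 + 1) + hop a (a + 1) + hop (a + 1) (a + 1 + 1)
      = x + hop a (a + 1) + hop (a + 1) (a + 1 + 1) + hop (a + 1) (a + 1 + 1) := by abel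
    simp only [pow_two, LinearMap.add_apply, LinearMap.sub_apply, Module.End.mul_apply,
      Module.algebraMap_end_apply, LinearMap.zero_apply, map_smul, hX _ hi', hX _ hi2,
      add_tsub_cancel_right, e1, e2, smul_smul, ← sub_smul, ← add_smul]
    convert zero_smul R _
    simp only [Pi.add_apply, hop_fst, hop_snd, add_zero, neg_add_cancel_right,
      add_neg_cancel_right, hop_of_ne (show a ≠ a + 1 by omega) (show a ≠ a + 1 + 1 by omega),
      hop_of_ne (show a + 1 + 1 ≠ a by omega) (show a + 1 + 1 ≠ a + 1 by omega)]
    -- If `a + 2` is a Fermi site, two particles cannot leave it.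
    rcases lt_or_ge (a + 1 + 1) n with h | h
    · have := hbose (a + 1) (by omega) (x (a + 1) + 1)
      rw [add_sub_cancel_right] at this
      linear_combination (σ a (x a + 1) * σ (a + 2) (x (a + 2)) * σ (a + 2) (x (a + 2) + -1))
        * this
    · have := hfermi _ h (x (a + 1 + 1) + -1)
      rw [neg_add_cancel_right] at this
      linear_combination (σ a (x a + 1) * σ (a + 1) (x (a + 1) + 1) *
        (σ (a + 1) (x (a + 1)) ^ 2 + σ (a + 1) (x (a + 1) + 1 + 1) ^ 2
          - c * σ (a + 1) (x (a + 1) + 1) ^ 2)) * this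
  | quartic hn hm =>
    obtain ⟨a, rfl⟩ : ∃ a, n = a + 2 := ⟨n - 2, by omega⟩
    have h1 : 1 ≤ a + 1 ∧ a + 1 < a + 2 + m := ⟨by omega, by omega⟩
    have h2 : 1 ≤ a + 1 + 1 ∧ a + 1 + 1 < a + 2 + m := ⟨by omega, by omega⟩
    have h3 : 1 ≤ a + 1 + 1 + 1 ∧ a + 1 + 1 + 1 < a + 2 + m := ⟨by omega, hm⟩
    rw [show a + 2 - 1 = a + 1 by omega, show a + 2 = a + 1 + 1 by omega]
    generalize hv1 : hop a (a + 1) = v1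
    generalize hv2 : hop (a + 1) (a + 1 + 1) = v2
    generalize hv3 : hop (a + 1 + 1) (a + 1 + 1 + 1) = v3
    have e1 : x + v3 + v2 + v1 + v2 = x + v1 + v2 + v2 + v3 := by abel
    have e2 : x + v2 + v3 + v2 + v1 = x + v1 + v2 + v2 + v3 := by abel
    have e3 : x + v1 + v2 + v3 + v2 = x + v1 + v2 + v2 + v3 := by abel
    have e4 : x + v2 + v1 + v2 + v3 = x + v1 + v2 + v2 + v3 := by abel
    have e5 : x + v2 + v3 + v1 + v2 = x + v1 + v2 + v2 + v3 := by abel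
    simp only [LinearMap.add_apply, LinearMap.sub_apply, Module.End.mul_apply,
      Module.algebraMap_end_apply, LinearMap.zero_apply, map_smul, hX _ h1, hX _ h2, hX _ h3,
      add_tsub_cancel_right, hv1, hv2, hv3, e1, e2, e3, e4, e5, smul_smul, ← sub_smul,
      ← add_smul]
    convert zero_smul R _
    subst hv1 hv2 hv3
    simp only [Pi.add_apply, hop_fst, hop_snd, add_zero, neg_add_cancel_right,
      add_neg_cancel_right, hop_of_ne (show a ≠ a + 1 by omega) (show a ≠ a + 1 + 1 by omega),
      hop_of_ne (show a ≠ a + 1 + 1 by omega) (show a ≠ a + 1 + 1 + 1 by omega),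
      hop_of_ne (show a + 1 ≠ a + 1 + 1 by omega) (show a + 1 ≠ a + 1 + 1 + 1 by omega),
      hop_of_ne (show a + 1 + 1 ≠ a by omega) (show a + 1 + 1 ≠ a + 1 by omega),
      hop_of_ne (show a + 1 + 1 + 1 ≠ a by omega) (show a + 1 + 1 + 1 ≠ a + 1 by omega),
      hop_of_ne (show a + 1 + 1 + 1 ≠ a + 1 by omega) (show a + 1 + 1 + 1 ≠ a + 1 + 1 by omega)]
    -- Site `a + 1` is the last Bose site and `a + 2` the first Fermi site; the terms which the
    -- three-term identity leaves over contain a double occupation of `a + 2`.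
    have hb := hbose (a + 1) (by omega) (x (a + 1) + 1)
    rw [add_sub_cancel_right] at hb
    have hf1 := hfermi (a + 2) le_rfl (x (a + 2))
    have hf2 := hfermi (a + 2) le_rfl (x (a + 2) + -1)
    rw [neg_add_cancel_right] at hf2
    linear_combination
      (σ a (x a + 1) * σ (a + 3) (x (a + 3)) * σ (a + 2) (x (a + 2)) ^ 3) * hb
      + (σ a (x a + 1) * σ (a + 3) (x (a + 3)) * σ (a + 1) (x (a + 1) + 1) ^ 3
        * σ (a + 2) (x (a + 2) + 1)) * hf1
      + (σ a (x a + 1) * σ (a + 3) (x (a + 3)) * σ (a + 1) (x (a + 1) + 1) ^ 3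
        * σ (a + 2) (x (a + 2) + -1)) * hf2

/-! ### Configurations with an adjoined site `0` -/

variable {n m : ℕ}

/-- The configuration `l` with an additional occupation number `- (l_1 + … + l_{n+m-1})` at the
site `0`, so that the occupation numbers add up to zero. -/
def Occ.config (l : Occ n m) : ℕ → ℤ := fun i => if i = 0 then -(l.total : ℤ) else l.1 i

lemma Occ.config_zero (l : Occ n m) : l.config 0 = -(l.total : ℤ) := rfl

lemma Occ.config_of_ne (l : Occ n m) {i : ℕ} (hi : i ≠ 0) : l.config i = l.1 i := if_neg hi

lemma Occ.apply_zero (l : Occ n m) : l.1 0 = 0 := by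
  by_contra h
  exact absurd (l.2.1 0 h).1 (by omega)

lemma Occ.config_injective : Function.Injective (Occ.config (n := n) (m := m)) := fun l l' h =>
  Occ.ext' fun i => by
    rcases eq_or_ne i 0 with rfl | hi
    · rw [l.apply_zero, l'.apply_zero]
    · have := congrFun h i
      rw [l.config_of_ne hi, l'.config_of_ne hi] at this
      exact_mod_cast this

lemma Occ.config_zero_eq_neg_sum (l : Occ n m) :
    l.config 0 = -∑ i ∈ Finset.Ico 1 (n + m), l.config i := by
  rw [l.config_zero, Occ.total, Nat.cast_sum, neg_inj]
  exact Finset.sum_congr rfl fun i hi =>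
    (l.config_of_ne (by have := (Finset.mem_Ico.1 hi).1; omega)).symm

lemma Occ.apply_eq_zero (l : Occ n m) {i : ℕ} (hi : n + m ≤ i) : l.1 i = 0 := by
  by_contra h
  exact absurd (l.2.1 i h).2 (by omega)

lemma Occ.exists_config_eq (hn : 1 ≤ n) (x : ℕ → ℤ)
    (h0 : x 0 = -∑ i ∈ Finset.Ico 1 (n + m), x i) (hnonneg : ∀ i, 1 ≤ i → 0 ≤ x i)
    (hout : ∀ i, n + m ≤ i → x i = 0) (hle : ∀ i, n ≤ i → x i ≤ 1) :
    ∃ l : Occ n m, l.config = x := by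
  obtain ⟨l, hl⟩ : ∃ l : Occ n m, ∀ i, l.1 i = if i = 0 then 0 else (x i).toNat := by
    refine ⟨⟨fun i => if i = 0 then 0 else (x i).toNat, fun i hi => ?_, fun i hi => ?_⟩,
      fun _ => rfl⟩
    · have h1 : i ≠ 0 := by rintro rfl; simp at hi
      simp only [h1, if_false] at hi
      refine ⟨by omega, ?_⟩
      by_contra hc
      exact hi (by rw [hout i (by omega)]; rfl)
    · have := hle i hi
      simp only [show i ≠ 0 by omega, if_false]
      omega
  have hne : ∀ i, i ≠ 0 → l.config i = x i := fun i hi => by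
    rw [l.config_of_ne hi, hl, if_neg hi, Int.toNat_of_nonneg (hnonneg i (by omega))]
  refine ⟨l, funext fun i => ?_⟩
  rcases eq_or_ne i 0 with rfl | hi
  · rw [l.config_zero_eq_neg_sum, h0, neg_inj]
    exact Finset.sum_congr rfl fun i hi => hne i (by have := (Finset.mem_Ico.1 hi).1; omega)
  · exact hne i hi

section Kets

variable (R : Type*) [CommRing R]

open Classical in
/-- The basis vector of the configuration `x`, and zero if `x` violates the constraints on
occupation numbers. -/
def ket (x : ℕ → ℤ) : Occ n m →₀ R :=
  if h : ∃ l : Occ n m, l.config = x then Finsupp.single h.choose 1 else 0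

variable {R}

lemma ket_config (l : Occ n m) : ket R l.config = Finsupp.single l 1 := by
  have h : ∃ l' : Occ n m, l'.config = l.config := ⟨l, rfl⟩
  rw [ket, dif_pos h, Occ.config_injective h.choose_spec]

lemma ket_eq_zero {x : ℕ → ℤ} (h : ∀ l : Occ n m, l.config ≠ x) :
    ket R x = (0 : Occ n m →₀ R) :=
  dif_neg fun ⟨l, hl⟩ => h l hl

lemma end_ext {S T : Module.End R (Occ n m →₀ R)}
    (h : ∀ l : Occ n m, S (Finsupp.single l 1) = T (Finsupp.single l 1)) : S = T :=
  Finsupp.lhom_ext' fun l => LinearMap.ext_ring (h l)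

lemma end_ext_ket {S T : Module.End R (Occ n m →₀ R)} (h : ∀ x, S (ket R x) = T (ket R x)) :
    S = T := end_ext fun l => by simpa only [ket_config] using h l.config

/-- The operator that displaces configurations by `v`, with matrix elements given by `w`. -/
def moveOp (v : ℕ → ℤ) (w : (ℕ → ℤ) → R) : Module.End R (Occ n m →₀ R) :=
  Finsupp.linearCombination R fun l : Occ n m => w l.config • ket R (l.config + v)

lemma moveOp_single (v : ℕ → ℤ) (w : (ℕ → ℤ) → R) (l : Occ n m) :
    moveOp v w (Finsupp.single l 1) = w l.config • ket R (l.config + v) := by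
  rw [moveOp, Finsupp.linearCombination_single, one_smul]

lemma moveOp_ket {v : ℕ → ℤ} {w : (ℕ → ℤ) → R}
    (hw : ∀ (x : ℕ → ℤ) (l : Occ n m), l.config = x + v → w x ≠ 0 →
      ∃ l' : Occ n m, l'.config = x) (x : ℕ → ℤ) :
    moveOp v w (ket R x) = w x • (ket R (x + v) : Occ n m →₀ R) := by
  by_cases h : ∃ l : Occ n m, l.config = x
  · obtain ⟨l, rfl⟩ := h
    rw [ket_config, moveOp_single]
  · rw [ket_eq_zero fun l hl => h ⟨l, hl⟩, map_zero]
    by_cases h' : ∃ l : Occ n m, l.config = x + v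
    · obtain ⟨l, hl⟩ := h'
      by_cases h0 : w x = 0
      · rw [h0, zero_smul]
      · exact absurd (hw x l hl h0) h
    · rw [ket_eq_zero fun l hl => h' ⟨l, hl⟩, smul_zero]

/-- Multiplication of `|l)` by `φ l`. -/
def diagOp (φ : Occ n m → R) : Module.End R (Occ n m →₀ R) :=
  Finsupp.linearCombination R fun l => Finsupp.single l (φ l)

lemma diagOp_single (φ : Occ n m → R) (l : Occ n m) :
    diagOp φ (Finsupp.single l 1) = φ l • Finsupp.single l 1 := by
  rw [diagOp, Finsupp.linearCombination_single, one_smul, Finsupp.smul_single, smul_eq_mul,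
    mul_one]

lemma diagOp_ket (φ : (ℕ → ℤ) → R) (x : ℕ → ℤ) :
    diagOp (fun l => φ l.config) (ket R x) = φ x • (ket R x : Occ n m →₀ R) := by
  by_cases h : ∃ l : Occ n m, l.config = x
  · obtain ⟨l, rfl⟩ := h
    rw [ket_config, diagOp_single]
  · rw [ket_eq_zero fun l hl => h ⟨l, hl⟩, map_zero, smul_zero]

lemma diagOp_mul (φ ψ : Occ n m → R) : diagOp φ * diagOp ψ = diagOp (φ * ψ) :=
  end_ext fun l => by
    rw [Module.End.mul_apply, diagOp_single, diagOp_single, map_smul, diagOp_single, smul_smul,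
      mul_comm]; rfl

/-- Displacing a configuration by `v` changes the value of a function of the number operators. -/
lemma diagOp_mul_moveOp {v : ℕ → ℤ} {w : (ℕ → ℤ) → R} {φ ψ : Occ n m → R}
    (h : ∀ l l' : Occ n m, l'.config = l.config + v → φ l' = ψ l) :
    diagOp φ * moveOp v w = moveOp v w * diagOp ψ := by
  refine end_ext fun l => ?_
  rw [Module.End.mul_apply, Module.End.mul_apply, diagOp_single, moveOp_single, map_smul, map_smul,
    moveOp_single]
  by_cases h' : ∃ l' : Occ n m, l'.config = l.config + v
  · obtain ⟨l', hl'⟩ := h'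
    rw [← hl', ket_config, diagOp_single, h l l' hl', smul_comm]
  · rw [ket_eq_zero fun l hl => h' ⟨l, hl⟩, map_zero, smul_zero, smul_zero]

end Kets

/-! ### The relations for the hopping operators -/

section Relations

variable {R : Type*} [CommRing R]

/-- The conditions on the amplitudes `ρ i k` of the Holstein-Primakoff realization: the square of
`ρ i k` is `[k]` at the Bose sites `1 ≤ i < n` and `[p + k]` at the site `0`; at the Fermi sites
`ρ i k` is `1` for `k = 1` and `0` otherwise. -/
structure IsAmplitude (n : ℕ) (br : ℂ → R) (p : ℂ) (ρ : ℕ → ℤ → R) : Prop where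
  bose_of_nonpos : ∀ i, 1 ≤ i → i < n → ∀ k ≤ 0, ρ i k = 0
  bose_sq : ∀ i, 1 ≤ i → i < n → ∀ k, 0 ≤ k → ρ i k ^ 2 = br k
  zero_sq : ∀ k : ℤ, ρ 0 k ^ 2 = br (p + k)
  fermi : ∀ i, n ≤ i → ∀ k, ρ i k = if k = 1 then 1 else 0

/-- The operator that moves a particle from site `i` to site `i - 1`. -/
def opE (ρ : ℕ → ℤ → R) (i : ℕ) : Module.End R (Occ n m →₀ R) :=
  moveOp (hop (i - 1) i) fun x => ρ (i - 1) (x (i - 1) + 1) * ρ i (x i)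

/-- The operator that moves a particle from site `i - 1` to site `i`. -/
def opF (ρ : ℕ → ℤ → R) (i : ℕ) : Module.End R (Occ n m →₀ R) :=
  moveOp (hop i (i - 1)) fun x => ρ (i - 1) (x (i - 1)) * ρ i (x i + 1)

/-- The value of `π (h_j)` at a configuration. -/
def weight (p : ℂ) (j : ℕ) (x : ℕ → ℤ) : ℂ := (if j = 1 then p else 0) + (x (j - 1) : ℂ)

variable {br : ℂ → R} {p : ℂ} {ρ : ℕ → ℤ → R}

lemma IsAmplitude.zero (hρ : IsAmplitude n br p ρ) {i : ℕ} (hi : 1 ≤ i) : ρ i 0 = 0 := by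
  rcases lt_or_ge i n with h | h
  · exact hρ.bose_of_nonpos i hi h 0 le_rfl
  · rw [hρ.fermi i h, if_neg (by norm_num)]

lemma IsAmplitude.fermi_two (hρ : IsAmplitude n br p ρ) {i : ℕ} (hi : n ≤ i) : ρ i 2 = 0 := by
  rw [hρ.fermi i hi, if_neg (by norm_num)]

lemma IsAmplitude.fermi_mul (hρ : IsAmplitude n br p ρ) {i : ℕ} (hi : n ≤ i) (k : ℤ) :
    ρ i k * ρ i (k + 1) = 0 := by
  rw [hρ.fermi i hi, hρ.fermi i hi]
  split_ifs <;> first | omega | simp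

lemma IsAmplitude.bose_three_term {c : R} (hbr : IsBracket br c) (hρ : IsAmplitude n br p ρ)
    {i : ℕ} (hi : i < n) (k : ℤ) :
    ρ i k * (ρ i (k + 1) ^ 2 + ρ i (k - 1) ^ 2 - c * ρ i k ^ 2) = 0 := by
  rcases Nat.eq_zero_or_pos i with rfl | h0
  · have := hbr.add_sub (p + k)
    simp only [hρ.zero_sq]
    push_cast
    rw [← add_assoc, ← add_sub_assoc, this, sub_self, mul_zero]
  · rcases le_or_gt k 0 with hk | hk
    · rw [hρ.bose_of_nonpos i h0 hi k hk, zero_mul]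
    · have := hbr.add_sub k
      simp only [hρ.bose_sq i h0 hi (k + 1) (by omega), hρ.bose_sq i h0 hi (k - 1) (by omega),
        hρ.bose_sq i h0 hi k hk.le]
      push_cast
      rw [this, sub_self, mul_zero]

lemma sum_hop {i j : ℕ} {s : Finset ℕ} (hi : i ∈ s) (hj : j ∈ s) : ∑ k ∈ s, hop i j k = 0 := by
  simp [hop, hi, hj]

/-- A displacement along `hop i j` that ends in an allowed configuration starts in one, unless the
site `i` was empty before or the site `j` was overfull. -/
lemma Occ.exists_config_eq_of_add_hop (hn : 1 ≤ n) {i j : ℕ} (hi : i < n + m) (hj : j < n + m)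
    {x : ℕ → ℤ} {l : Occ n m} (hl : l.config = x + hop i j)
    (hxi : 1 ≤ i → x i ≠ -1) (hxj : n ≤ j → x j ≠ 2) : ∃ l' : Occ n m, l'.config = x := by
  have hval : ∀ k, x k = l.config k - hop i j k := fun k => by rw [hl]; simp
  rcases eq_or_ne i j with rfl | hij
  · exact ⟨l, by funext k; simp [hval, hop]⟩
  have hrange : insert 0 (Finset.Ico 1 (n + m)) = Finset.range (n + m) := by
    rw [Finset.range_eq_Ico, ← Finset.insert_Ico_add_one_left_eq_Ico (by omega : 0 < n + m),
      zero_add]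
  have hsum : ∀ y : ℕ → ℤ,
      ∑ k ∈ Finset.range (n + m), y k = y 0 + ∑ k ∈ Finset.Ico 1 (n + m), y k := fun y => by
    rw [← hrange, Finset.sum_insert (by simp)]
  refine Occ.exists_config_eq hn x ?_ (fun k hk => ?_) (fun k hk => ?_) fun k hk => ?_
  · have h1 := hsum l.config
    have h2 := hsum x
    have h3 := l.config_zero_eq_neg_sum
    have h4 : ∑ k ∈ Finset.range (n + m), x k = ∑ k ∈ Finset.range (n + m), l.config k := by
      rw [Finset.sum_congr rfl fun k _ => hval k, Finset.sum_sub_distrib,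
        sum_hop (Finset.mem_range.2 hi) (Finset.mem_range.2 hj), sub_zero]
    omega
  · have h1 := hval k
    rw [l.config_of_ne (by omega)] at h1
    rcases eq_or_ne k i with rfl | hki
    · have := hxi hk
      simp only [hop, if_true, hij, if_false] at h1
      omega
    · simp only [hop, hki, if_false] at h1
      split_ifs at h1 <;> omega
  · rw [hval, hop_of_ne (by omega) (by omega), l.config_of_ne (by omega), l.apply_eq_zero hk]
    rfl
  · have h1 := hval k
    have h2 := l.2.2 k hk
    rw [l.config_of_ne (by omega)] at h1
    rcases eq_or_ne k j with rfl | hkj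
    · have := hxj hk
      simp only [hop, if_true, hij.symm, if_false] at h1
      omega
    · simp only [hop, hkj, if_false] at h1
      split_ifs at h1 <;> omega

lemma opE_ket (hn : 1 ≤ n) (hρ : IsAmplitude n br p ρ) {i : ℕ} (hi : 1 ≤ i ∧ i < n + m)
    (x : ℕ → ℤ) : opE ρ i (ket R x)
      = (ρ (i - 1) (x (i - 1) + 1) * ρ i (x i)) • (ket R (x + hop (i - 1) i) : Occ n m →₀ R) := by
  refine moveOp_ket (w := fun x => ρ (i - 1) (x (i - 1) + 1) * ρ i (x i)) (fun x l hl hx => ?_) x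
  refine Occ.exists_config_eq_of_add_hop hn (by omega) hi.2 hl (fun h1 h => hx ?_) fun h1 h => hx ?_
  · simp [h, hρ.zero h1]
  · simp [h, hρ.fermi_two h1]

lemma opF_ket (hn : 1 ≤ n) (hρ : IsAmplitude n br p ρ) {i : ℕ} (hi : 1 ≤ i ∧ i < n + m)
    (x : ℕ → ℤ) : opF ρ i (ket R x)
      = (ρ (i - 1) (x (i - 1)) * ρ i (x i + 1)) • (ket R (x + hop i (i - 1)) : Occ n m →₀ R) := by
  refine moveOp_ket (w := fun x => ρ (i - 1) (x (i - 1)) * ρ i (x i + 1)) (fun x l hl hx => ?_) x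
  refine Occ.exists_config_eq_of_add_hop hn hi.2 (by omega) hl (fun h1 h => hx ?_) fun h1 h => hx ?_
  · simp [h, hρ.zero h1]
  · simp [h, hρ.fermi_two h1]

lemma serreRel_opE {c : R} (hn : 1 ≤ n) (hbr : IsBracket br c) (hρ : IsAmplitude n br p ρ)
    {S T : Module.End R (Occ n m →₀ R)}
    (hST : SerreRel n m (algebraMap R (Module.End R (Occ n m →₀ R)) c) (opE ρ) S T) : S = T :=
  serreRel_eq_of_hop (σ := ρ) (ket R) (fun _ _ => end_ext_ket)
    (fun _ hi => hρ.bose_three_term hbr hi) (fun _ hi => hρ.fermi_mul hi)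
    (fun _ hi => opE_ket hn hρ hi) hST

/-- Under reflection of the occupation numbers the operators `opF` become hopping operators of the
same form as `opE`. -/
lemma serreRel_opF {c : R} (hn : 1 ≤ n) (hbr : IsBracket br c) (hρ : IsAmplitude n br p ρ)
    {S T : Module.End R (Occ n m →₀ R)}
    (hST : SerreRel n m (algebraMap R (Module.End R (Occ n m →₀ R)) c) (opF ρ) S T) : S = T := by
  refine serreRel_eq_of_hop (σ := fun i k => ρ i (1 - k)) (fun x => ket R (-x))
    (fun S T h => end_ext_ket fun x => by simpa using h (-x)) (fun i hi k => ?_)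
    (fun i hi k => ?_) (fun i hi x => ?_) hST
  · have := hρ.bose_three_term hbr hi (1 - k)
    rw [show 1 - (k + 1) = 1 - k - 1 by ring, show 1 - (k - 1) = 1 - k + 1 by ring]
    linear_combination this
  · have := hρ.fermi_mul hi (1 - (k + 1))
    rw [show 1 - (k + 1) + 1 = 1 - k by ring] at this
    rw [mul_comm, this]
  · rw [opF_ket hn hρ hi, neg_add, neg_hop]
    simp only [Pi.neg_apply]
    rw [show 1 - (x (i - 1) + 1) = -x (i - 1) by ring, show 1 - x i = -x i + 1 by ring]

end Relations

section Relations

variable {R : Type*} [CommRing R] {br : ℂ → R} {p : ℂ} {ρ : ℕ → ℤ → R}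

lemma weight_add_hop (p : ℂ) {j : ℕ} (x v : ℕ → ℤ) :
    weight p (j + 1) (x + v) = weight p (j + 1) x + (v j : ℂ) := by
  simp only [weight, add_tsub_cancel_right, Pi.add_apply, Int.cast_add]
  ring

lemma diagOp_comm_moveOp {v : ℕ → ℤ} {w : (ℕ → ℤ) → R} {φ : Occ n m → R} (d : R)
    (h : ∀ l l' : Occ n m, l'.config = l.config + v → φ l' = φ l + d) :
    diagOp φ * moveOp v w - moveOp v w * diagOp φ = d • moveOp v w := by
  rw [diagOp_mul_moveOp (ψ := fun l => φ l + d) h]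
  refine end_ext fun l => ?_
  rw [LinearMap.sub_apply, Module.End.mul_apply, Module.End.mul_apply, diagOp_single,
    diagOp_single, ← map_sub, ← sub_smul, add_sub_cancel_left, map_smul]
  rfl

lemma opE_mul_opF_ket (hn : 1 ≤ n) (hρ : IsAmplitude n br p ρ) {a : ℕ} (ha : a + 1 < n + m)
    (x : ℕ → ℤ) : (opE ρ (a + 1) * opF ρ (a + 1) : Module.End R _) (ket R x)
      = (ρ a (x a) ^ 2 * ρ (a + 1) (x (a + 1) + 1) ^ 2) • (ket R x : Occ n m →₀ R) := by
  have hi : 1 ≤ a + 1 ∧ a + 1 < n + m := ⟨by omega, ha⟩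
  rw [Module.End.mul_apply, opF_ket hn hρ hi, map_smul, opE_ket hn hρ hi, smul_smul]
  have h1 : x + hop (a + 1) a + hop a (a + 1) = x := by
    rw [← neg_hop a, add_assoc, neg_add_cancel, add_zero]
  simp only [add_tsub_cancel_right, h1]
  simp only [← neg_hop a, Pi.add_apply, Pi.neg_apply, hop_fst, hop_snd, neg_add_cancel_right,
    neg_neg]
  congr 1
  ring

lemma opF_mul_opE_ket (hn : 1 ≤ n) (hρ : IsAmplitude n br p ρ) {a : ℕ} (ha : a + 1 < n + m)
    (x : ℕ → ℤ) : (opF ρ (a + 1) * opE ρ (a + 1) : Module.End R _) (ket R x)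
      = (ρ a (x a + 1) ^ 2 * ρ (a + 1) (x (a + 1)) ^ 2) • (ket R x : Occ n m →₀ R) := by
  have hi : 1 ≤ a + 1 ∧ a + 1 < n + m := ⟨by omega, ha⟩
  rw [Module.End.mul_apply, opE_ket hn hρ hi, map_smul, opF_ket hn hρ hi, smul_smul]
  have h1 : x + hop a (a + 1) + hop (a + 1) a = x := by
    rw [← neg_hop a, add_assoc, add_neg_cancel, add_zero]
  simp only [add_tsub_cancel_right, h1]
  simp only [Pi.add_apply, hop_fst, hop_snd, neg_add_cancel_right]
  congr 1
  ring

lemma opE_mul_opF_of_ne (hn : 1 ≤ n) (hρ : IsAmplitude n br p ρ) {i j : ℕ}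
    (hi : 1 ≤ i ∧ i < n + m) (hj : 1 ≤ j ∧ j < n + m) (hij : i ≠ j) :
    (opE ρ i * opF ρ j : Module.End R (Occ n m →₀ R)) = opF ρ j * opE ρ i := by
  refine end_ext_ket fun x => ?_
  obtain ⟨a, rfl⟩ : ∃ a, i = a + 1 := ⟨i - 1, by omega⟩
  obtain ⟨b, rfl⟩ : ∃ b, j = b + 1 := ⟨j - 1, by omega⟩
  rw [Module.End.mul_apply, Module.End.mul_apply, opE_ket hn hρ hi, opF_ket hn hρ hj, map_smul,
    map_smul, opE_ket hn hρ hi, opF_ket hn hρ hj, add_right_comm x]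
  simp only [add_tsub_cancel_right, ← neg_hop b, smul_smul, Pi.add_apply, Pi.neg_apply]
  congr 1
  have hab : a ≠ b := by omega
  rcases eq_or_ne b (a + 1) with rfl | h1
  · simp only [hop_fst, hop_snd, hop_of_ne (show a ≠ a + 1 by omega) (show a ≠ a + 1 + 1 by omega),
      hop_of_ne (show a + 1 + 1 ≠ a by omega) (show a + 1 + 1 ≠ a + 1 by omega), neg_zero, add_zero]
    ring
  · rcases eq_or_ne a (b + 1) with rfl | h2
    · simp only [hop_fst, hop_snd,
        hop_of_ne (show b ≠ b + 1 by omega) (show b ≠ b + 1 + 1 by omega),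
        hop_of_ne (show b + 1 + 1 ≠ b by omega) (show b + 1 + 1 ≠ b + 1 by omega), neg_zero,
        add_zero, neg_neg]
      ring
    · simp only [hop_of_ne hab h2, hop_of_ne h1.symm (show a + 1 ≠ b + 1 by omega),
        hop_of_ne hab.symm h1, hop_of_ne h2.symm (show b + 1 ≠ a + 1 by omega), neg_zero, add_zero]
      ring

lemma Occ.config_fermi (hn : 1 ≤ n) (l : Occ n m) {i : ℕ} (hi : n ≤ i) :
    l.config i = 0 ∨ l.config i = 1 := by
  have := l.2.2 i hi
  rw [l.config_of_ne (by omega)]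
  omega

lemma IsAmplitude.sq_eq (hρ : IsAmplitude n br p ρ) {i : ℕ} (hi : i < n) {k : ℤ}
    (hk : 1 ≤ i → 0 ≤ k) : ρ i k ^ 2 = br ((if i = 0 then p else 0) + k) := by
  rcases Nat.eq_zero_or_pos i with rfl | h0
  · rw [hρ.zero_sq, if_pos rfl]
  · rw [hρ.bose_sq i h0 hi k (hk h0), if_neg (by omega), zero_add]

/-- The eigenvalue of the right-hand side of the relation between `e i` and `f i`. -/
def cartan (p : ℂ) (n i : ℕ) (x : ℕ → ℤ) : ℂ :=
  if i = n then weight p i x + weight p (i + 1) x else weight p i x - weight p (i + 1) x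

/-- The hopping operators satisfy the defining relations. -/
lemma glRel_op {c : R} [Algebra ℂ R] (hn : 1 ≤ n) (hbr : IsBracket br c)
    (hρ : IsAmplitude n br p ρ) {S T : Module.End R (Occ n m →₀ R)}
    (hST : GlRel n m (algebraMap R (Module.End R (Occ n m →₀ R)) c)
      (fun j => diagOp fun l => algebraMap ℂ R (weight p j l.config)) (opE ρ) (opF ρ)
      (fun i => diagOp fun l => br (cartan p n i l.config)) S T) : S = T := by
  cases hST with
  | hh i j hi hj => rw [diagOp_mul, diagOp_mul, mul_comm]
  | he i j hi hj =>
    obtain ⟨a, rfl⟩ : ∃ a, i = a + 1 := ⟨i - 1, by omega⟩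
    obtain ⟨b, rfl⟩ : ∃ b, j = b + 1 := ⟨j - 1, by omega⟩
    rw [opE, diagOp_comm_moveOp ((if a = b then 1 else 0) - (if a = b + 1 then 1 else 0) : R)]
    · simp only [add_left_inj]
      exact ite_sub_ite_smul (B := Module.End R (Occ n m →₀ R)) (a = b) (a = b + 1) _
    · intro l l' h
      rw [h, weight_add_hop, map_add]
      simp only [hop, add_tsub_cancel_right]
      split_ifs <;> simp
  | hf i j hi hj =>
    obtain ⟨a, rfl⟩ : ∃ a, i = a + 1 := ⟨i - 1, by omega⟩
    obtain ⟨b, rfl⟩ : ∃ b, j = b + 1 := ⟨j - 1, by omega⟩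
    rw [opF, diagOp_comm_moveOp (-(if a = b then 1 else 0) + (if a = b + 1 then 1 else 0) : R)]
    · simp only [add_left_inj]
      exact neg_ite_add_ite_smul (B := Module.End R (Occ n m →₀ R)) (a = b) (a = b + 1) _
    · intro l l' h
      rw [h, weight_add_hop, map_add]
      simp only [hop, add_tsub_cancel_right]
      split_ifs <;> simp
  | ef_ne i j hi hj hij => rw [opE_mul_opF_of_ne hn hρ hi hj hij, sub_self]
  | ef_even i hi hin =>
    obtain ⟨a, rfl⟩ : ∃ a, i = a + 1 := ⟨i - 1, by omega⟩
    refine end_ext fun l => ?_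
    rw [diagOp_single, ← ket_config, LinearMap.sub_apply, opE_mul_opF_ket hn hρ hi.2,
      opF_mul_opE_ket hn hρ hi.2, ← sub_smul]
    congr 1
    have hpos : ∀ k, 1 ≤ k → 0 ≤ l.config k := fun k hk => by
      rw [l.config_of_ne (by omega)]; omega
    simp only [cartan, hin, if_false, weight, add_tsub_cancel_right, Nat.add_eq_right,
      Nat.add_eq_zero_iff, one_ne_zero, and_false, zero_add]
    have h1 := hpos (a + 1) (by omega)
    -- Two Bose sites give `[x] [y+1] - [x+1] [y] = [x-y]`; at two Fermi sites there are four cases.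
    -- Both sites are of the same kind because of `a + 1 ≠ n`.
    rcases lt_or_ge (a + 1) n with h | h
    · have h0 : 1 ≤ a → 0 ≤ l.config a := hpos a
      rw [hρ.sq_eq (i := a) (by omega) h0,
        hρ.sq_eq (i := a) (by omega) (fun h => by have := h0 h; omega),
        hρ.bose_sq _ (by omega) h _ h1, hρ.bose_sq _ (by omega) h _ (by omega), ← hbr.mul_sub]
      push_cast
      rw [add_assoc]
    · have ha : n ≤ a := by omega
      rw [if_neg (by omega), zero_add, hρ.fermi a ha, hρ.fermi a ha, hρ.fermi _ h, hρ.fermi _ h]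
      rcases l.config_fermi hn ha with h2 | h2 <;> rcases l.config_fermi hn h with h3 | h3 <;>
        simp [h2, h3, hbr.zero, hbr.one, hbr.neg_one]
  | ef_odd hnm =>
    obtain ⟨a, rfl⟩ : ∃ a, n = a + 1 := ⟨n - 1, by omega⟩
    refine end_ext fun l => ?_
    rw [diagOp_single, ← ket_config, LinearMap.add_apply, opE_mul_opF_ket hn hρ hnm.2,
      opF_mul_opE_ket hn hρ hnm.2, ← add_smul]
    congr 1
    have h0 : 1 ≤ a → 0 ≤ l.config a := fun h => by rw [l.config_of_ne (by omega)]; omega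
    simp only [cartan, if_true, weight, add_tsub_cancel_right, Nat.add_eq_right,
      Nat.add_eq_zero_iff, one_ne_zero, and_false, if_false, zero_add]
    rw [hρ.sq_eq (i := a) (by omega) h0,
      hρ.sq_eq (i := a) (by omega) (fun h => by have := h0 h; omega),
      hρ.fermi _ le_rfl, hρ.fermi _ le_rfl]
    -- The occupation number of the Fermi site decides which of the two summands survives.
    rcases l.config_fermi hn (le_refl (a + 1)) with h3 | h3 <;> simp [h3, add_assoc]
  | serre_e _ _ h => exact serreRel_opE hn hbr hρ h
  | serre_f _ _ h => exact serreRel_opF hn hbr hρ h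

end Relations

/-! ### The Holstein-Primakoff operators as hopping operators -/

section Amplitude

variable {R : Type*} [CommRing R] [Algebra ℂ R]

/-- The amplitudes of the Holstein-Primakoff realization. At a Bose site `√k t_k` is a square root
of `[k]` (and `√k = 0` for negative `k`), at the site `0` the amplitude at `k = -N` is
`√[p - N]`. -/
def hpAmp (n : ℕ) (s : ℤ → R) (t : ℕ → R) (i : ℕ) (k : ℤ) : R :=
  if i = 0 then s (-k)
  else if i < n then algebraMap ℂ R (Real.sqrt k : ℝ) * t k.toNat
  else if k = 1 then 1 else 0

/-- The amplitudes of the creation and annihilation operators. -/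
def bareAmp (n i : ℕ) (k : ℤ) : ℂ :=
  if i < n then (Real.sqrt k : ℝ) else if k = 1 then 1 else 0

lemma isAmplitude_hpAmp {br : ℂ → R} {p : ℂ} {s : ℤ → R} {t : ℕ → R} (hn : 1 ≤ n)
    (h : IsRoots br p s t) : IsAmplitude n br p (hpAmp n s t) where
  bose_of_nonpos i h1 h2 k hk := by
    have : Real.sqrt k = 0 := Real.sqrt_eq_zero_of_nonpos (by exact_mod_cast hk)
    simp [hpAmp, show i ≠ 0 by omega, h2, this]
  bose_sq i h1 h2 k hk := by
    obtain ⟨k, rfl⟩ := Int.eq_ofNat_of_zero_le hk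
    have h3 : ((Real.sqrt ((k : ℤ) : ℝ) : ℝ) : ℂ) ^ 2 = k := by
      rw [← Complex.ofReal_pow, Real.sq_sqrt (by positivity)]; simp
    rw [hpAmp, if_neg (by omega), if_pos h2, mul_pow, ← map_pow, h3, Int.toNat_natCast, map_natCast,
      mul_comm, h.t_sq]
    simp
  zero_sq k := by
    rw [hpAmp, if_pos rfl, h.s_sq]
    simp
  fermi i hi k := by rw [hpAmp, if_neg (by omega), if_neg (by omega)]

lemma bareAmp_mul_ang (s : ℤ → R) (t : ℕ → R) {i : ℕ} (hi : 1 ≤ i) (k : ℤ) :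
    algebraMap ℂ R (bareAmp n i k) * ang n t i k.toNat = hpAmp n s t i k := by
  simp only [bareAmp, ang, hpAmp, show i ≠ 0 by omega, if_false]
  split_ifs <;> simp

lemma bareAmp_of_nonpos {i : ℕ} {k : ℤ} (hk : k ≤ 0) : bareAmp n i k = 0 := by
  have : Real.sqrt k = 0 := Real.sqrt_eq_zero_of_nonpos (by exact_mod_cast hk)
  rw [bareAmp, this, if_neg (by omega : ¬ k = 1)]
  simp

end Amplitude

section Fock

lemma Am_single_eq_zero_or (l : Occ n m) (i : ℕ) :
    (l.1 i = 0 ∧ Am n m i (Finsupp.single l 1) = 0) ∨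
      (l.1 i ≠ 0 ∧ Am n m i (Finsupp.single l 1)
        = (l.sgn i * bareAmp n i (l.1 i)) • Finsupp.single (l.lower i) 1) := by
  by_cases h : l.1 i = 0
  · exact .inl ⟨h, Am_zero l i h 1⟩
  · refine .inr ⟨h, ?_⟩
    rw [Am_single, one_mul, Finsupp.smul_single, smul_eq_mul, mul_one]
    congr 2
    rw [bareAmp]
    split_ifs with h1 h2
    · simp
    · rw [show l.1 i = 1 by exact_mod_cast h2]; simp
    · have := l.2.2 i (by omega)
      omega

lemma Ap_single_of_canRaise (l : Occ n m) {i : ℕ} (hi : l.CanRaise i) :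
    Ap n m i (Finsupp.single l 1)
      = (l.sgn i * bareAmp n i (l.1 i + 1)) • Finsupp.single (l.raise i hi) 1 := by
  rw [Ap_pos l i hi, one_mul, Finsupp.smul_single, smul_eq_mul, mul_one]
  congr 2
  rw [bareAmp]
  split_ifs with h1 h2
  · simp
  · rw [show l.1 i = 0 by omega]; simp
  · have := hi.2 (by omega)
    omega

lemma Occ.sum_update (l l' : Occ n m) {i : ℕ} (hi : 1 ≤ i ∧ i < n + m)
    (hne : ∀ k, k ≠ i → l'.1 k = l.1 k) : (l'.total : ℤ) = l.total + (l'.1 i - l.1 i : ℤ) := by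
  have hmem : i ∈ Finset.Ico 1 (n + m) := Finset.mem_Ico.2 hi
  rw [Occ.total, Occ.total, ← Finset.add_sum_erase _ l.1 hmem, ← Finset.add_sum_erase _ l'.1 hmem,
    Finset.sum_congr rfl fun k hk => hne k (Finset.ne_of_mem_erase hk)]
  push_cast
  ring

lemma Occ.config_raise (l : Occ n m) {i : ℕ} (hi : l.CanRaise i) :
    (l.raise i hi).config = l.config + hop i 0 := by
  have h0 : i ≠ 0 := by have := hi.1.1; omega
  funext k
  rcases eq_or_ne k 0 with rfl | hk
  · have := l.sum_update (l.raise i hi) hi.1 fun k hk => l.raise_ne i k hi hk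
    rw [l.raise_self i hi] at this
    simp only [Pi.add_apply, Occ.config_zero, hop, h0.symm, if_false, if_true]
    push_cast at this
    omega
  · rw [Pi.add_apply, Occ.config_of_ne _ hk, Occ.config_of_ne _ hk]
    rcases eq_or_ne k i with rfl | hki
    · simp [hop, hk, Occ.raise_self]
    · simp [hop, hk, hki, Occ.raise_ne]

lemma Occ.config_lower (l : Occ n m) {i : ℕ} (hi : l.1 i ≠ 0) :
    (l.lower i).config = l.config + hop 0 i := by
  have h1 := l.2.1 i hi
  have hr : (l.lower i).CanRaise i :=
    ⟨h1, fun hn => by rw [Occ.lower_self]; have := l.2.2 i hn; omega⟩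
  have hl : (l.lower i).raise i hr = l := Occ.ext' fun k => by
    rcases eq_or_ne k i with rfl | hk
    · rw [Occ.raise_self, Occ.lower_self]; omega
    · rw [Occ.raise_ne _ _ _ _ hk, Occ.lower_ne _ _ _ hk]
  have := (l.lower i).config_raise hr
  rw [hl] at this
  rw [this, ← neg_hop 0 i, neg_add_cancel_right]

lemma Am_one_eq_moveOp : Am n m 1 = moveOp (hop 0 1) fun x => bareAmp n 1 (x 1) := by
  refine op_ext fun l => ?_
  rw [moveOp_single, l.config_of_ne one_ne_zero]
  rcases Am_single_eq_zero_or l 1 with ⟨h0, h⟩ | ⟨h0, h⟩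
  · rw [h, h0, bareAmp_of_nonpos (by simp), zero_smul]
  · have hs : l.sgn 1 = 1 := by
      rw [Occ.sgn]; split_ifs with hn
      · rcases Nat.eq_zero_or_pos n with rfl | hn0
        · simp [l.apply_zero]
        · simp [show n = 1 by omega]
      · rfl
    rw [h, hs, one_mul, ← l.config_lower h0, ket_config]

lemma Occ.not_canRaise (l : Occ n m) {i : ℕ} (hi : 1 ≤ i ∧ i < n + m) (h : ¬ l.CanRaise i) :
    n ≤ i ∧ l.1 i = 1 := by
  have hni : n ≤ i := by by_contra hc; exact h ⟨hi, fun h => absurd h hc⟩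
  have := l.2.2 i hni
  have h0 : l.1 i ≠ 0 := fun h0 => h ⟨hi, fun _ => h0⟩
  exact ⟨hni, by omega⟩

lemma bareAmp_fermi_two {i : ℕ} (hi : n ≤ i) : bareAmp n i 2 = 0 := by
  rw [bareAmp, if_neg (by omega), if_neg (by norm_num)]

/-- No Fermi site precedes site `1`, so `A_1^+` carries no sign. The particle comes from
site `0`. -/
lemma Ap_one_eq_moveOp (hnm : 1 < n + m) :
    Ap n m 1 = moveOp (hop 1 0) fun x => bareAmp n 1 (x 1 + 1) := by
  refine op_ext fun l => ?_
  rw [moveOp_single, l.config_of_ne one_ne_zero]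
  by_cases hr : l.CanRaise 1
  · have hs : l.sgn 1 = 1 := by
      rw [Occ.sgn]; split_ifs with hn
      · rcases Nat.eq_zero_or_pos n with rfl | hn0
        · simp [l.apply_zero]
        · simp [show n = 1 by omega]
      · rfl
    rw [Ap_single_of_canRaise l hr, hs, one_mul, ← l.config_raise hr, ket_config]
  · obtain ⟨h1, h2⟩ := l.not_canRaise ⟨le_rfl, hnm⟩ hr
    rw [Ap_neg _ _ hr, h2, show ((1 : ℕ) : ℤ) + 1 = 2 by norm_num, bareAmp_fermi_two h1, zero_smul]

/-- The signs of neighbouring operators `A_i^+` and `A_j^-` cancel, since the site `i` has to be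
empty before, and the site `j` afterwards, if they are Fermi sites. -/
lemma Ap_mul_Am_eq_moveOp {i j : ℕ} (hi : 1 ≤ i ∧ i < n + m) (hj : 1 ≤ j ∧ j < n + m)
    (hij : i = j + 1 ∨ j = i + 1) :
    Ap n m i * Am n m j
      = moveOp (hop i j) fun x => bareAmp n i (x i + 1) * bareAmp n j (x j) := by
  refine op_ext fun l => ?_
  have hne : i ≠ j := by omega
  rw [moveOp_single, l.config_of_ne (by omega : j ≠ 0), l.config_of_ne (by omega : i ≠ 0),
    Module.End.mul_apply]
  rcases Am_single_eq_zero_or l j with ⟨h0, h⟩ | ⟨h0, h⟩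
  · rw [h, h0, map_zero, bareAmp_of_nonpos (i := j) (by simp), mul_zero, zero_smul]
  · rw [h, map_smul]
    by_cases hr : (l.lower j).CanRaise i
    · rw [Ap_single_of_canRaise _ hr, smul_smul, Occ.lower_ne _ _ _ hne, Occ.sgn_lower _ _ _ h0]
      have hv : ((l.lower j).raise i hr).config = l.config + hop i j := by
        rw [Occ.config_raise, l.config_lower h0, add_assoc]
        congr 1
        funext k
        simp only [hop, Pi.add_apply]
        ring
      rw [← hv, ket_config]
      have hs : l.sgn j * (swapSign n j i * l.sgn i) = 1 := by
        have hri := hr.2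
        rw [Occ.lower_ne _ _ _ hne] at hri
        have hlj := l.2.2 j
        unfold Occ.sgn swapSign
        rcases hij with rfl | rfl
        · by_cases hn : n ≤ j
          · rw [if_pos hn, if_pos ⟨hn, Nat.lt_succ_self j⟩, if_pos (show n ≤ j + 1 by omega),
              Finset.sum_Ico_succ_top hn, pow_add, show l.1 j = 1 by have := hlj hn; omega, pow_one]
            have := (Even.add_self (∑ k ∈ Finset.Ico n j, l.1 k)).neg_one_pow (α := ℂ)
            rw [pow_add] at this
            linear_combination this
          · rw [if_neg hn, if_neg (fun h => hn h.1), Finset.Ico_eq_empty_of_le (by omega)]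
            simp
        · rw [if_neg (show ¬ (n ≤ i + 1 ∧ i + 1 < i) by omega)]
          by_cases hn : n ≤ i
          · rw [if_pos hn, if_pos (show n ≤ i + 1 by omega), Finset.sum_Ico_succ_top hn,
              hri hn, add_zero, one_mul, ← pow_add]
            exact (Even.add_self _).neg_one_pow
          · rw [if_neg hn, Finset.Ico_eq_empty_of_le (by omega)]
            simp
      congr 1
      linear_combination (bareAmp n i (l.1 i + 1) * bareAmp n j (l.1 j)) * hs
    · obtain ⟨h1, h2⟩ := (l.lower j).not_canRaise hi hr
      rw [Occ.lower_ne _ _ _ hne] at h2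
      rw [Ap_neg _ _ hr, h2, show ((1 : ℕ) : ℤ) + 1 = 2 by norm_num, bareAmp_fermi_two h1,
        zero_mul, zero_smul, smul_zero]

lemma Ap_mul_Am_self (i : ℕ) : Ap n m i * Am n m i = diagOp fun l => (l.1 i : ℂ) := by
  refine op_ext fun l => ?_
  rw [number_single, diagOp_single, Finsupp.smul_single, smul_eq_mul]

end Fock

section Formulas

variable {R : Type*} [CommRing R]

lemma moveOp_congr {v : ℕ → ℤ} {w w' : (ℕ → ℤ) → R}
    (h : ∀ l : Occ n m, w l.config = w' l.config) :
    (moveOp v w : Module.End R (Occ n m →₀ R)) = moveOp v w' :=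
  end_ext fun l => by rw [moveOp_single, moveOp_single, h]

lemma diagOp_mul_moveOp_eq {v : ℕ → ℤ} {w : (ℕ → ℤ) → R} (φ : (ℕ → ℤ) → R) :
    diagOp (fun l : Occ n m => φ l.config) * moveOp v w = moveOp v fun x => w x * φ (x + v) := by
  refine end_ext fun l => ?_
  rw [Module.End.mul_apply, moveOp_single, moveOp_single, map_smul, diagOp_ket, smul_smul]

/-- `diagOp` as a ring homomorphism. -/
def diagHom (R : Type*) [CommRing R] (n m : ℕ) :
    (Occ n m → R) →+* Module.End R (Occ n m →₀ R) where
  toFun := diagOp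
  map_one' := end_ext fun l => by rw [diagOp_single, Pi.one_apply, one_smul]; rfl
  map_mul' φ ψ := (diagOp_mul φ ψ).symm
  map_zero' := end_ext fun l => by rw [diagOp_single, Pi.zero_apply, zero_smul]; rfl
  map_add' φ ψ := end_ext fun l => by
    rw [diagOp_single, Pi.add_apply, add_smul, LinearMap.add_apply, diagOp_single, diagOp_single]

/-- The data that realize the hopping operators over `R` in a ring `B`: functions of the number
operators and the products of creation and annihilation operators that enter the
Holstein-Primakoff formulas. -/
structure IsRealization [Algebra ℂ R] {B : Type*} [Ring B] [Algebra ℂ B]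
    (Ψ : Module.End R (Occ n m →₀ R) →+* B) (D : (Occ n m → R) → B) (ap am : ℕ → B) : Prop where
  diag : ∀ φ, D φ = Ψ (diagOp φ)
  scalar : ∀ z : ℂ, algebraMap ℂ B z = Ψ (diagOp fun _ => algebraMap ℂ R z)
  number : ∀ i, ap i * am i = Ψ (diagOp fun l => algebraMap ℂ R (l.1 i))
  am_one : am 1 = Ψ (moveOp (hop 0 1) fun x => algebraMap ℂ R (bareAmp n 1 (x 1)))
  ap_one : 1 < n + m → ap 1 = Ψ (moveOp (hop 1 0) fun x => algebraMap ℂ R (bareAmp n 1 (x 1 + 1)))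
  ap_mul_am : ∀ i j, 1 ≤ i ∧ i < n + m → 1 ≤ j ∧ j < n + m → i = j + 1 ∨ j = i + 1 →
    ap i * am j = Ψ (moveOp (hop i j) fun x =>
      algebraMap ℂ R (bareAmp n i (x i + 1) * bareAmp n j (x j)))

lemma Occ.config_pos (l : Occ n m) {i : ℕ} (hi : 1 ≤ i) : 0 ≤ l.config i := by
  rw [l.config_of_ne (by omega)]; omega

lemma Occ.toNat_config (l : Occ n m) {i : ℕ} (hi : 1 ≤ i) : (l.config i).toNat = l.1 i := by
  rw [l.config_of_ne (by omega), Int.toNat_natCast]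

/-- A function of the number operators in terms of the configuration with adjoined site. -/
lemma ang_config (t : ℕ → R) {i : ℕ} (hi : 1 ≤ i) :
    (fun l : Occ n m => ang n t i (l.1 i)) = fun l => ang n t i (l.config i).toNat := by
  funext l; rw [l.toNat_config hi]

lemma ang_config_add_one (t : ℕ → R) {i : ℕ} (hi : 1 ≤ i) :
    (fun l : Occ n m => ang n t i (l.1 i + 1)) = fun l => ang n t i (l.config i + 1).toNat := by
  funext l
  rw [Int.toNat_add (l.config_pos hi) zero_le_one, l.toNat_config hi]; rfl

variable [Algebra ℂ R] {B : Type*} [Ring B] [Algebra ℂ B]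
  {Ψ : Module.End R (Occ n m →₀ R) →+* B} {D : (Occ n m → R) → B} {ap am : ℕ → B}

lemma IsRealization.hpH_eq (h : IsRealization Ψ D ap am) (p : ℂ) {j : ℕ} (hj : 1 ≤ j) :
    hpH n m ap am p j = Ψ (diagOp fun l => algebraMap ℂ R (weight p j l.config)) := by
  by_cases h1 : j = 1
  · subst h1
    rw [hpH, if_pos rfl, h.scalar, Finset.sum_congr rfl fun i _ => h.number i, ← map_sum, ← map_sub]
    congr 1
    change diagHom R n m _ - ∑ i ∈ _, diagHom R n m _ = diagHom R n m _
    rw [← map_sum]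
    refine end_ext fun l => ?_
    change (diagOp _ - diagOp _ : Module.End R (Occ n m →₀ R)) _ = diagOp _ _
    rw [LinearMap.sub_apply, diagOp_single, diagOp_single, diagOp_single, ← sub_smul,
      Finset.sum_apply, ← map_sum, ← map_sub]
    simp only [weight, if_true, Nat.sub_self, l.config_zero, Occ.total]
    push_cast
    rw [sub_eq_add_neg]
  · rw [hpH, if_neg h1, h.number]
    congr 2
    funext l
    simp [weight, h1, l.config_of_ne (show j - 1 ≠ 0 by omega)]

lemma IsRealization.hpE_eq (h : IsRealization Ψ D ap am) (s : ℤ → R) (t : ℕ → R) {i : ℕ}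
    (hi : 1 ≤ i ∧ i < n + m) : hpE D ap am s t i = Ψ (opE (hpAmp n s t) i) := by
  obtain ⟨a, rfl⟩ : ∃ a, i = a + 1 := ⟨i - 1, by omega⟩
  rw [hpE, add_tsub_cancel_right, opE, add_tsub_cancel_right]
  split_ifs with h1
  · obtain rfl : a = 0 := by omega
    rw [h.diag, h.diag, h.am_one, ← map_mul, ← map_mul, ang_config_add_one t le_rfl, mul_assoc,
      diagOp_mul_moveOp_eq fun x => ang n t 1 (x 1 + 1).toNat,
      show (fun l : Occ n m => s l.total) = fun l => s (-l.config 0) by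
        funext l; rw [l.config_zero, neg_neg],
      diagOp_mul_moveOp_eq fun x => s (-x 0)]
    congr 1
    refine moveOp_congr fun l => ?_
    simp only [Pi.add_apply, zero_add, hop_fst 0, show hop 0 1 1 = -1 from hop_snd 0,
      neg_add_cancel_right, bareAmp_mul_ang s t le_rfl]
    rw [mul_comm]
    exact congrArg (· * _) (if_pos rfl).symm
  · have ha : 1 ≤ a := by omega
    rw [h.diag, h.diag, mul_assoc, h.ap_mul_am a (a + 1) ⟨ha, by omega⟩ hi (.inr rfl), ← map_mul,
      ← map_mul, ang_config_add_one t hi.1, ang_config t ha, mul_assoc,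
      diagOp_mul_moveOp_eq fun x => ang n t (a + 1) (x (a + 1) + 1).toNat,
      diagOp_mul_moveOp_eq fun x => ang n t a (x a).toNat]
    congr 1
    refine moveOp_congr fun l => ?_
    simp only [Pi.add_apply, hop_fst, hop_snd, neg_add_cancel_right]
    rw [← bareAmp_mul_ang s t ha, ← bareAmp_mul_ang s t hi.1, map_mul]
    ring

lemma IsRealization.hpF_eq (h : IsRealization Ψ D ap am) (s : ℤ → R) (t : ℕ → R) {i : ℕ}
    (hi : 1 ≤ i ∧ i < n + m) : hpF D ap am s t i = Ψ (opF (hpAmp n s t) i) := by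
  obtain ⟨a, rfl⟩ : ∃ a, i = a + 1 := ⟨i - 1, by omega⟩
  rw [hpF, add_tsub_cancel_right, opF, add_tsub_cancel_right]
  split_ifs with h1
  · obtain rfl : a = 0 := by omega
    rw [h.diag, h.diag, h.ap_one hi.2, ← map_mul, ← map_mul, ang_config t le_rfl, mul_assoc,
      diagOp_mul_moveOp_eq fun x => ang n t 1 (x 1).toNat,
      show (fun l : Occ n m => s (l.total - 1)) = fun l => s (-l.config 0 - 1) by
        funext l; rw [l.config_zero, neg_neg],
      diagOp_mul_moveOp_eq fun x => s (-x 0 - 1)]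
    congr 1
    refine moveOp_congr fun l => ?_
    simp only [← neg_hop 0, Pi.add_apply, Pi.neg_apply, zero_add, hop_fst 0,
      show hop 0 1 1 = -1 from hop_snd 0, neg_neg, bareAmp_mul_ang s t le_rfl]
    rw [mul_comm, show hpAmp n s t 0 (l.config 0) = s (-l.config 0) from if_pos rfl]
    congr 2
    ring
  · have ha : 1 ≤ a := by omega
    rw [h.diag, h.diag, mul_assoc, h.ap_mul_am (a + 1) a hi ⟨ha, by omega⟩ (.inl rfl), ← map_mul,
      ← map_mul, ang_config t hi.1, ang_config_add_one t ha, mul_assoc,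
      diagOp_mul_moveOp_eq fun x => ang n t (a + 1) (x (a + 1)).toNat,
      diagOp_mul_moveOp_eq fun x => ang n t a (x a + 1).toNat]
    congr 1
    refine moveOp_congr fun l => ?_
    simp only [← neg_hop a, Pi.add_apply, Pi.neg_apply, hop_fst, hop_snd, neg_neg,
      neg_add_cancel_right]
    rw [← bareAmp_mul_ang s t ha, ← bareAmp_mul_ang s t hi.1, map_mul]
    ring

end Formulas

/-- The Fock space operators for a numerical parameter. -/
lemma isRealization_id :
    IsRealization (RingHom.id (Module.End ℂ (Occ n m →₀ ℂ))) (diag (n := n) (m := m))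
      (Ap n m) (Am n m) where
  diag _ := rfl
  scalar z := op_ext fun l => by
    rw [RingHom.id_apply, diagOp_single, Module.algebraMap_end_apply]; rfl
  number i := Ap_mul_Am_self i
  am_one := Am_one_eq_moveOp
  ap_one := Ap_one_eq_moveOp
  ap_mul_am _ _ hi hj hij := Ap_mul_Am_eq_moveOp hi hj hij

/-! ### Operators over `ℂ⟦X⟧` as power series of operators -/

lemma algebraMap_eq_C (z : ℂ) : algebraMap ℂ ℂ⟦X⟧ z = PowerSeries.C z := by
  simp

/-- Coefficientwise extraction of the `k`-th coefficient. -/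
def coeffMap (n m k : ℕ) : (Occ n m →₀ ℂ⟦X⟧) →ₗ[ℂ] Fock n m :=
  Finsupp.mapRange.linearMap (PowerSeries.coeff k)

/-- Vectors with constant coefficients. -/
def constMap (n m : ℕ) : Fock n m →ₗ[ℂ] (Occ n m →₀ ℂ⟦X⟧) :=
  Finsupp.mapRange.linearMap (Algebra.linearMap ℂ ℂ⟦X⟧)

lemma constMap_single (l : Occ n m) (z : ℂ) :
    constMap n m (Finsupp.single l z) = Finsupp.single l (PowerSeries.C z) := by
  simp [constMap]

lemma coeffMap_single (k : ℕ) (l : Occ n m) (a : ℂ⟦X⟧) :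
    coeffMap n m k (Finsupp.single l a) = Finsupp.single l (PowerSeries.coeff k a) := by
  simp [coeffMap]

lemma coeffMap_smul (k : ℕ) (a : ℂ⟦X⟧) (v : Occ n m →₀ ℂ⟦X⟧) :
    coeffMap n m k (a • v) = ∑ ij ∈ Finset.HasAntidiagonal.antidiagonal k,
      PowerSeries.coeff ij.2 a • coeffMap n m ij.1 v := by
  ext l
  simp only [coeffMap, Finsupp.mapRange.linearMap_apply, Finsupp.mapRange_apply,
    Finsupp.smul_apply, smul_eq_mul, PowerSeries.coeff_mul, Finsupp.finsetSum_apply]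
  rw [← Finset.Nat.sum_antidiagonal_swap]
  rfl

lemma coeffMap_ket (k : ℕ) (x : ℕ → ℤ) (a : ℂ⟦X⟧) :
    coeffMap n m k (a • ket ℂ⟦X⟧ x) = PowerSeries.coeff k a • ket ℂ x := by
  by_cases h : ∃ l : Occ n m, l.config = x
  · obtain ⟨l, rfl⟩ := h
    rw [ket_config, ket_config, Finsupp.smul_single, Finsupp.smul_single, coeffMap_single,
      smul_eq_mul, smul_eq_mul, mul_one, mul_one]
  · rw [ket_eq_zero fun l hl => h ⟨l, hl⟩, ket_eq_zero fun l hl => h ⟨l, hl⟩, smul_zero, smul_zero,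
      map_zero]

/-- The `k`-th coefficient of an operator over `ℂ⟦X⟧`. -/
def coeffOp (k : ℕ) (T : Module.End ℂ⟦X⟧ (Occ n m →₀ ℂ⟦X⟧)) : Op n m :=
  coeffMap n m k ∘ₗ T.restrictScalars ℂ ∘ₗ constMap n m

lemma coeffOp_apply (k : ℕ) (T : Module.End ℂ⟦X⟧ (Occ n m →₀ ℂ⟦X⟧)) (v : Fock n m) :
    coeffOp k T v = coeffMap n m k (T (constMap n m v)) := rfl

lemma coeffMap_apply_eq_sum (k : ℕ) (T : Module.End ℂ⟦X⟧ (Occ n m →₀ ℂ⟦X⟧))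
    (v : Occ n m →₀ ℂ⟦X⟧) : coeffMap n m k (T v) = ∑ ij ∈ Finset.HasAntidiagonal.antidiagonal k,
      coeffOp ij.1 T (coeffMap n m ij.2 v) := by
  induction v using Finsupp.induction_linear with
  | zero => simp
  | add v w hv hw => simp only [map_add, hv, hw, Finset.sum_add_distrib]
  | single l a =>
    rw [← mul_one a, ← smul_eq_mul, ← Finsupp.smul_single, map_smul, coeffMap_smul]
    refine Finset.sum_congr rfl fun ij _ => ?_
    rw [Finsupp.smul_single, smul_eq_mul, mul_one, coeffMap_single, coeffOp_apply, constMap_single,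
      ← mul_one (PowerSeries.C _), ← smul_eq_mul, ← Finsupp.smul_single, map_smul,
      ← algebraMap_eq_C, algebraMap_smul, map_smul]

/-- A `ℂ⟦X⟧`-linear operator as a power series of operators on the Fock space. -/
def expand (n m : ℕ) : Module.End ℂ⟦X⟧ (Occ n m →₀ ℂ⟦X⟧) →+* (Op n m)⟦X⟧ where
  toFun T := PowerSeries.mk fun k => coeffOp k T
  map_one' := by
    ext k : 1
    refine op_ext fun l => ?_
    rw [PowerSeries.coeff_mk, coeffOp_apply, constMap_single, Module.End.one_apply,
      coeffMap_single, PowerSeries.coeff_one, PowerSeries.coeff_C]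
    split_ifs <;> simp
  map_mul' S T := by
    ext k : 1
    refine LinearMap.ext fun v => ?_
    rw [PowerSeries.coeff_mk, coeffOp_apply, Module.End.mul_apply, coeffMap_apply_eq_sum,
      PowerSeries.coeff_mul, LinearMap.sum_apply]
    simp only [PowerSeries.coeff_mk, Module.End.mul_apply, coeffOp_apply]
  map_zero' := by
    ext k : 1
    refine LinearMap.ext fun v => ?_
    rw [PowerSeries.coeff_mk, coeffOp_apply, LinearMap.zero_apply, map_zero]; rfl
  map_add' S T := by
    ext k : 1
    refine LinearMap.ext fun v => ?_
    rw [PowerSeries.coeff_mk, coeffOp_apply, LinearMap.add_apply, map_add, map_add,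
      LinearMap.add_apply, PowerSeries.coeff_mk, PowerSeries.coeff_mk]
    rfl

lemma coeff_expand (k : ℕ) (T : Module.End ℂ⟦X⟧ (Occ n m →₀ ℂ⟦X⟧)) :
    PowerSeries.coeff k (expand n m T) = coeffOp k T := by
  simp [expand]

lemma coeffOp_moveOp (k : ℕ) (v : ℕ → ℤ) (w : (ℕ → ℤ) → ℂ⟦X⟧) :
    coeffOp k (moveOp v w : Module.End ℂ⟦X⟧ (Occ n m →₀ ℂ⟦X⟧))
      = moveOp v fun x => PowerSeries.coeff k (w x) := by
  refine op_ext fun l => ?_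
  rw [coeffOp_apply, constMap_single, map_one, moveOp_single, moveOp_single, coeffMap_ket]

lemma coeffOp_diagOp (k : ℕ) (φ : Occ n m → ℂ⟦X⟧) :
    coeffOp k (diagOp φ) = diag fun l => PowerSeries.coeff k (φ l) := by
  refine op_ext fun l => ?_
  rw [coeffOp_apply, constMap_single, map_one, diagOp_single, Finsupp.smul_single, smul_eq_mul,
    mul_one, coeffMap_single]
  rw [diag, Finsupp.linearCombination_single, one_smul]

lemma expand_diagOp (φ : Occ n m → ℂ⟦X⟧) : expand n m (diagOp φ) = diagH φ := by
  ext k : 1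
  rw [coeff_expand, coeffOp_diagOp, diagH, PowerSeries.coeff_mk]

lemma expand_moveOp_const (v : ℕ → ℤ) (w : (ℕ → ℤ) → ℂ) :
    expand n m (moveOp v fun x => algebraMap ℂ ℂ⟦X⟧ (w x)) = PowerSeries.C (moveOp v w) := by
  ext k : 1
  rw [coeff_expand, coeffOp_moveOp, PowerSeries.coeff_C]
  refine op_ext fun l => ?_
  rw [moveOp_single, algebraMap_eq_C, PowerSeries.coeff_C]
  split_ifs
  · rw [moveOp_single]
  · rw [zero_smul]; rfl

lemma expand_diagOp_const (φ : Occ n m → ℂ) :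
    expand n m (diagOp fun l => algebraMap ℂ ℂ⟦X⟧ (φ l)) = PowerSeries.C (diag φ) := by
  ext k : 1
  rw [coeff_expand, coeffOp_diagOp, PowerSeries.coeff_C]
  refine op_ext fun l => ?_
  change diagOp _ _ = _
  rw [diagOp_single, algebraMap_eq_C, PowerSeries.coeff_C]
  split_ifs
  · exact (diagOp_single _ _).symm
  · rw [zero_smul]; rfl

/-- The Fock space operators for the formal parameter. -/
lemma isRealization_expand :
    IsRealization (expand n m) diagH (fun i => PowerSeries.C (Ap n m i))
      (fun i => PowerSeries.C (Am n m i)) where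
  diag φ := (expand_diagOp φ).symm
  scalar z := by
    rw [expand_diagOp_const, PowerSeries.algebraMap_apply]
    congr 1
    exact isRealization_id.scalar z
  number i := by
    rw [← map_mul, Ap_mul_Am_self, expand_diagOp_const]; rfl
  am_one := by rw [Am_one_eq_moveOp, expand_moveOp_const]
  ap_one h := by rw [Ap_one_eq_moveOp h, expand_moveOp_const]
  ap_mul_am _ _ hi hj hij := by rw [← map_mul, Ap_mul_Am_eq_moveOp hi hj hij, expand_moveOp_const]

/-! ### Parity and invariant subspaces of the hopping operators -/

section Stability

variable {R : Type*} [CommRing R]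

lemma Occ.fermi_eq_sum (hn : 1 ≤ n) (l : Occ n m) :
    (l.fermi : ℤ) = ∑ i ∈ Finset.Ico n (n + m), l.config i := by
  rw [Occ.fermi, Nat.cast_sum]
  exact Finset.sum_congr rfl fun i hi =>
    (l.config_of_ne (by have := (Finset.mem_Ico.1 hi).1; omega)).symm

lemma Occ.fermi_of_hop (hn : 1 ≤ n) {l l' : Occ n m} {i j : ℕ}
    (h : l'.config = l.config + hop i j) :
    (l'.fermi : ℤ) = l.fermi + ((if n ≤ i ∧ i < n + m then 1 else 0)
      - (if n ≤ j ∧ j < n + m then 1 else 0)) := by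
  rw [l'.fermi_eq_sum hn, l.fermi_eq_sum hn, h]
  simp [hop, Finset.sum_add_distrib]

lemma Occ.total_of_hop {l l' : Occ n m} {i j : ℕ} (h : l'.config = l.config + hop i j) :
    (l'.total : ℤ) = l.total - hop i j 0 := by
  have := congrFun h 0
  rw [Pi.add_apply, Occ.config_zero, Occ.config_zero] at this
  omega

lemma diagOp_mul_moveOp_of_odd {v : ℕ → ℤ} {w : (ℕ → ℤ) → R} {φ : Occ n m → R}
    (h : ∀ l l' : Occ n m, l'.config = l.config + v → φ l' = -φ l) :
    diagOp φ * moveOp v w + moveOp v w * diagOp φ = 0 := by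
  rw [diagOp_mul_moveOp h]
  refine end_ext fun l => ?_
  rw [LinearMap.add_apply, Module.End.mul_apply, Module.End.mul_apply, diagOp_single,
    diagOp_single, map_smul, map_smul, ← add_smul, neg_add_cancel, zero_smul]
  rfl

/-- Only a hop between the last Bose site `n - 1` and the first Fermi site `n` changes the number of
Fermi particles. -/
lemma neg_one_pow_fermi [Algebra ℂ R] (hn : 1 ≤ n) {l l' : Occ n m} {i : ℕ}
    (hi : 1 ≤ i ∧ i < n + m)
    (h : l'.config = l.config + hop (i - 1) i ∨ l'.config = l.config + hop i (i - 1)) :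
    algebraMap ℂ R ((-1) ^ l'.fermi)
      = (if i = n then -1 else 1) * algebraMap ℂ R ((-1) ^ l.fermi) := by
  by_cases hin : i = n
  · have hpar : l'.fermi = l.fermi + 1 ∨ l.fermi = l'.fermi + 1 := by
      rcases h with h | h
      · have := Occ.fermi_of_hop hn h
        rw [if_neg (by omega), if_pos (by omega)] at this
        omega
      · have := Occ.fermi_of_hop hn h
        rw [if_pos (by omega), if_neg (by omega)] at this
        omega
    rw [if_pos hin]
    rcases hpar with h | h <;> rw [h, pow_succ] <;> simp
  · have hpar : l'.fermi = l.fermi := by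
      rcases h with h | h
      · have := Occ.fermi_of_hop hn h
        split_ifs at this <;> omega
      · have := Occ.fermi_of_hop hn h
        split_ifs at this <;> omega
    rw [if_neg hin, hpar, one_mul]

lemma respectsDegree [Algebra ℂ R] {B : Type*} [Ring B] (hn : 1 ≤ n) (p : ℂ) (ρ : ℕ → ℤ → R)
    (Ψ : Module.End R (Occ n m →₀ R) →+* B) :
    RespectsDegree n m (Ψ (diagOp fun l => algebraMap ℂ R ((-1) ^ l.fermi)))
      (fun j => Ψ (diagOp fun l => algebraMap ℂ R (weight p j l.config)))
      (fun i => Ψ (opE ρ i)) (fun i => Ψ (opF ρ i)) := by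
  have key : ∀ (i : ℕ) (v : ℕ → ℤ) (w : (ℕ → ℤ) → R),
      (∀ l l' : Occ n m, l'.config = l.config + v → algebraMap ℂ R ((-1) ^ l'.fermi)
        = (if i = n then -1 else 1) * algebraMap ℂ R ((-1) ^ l.fermi)) →
      Ψ (diagOp fun l => algebraMap ℂ R ((-1) ^ l.fermi)) * Ψ (moveOp v w)
        = (if i = n then -1 else 1) *
          (Ψ (moveOp v w) * Ψ (diagOp fun l => algebraMap ℂ R ((-1) ^ l.fermi))) := by
    intro i v w h
    split_ifs at h ⊢ with hin
    · rw [neg_one_mul, ← map_mul, ← map_mul, ← add_eq_zero_iff_eq_neg, ← map_add,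
        diagOp_mul_moveOp_of_odd fun l l' hl => by rw [h l l' hl, neg_one_mul], map_zero]
    · rw [one_mul, ← map_mul, ← map_mul,
        diagOp_mul_moveOp fun l l' hl => (h l l' hl).trans (one_mul _)]
  refine ⟨fun j _ => ?_, fun i hi => ⟨?_, ?_⟩⟩
  · rw [← map_mul, ← map_mul, diagOp_mul, diagOp_mul, mul_comm]
  · exact key i _ _ fun l l' h => neg_one_pow_fermi hn hi (.inl h)
  · exact key i _ _ fun l l' h => neg_one_pow_fermi hn hi (.inr h)

lemma mem_F0_iff {p : ℕ} {v : Fock n m} : v ∈ F0 n m p ↔ ∀ l, v l ≠ 0 → l.total ≤ p := by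
  have : F0 n m p = Finsupp.supported ℂ ℂ {l : Occ n m | l.total ≤ p} := by
    rw [Finsupp.supported_eq_span_single, F0]
    congr 1
    ext v
    simp [eq_comm]
  rw [this, Finsupp.mem_supported]
  simp [Set.subset_def]

lemma mem_F1_iff {p : ℕ} {v : Fock n m} : v ∈ F1 n m p ↔ ∀ l, v l ≠ 0 → p < l.total := by
  have : F1 n m p = Finsupp.supported ℂ ℂ {l : Occ n m | p < l.total} := by
    rw [Finsupp.supported_eq_span_single, F1]
    congr 1
    ext v
    simp [eq_comm]
  rw [this, Finsupp.mem_supported]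
  simp [Set.subset_def]

/-- The operators that leave both `F0 n m p` and `F1 n m p` invariant. -/
def stab (n m p : ℕ) : Subalgebra ℂ (Op n m) where
  carrier := {T | (∀ x ∈ F0 n m p, T x ∈ F0 n m p) ∧ ∀ x ∈ F1 n m p, T x ∈ F1 n m p}
  mul_mem' hS hT := ⟨fun x hx => hS.1 _ (hT.1 x hx), fun x hx => hS.2 _ (hT.2 x hx)⟩
  add_mem' hS hT := ⟨fun x hx => add_mem (hS.1 x hx) (hT.1 x hx),
    fun x hx => add_mem (hS.2 x hx) (hT.2 x hx)⟩
  algebraMap_mem' c :=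
    ⟨fun _ hx => Submodule.smul_mem _ c hx, fun _ hx => Submodule.smul_mem _ c hx⟩

lemma mem_stab_of_single {p : ℕ} {T : Op n m}
    (h0 : ∀ l : Occ n m, l.total ≤ p → T (Finsupp.single l 1) ∈ F0 n m p)
    (h1 : ∀ l : Occ n m, p < l.total → T (Finsupp.single l 1) ∈ F1 n m p) : T ∈ stab n m p := by
  constructor
  · intro x hx
    rw [← Submodule.mem_comap]
    refine Submodule.span_le.2 ?_ hx
    rintro _ ⟨l, hl, rfl⟩
    exact h0 l hl
  · intro x hx
    rw [← Submodule.mem_comap]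
    refine Submodule.span_le.2 ?_ hx
    rintro _ ⟨l, hl, rfl⟩
    exact h1 l hl

lemma diag_mem_stab (p : ℕ) (φ : Occ n m → ℂ) : diag φ ∈ stab n m p := by
  refine mem_stab_of_single (fun l hl => ?_) fun l hl => ?_ <;>
    rw [show diag φ = diagOp φ from rfl, diagOp_single] <;>
    exact Submodule.smul_mem _ _ (Submodule.subset_span ⟨l, hl, rfl⟩)

lemma moveOp_mem_stab {p : ℕ} {v : ℕ → ℤ} {w : (ℕ → ℤ) → ℂ}
    (h : ∀ l l' : Occ n m, l'.config = l.config + v → w l.config ≠ 0 →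
      (l.total ≤ p ↔ l'.total ≤ p)) : moveOp v w ∈ stab n m p := by
  refine mem_stab_of_single (fun l hl => ?_) fun l hl => ?_ <;>
  · rw [moveOp_single]
    by_cases hw : w l.config = 0
    · rw [hw, zero_smul]
      exact zero_mem _
    by_cases h' : ∃ l' : Occ n m, l'.config = l.config + v
    · obtain ⟨l', hl'⟩ := h'
      have := h l l' hl' hw
      rw [← hl', ket_config]
      exact Submodule.smul_mem _ _ (Submodule.subset_span ⟨l', by omega, rfl⟩)
    · rw [ket_eq_zero fun l hl => h' ⟨l, hl⟩, smul_zero]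
      exact zero_mem _

variable {br : ℂ → R} {ρ : ℕ → ℤ → R} {p : ℕ}

/-- The amplitude `√[p - N]` vanishes at `N = p`, so that no particle can be added or removed
between `N = p` and `N = p + 1`. -/
lemma IsAmplitude.zero_neg_natCast [IsDomain R] (hρ : IsAmplitude n br p ρ) (h0 : br 0 = 0) :
    ρ 0 (-p) = 0 := by
  have := hρ.zero_sq (-p)
  rw [Int.cast_neg, Int.cast_natCast, add_neg_cancel, h0] at this
  exact pow_eq_zero_iff two_ne_zero |>.1 this

/-- A nonzero matrix element does not connect `N ≤ p` with `N > p`: the total occupation changes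
only by an exchange with site `0`, whose amplitude vanishes between `N = p` and `N = p + 1`. -/
lemma total_le_iff_of_opE [IsDomain R] (hρ : IsAmplitude n br p ρ) (h0 : br 0 = 0) {i : ℕ}
    (hi : 1 ≤ i) {l l' : Occ n m} (h : l'.config = l.config + hop (i - 1) i)
    (hw : ρ (i - 1) (l.config (i - 1) + 1) * ρ i (l.config i) ≠ 0) :
    l.total ≤ p ↔ l'.total ≤ p := by
  have h1 := Occ.total_of_hop h
  rcases eq_or_ne i 1 with rfl | hi1
  · have h2 : -(l.total : ℤ) + 1 ≠ -p := fun h2 => hw <| by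
      rw [Nat.sub_self, l.config_zero, h2, hρ.zero_neg_natCast h0, zero_mul]
    rw [show hop (1 - 1) 1 0 = 1 from hop_fst 0] at h1
    omega
  · rw [hop_of_ne (by omega) (by omega)] at h1
    omega

lemma total_le_iff_of_opF [IsDomain R] (hρ : IsAmplitude n br p ρ) (h0 : br 0 = 0) {i : ℕ}
    (hi : 1 ≤ i) {l l' : Occ n m} (h : l'.config = l.config + hop i (i - 1))
    (hw : ρ (i - 1) (l.config (i - 1)) * ρ i (l.config i + 1) ≠ 0) :
    l.total ≤ p ↔ l'.total ≤ p := by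
  have h1 := Occ.total_of_hop h
  rcases eq_or_ne i 1 with rfl | hi1
  · have h2 : -(l.total : ℤ) ≠ -p := fun h2 => hw <| by
      rw [Nat.sub_self, l.config_zero, h2, hρ.zero_neg_natCast h0, zero_mul]
    rw [show hop 1 (1 - 1) 0 = -1 by simp [hop]] at h1
    omega
  · rw [hop_of_ne (by omega) (by omega)] at h1
    omega

end Stability

lemma isCompl_F0_F1 (p : ℕ) : IsCompl (F0 n m p) (F1 n m p) := by
  constructor
  · rw [Submodule.disjoint_def]
    intro x h0 h1
    refine Finsupp.ext fun l => ?_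
    by_contra h
    have := mem_F0_iff.1 h0 l h
    have := mem_F1_iff.1 h1 l h
    omega
  · rw [codisjoint_iff, eq_top_iff]
    intro x _
    induction x using Finsupp.induction_linear with
    | zero => exact zero_mem _
    | add x y hx hy => exact add_mem (hx trivial) (hy trivial)
    | single l z =>
      rcases le_or_gt l.total p with h | h
      · refine Submodule.mem_sup_left (mem_F0_iff.2 fun l' hl' => ?_)
        obtain rfl : l = l' := by by_contra hc; simp [hc] at hl'
        exact h
      · refine Submodule.mem_sup_right (mem_F1_iff.2 fun l' hl' => ?_)
        obtain rfl : l = l' := by by_contra hc; simp [hc] at hl'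
        exact h

lemma finite_F0 (p : ℕ) : Module.Finite ℂ (F0 n m p) := by
  have hfin : {l : Occ n m | l.total ≤ p}.Finite := by
    let g : Occ n m → Fin (n + m) → ℕ := fun l i => l.1 i
    have hg : Function.Injective g := fun l l' h => Occ.ext' fun i => by
      by_cases hi : i < n + m
      · exact congrFun h ⟨i, hi⟩
      · rw [l.apply_eq_zero (by omega), l'.apply_eq_zero (by omega)]
    refine Set.Finite.of_finite_image (f := g) ?_ hg.injOn
    refine (Set.Finite.pi' (t := fun _ : Fin (n + m) => Set.Iic p) fun _ => Set.finite_Iic p).subset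
      ?_
    rintro _ ⟨l, hl, rfl⟩ i
    by_cases h0 : l.1 i = 0
    · simp [g, h0]
    · exact (Finset.single_le_sum (f := l.1) (fun _ _ => Nat.zero_le _)
        (Finset.mem_Ico.2 (l.2.1 i h0))).trans hl
  have hset : {v | ∃ l : Occ n m, l.total ≤ p ∧ v = Finsupp.single l (1 : ℂ)}
      = (fun l => Finsupp.single l 1) '' {l : Occ n m | l.total ≤ p} := by
    ext v; simp [eq_comm]
  rw [F0, hset]
  exact Module.Finite.span_of_finite ℂ (hfin.image _)

/-! ### Membership in the algebra of creation and annihilation operators -/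

lemma diag_mem_W (φ : Occ n m → ℂ) : diag φ ∈ W n m :=
  Algebra.subset_adjoin (.inr ⟨φ, rfl⟩)

lemma Ap_mem_W {i : ℕ} (hi : 1 ≤ i ∧ i < n + m) : Ap n m i ∈ W n m :=
  Algebra.subset_adjoin (.inl ⟨RingQuot.mkAlgHom ℂ _ (FreeAlgebra.ι ℂ (CAO.plus i hi)), by
    simp [fockRep]⟩)

lemma Am_mem_W {i : ℕ} (hi : 1 ≤ i ∧ i < n + m) : Am n m i ∈ W n m :=
  Algebra.subset_adjoin (.inl ⟨RingQuot.mkAlgHom ℂ _ (FreeAlgebra.ι ℂ (CAO.minus i hi)), by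
    simp [fockRep]⟩)

section

variable {R B : Type*} [CommRing R] [Ring B] {D : (Occ n m → R) → B} {ap am : ℕ → B}
  {S : Type*} [SetLike S B] [SubmonoidClass S B] {A : S}

lemma hpE_mem (hD : ∀ φ, D φ ∈ A) (hap : ∀ i, 1 ≤ i ∧ i < n + m → ap i ∈ A)
    (ham : ∀ i, 1 ≤ i ∧ i < n + m → am i ∈ A) (s : ℤ → R) (t : ℕ → R) {i : ℕ}
    (hi : 1 ≤ i ∧ i < n + m) : hpE D ap am s t i ∈ A := by
  rw [hpE]
  split_ifs with h
  · exact mul_mem (mul_mem (hD _) (hD _)) (ham 1 (h ▸ hi))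
  · exact mul_mem (mul_mem (mul_mem (hD _) (hD _)) (hap _ ⟨by omega, by omega⟩)) (ham i hi)

lemma hpF_mem (hD : ∀ φ, D φ ∈ A) (hap : ∀ i, 1 ≤ i ∧ i < n + m → ap i ∈ A)
    (ham : ∀ i, 1 ≤ i ∧ i < n + m → am i ∈ A) (s : ℤ → R) (t : ℕ → R) {i : ℕ}
    (hi : 1 ≤ i ∧ i < n + m) : hpF D ap am s t i ∈ A := by
  rw [hpF]
  split_ifs with h
  · exact mul_mem (mul_mem (hD _) (hD _)) (hap 1 (h ▸ hi))
  · exact mul_mem (mul_mem (mul_mem (hD _) (hD _)) (hap i hi)) (ham _ ⟨by omega, by omega⟩)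

end

section

variable {h : ℂ}

/-! ### The homomorphism for a numerical parameter -/

/-- The generators `q ^ (-h j)`. -/
def UN.kinv (n m : ℕ) (h : ℂ) (j : ℕ) : UN n m h := UN.mk n m h (GenN.kinvF n m j)

lemma UN.mk_surjective : Function.Surjective (UN.mk n m h) := RingQuot.mkAlgHom_surjective ℂ _

lemma UN.mk_eq_of_rel {x y : FreeAlgebra ℂ (GenN n m)} (hxy : relN n m h x y) :
    UN.mk n m h x = UN.mk n m h y := RingQuot.mkAlgHom_rel ℂ hxy

lemma UN.induction {P : UN n m h → Prop} (algebraMap : ∀ z : ℂ, P (algebraMap ℂ _ z))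
    (add : ∀ a b, P a → P b → P (a + b)) (mul : ∀ a b, P a → P b → P (a * b))
    (h_h : ∀ j, 1 ≤ j ∧ j ≤ n + m → P (UN.h n m h j))
    (h_k : ∀ j, 1 ≤ j ∧ j ≤ n + m → P (UN.k n m h j))
    (h_kinv : ∀ j, 1 ≤ j ∧ j ≤ n + m → P (UN.kinv n m h j))
    (h_e : ∀ i, 1 ≤ i ∧ i < n + m → P (UN.e n m h i))
    (h_f : ∀ i, 1 ≤ i ∧ i < n + m → P (UN.f n m h i)) (a : UN n m h) : P a := by
  obtain ⟨x, rfl⟩ := UN.mk_surjective a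
  induction x using FreeAlgebra.induction with
  | grade0 z => rw [AlgHom.commutes]; exact algebraMap z
  | grade1 g =>
    cases g with
    | h j hj => simpa [UN.h, GenN.hF, hj] using h_h j hj
    | k j hj => simpa [UN.k, GenN.kF, hj] using h_k j hj
    | kinv j hj => simpa [UN.kinv, GenN.kinvF, hj] using h_kinv j hj
    | e j hj => simpa [UN.e, GenN.eF, hj] using h_e j hj
    | f j hj => simpa [UN.f, GenN.fF, hj] using h_f j hj
  | mul a b ha hb => rw [map_mul]; exact mul _ _ ha hb
  | add a b ha hb => rw [map_add]; exact add _ _ ha hb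

lemma UN.k_mul_kinv {j : ℕ} (hj : 1 ≤ j ∧ j ≤ n + m) :
    UN.k n m h j * UN.kinv n m h j = 1 := by
  rw [UN.k, UN.kinv, ← map_mul, UN.mk_eq_of_rel (.k_kinv j hj), map_one]

lemma UN.kinv_mul_k {j : ℕ} (hj : 1 ≤ j ∧ j ≤ n + m) :
    UN.kinv n m h j * UN.k n m h j = 1 := by
  rw [UN.k, UN.kinv, ← map_mul, UN.mk_eq_of_rel (.kinv_k j hj), map_one]

/-- The images of the generators. -/
def genImageN (n m : ℕ) (h p : ℂ) (ρ : ℕ → ℤ → ℂ) : GenN n m → Op n m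
  | .h j _ => diagOp fun l => weight p j l.config
  | .k j _ => diagOp fun l => nPow h (weight p j l.config)
  | .kinv j _ => diagOp fun l => nPow h (-weight p j l.config)
  | .e i _ => opE ρ i
  | .f i _ => opF ρ i

lemma diagOp_one {R : Type*} [CommRing R] :
    (diagOp fun _ => 1 : Module.End R (Occ n m →₀ R)) = 1 := (diagHom R n m).map_one

lemma diagOp_sub (φ ψ : Occ n m → ℂ) :
    (diagOp φ - diagOp ψ : Op n m) = diagOp fun l => φ l - ψ l :=
  end_ext fun l => by
    rw [LinearMap.sub_apply, diagOp_single, diagOp_single, diagOp_single, sub_smul]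

lemma smul_diagOp (z : ℂ) (φ : Occ n m → ℂ) :
    (z • diagOp φ : Op n m) = diagOp fun l => z * φ l :=
  end_ext fun l => by rw [LinearMap.smul_apply, diagOp_single, diagOp_single, smul_smul]

/-- The operators `q ^ (h_j)` rescale a displacement by a power of `q`. -/
lemma diagOp_nPow_mul_moveOp (p : ℂ) {j : ℕ} {v : ℕ → ℤ} {w : (ℕ → ℤ) → ℂ} {d : ℂ}
    (hd : (v j : ℂ) = d) :
    diagOp (fun l => nPow h (weight p (j + 1) l.config)) * (moveOp v w : Op n m)
      = nPow h d • (moveOp v w * diagOp fun l => nPow h (weight p (j + 1) l.config)) := by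
  rw [diagOp_mul_moveOp (ψ := fun l => nPow h d * nPow h (weight p (j + 1) l.config))
    fun l l' hl => by rw [hl, weight_add_hop, hd, nPow_add, mul_comm], ← smul_diagOp,
    mul_smul_comm]

lemma genImageN_rel (hn : 1 ≤ n) (hq : ∀ k : ℕ, 0 < k → nPow h 1 ^ k ≠ 1) {p : ℂ}
    {ρ : ℕ → ℤ → ℂ} (hρ : IsAmplitude n (nBracket h) p ρ) {x y : FreeAlgebra ℂ (GenN n m)}
    (hxy : relN n m h x y) : FreeAlgebra.lift ℂ (genImageN n m h p ρ) x
      = FreeAlgebra.lift ℂ (genImageN n m h p ρ) y := by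
  have hH : ∀ j, 1 ≤ j ∧ j ≤ n + m → FreeAlgebra.lift ℂ (genImageN n m h p ρ) (GenN.hF n m j)
      = diagOp fun l => weight p j l.config := fun j hj => by simp [GenN.hF, hj, genImageN]
  have hK : ∀ j, 1 ≤ j ∧ j ≤ n + m → FreeAlgebra.lift ℂ (genImageN n m h p ρ) (GenN.kF n m j)
      = diagOp fun l => nPow h (weight p j l.config) := fun j hj => by
    simp [GenN.kF, hj, genImageN]
  have hKi : ∀ j, 1 ≤ j ∧ j ≤ n + m →
      FreeAlgebra.lift ℂ (genImageN n m h p ρ) (GenN.kinvF n m j)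
        = diagOp fun l => nPow h (-weight p j l.config) := fun j hj => by
    simp [GenN.kinvF, hj, genImageN]
  have hE : ∀ i, 1 ≤ i ∧ i < n + m → FreeAlgebra.lift ℂ (genImageN n m h p ρ) (GenN.eF n m i)
      = opE ρ i := fun j hj => by simp [GenN.eF, hj, genImageN]
  have hF : ∀ i, 1 ≤ i ∧ i < n + m → FreeAlgebra.lift ℂ (genImageN n m h p ρ) (GenN.fF n m i)
      = opF ρ i := fun j hj => by simp [GenN.fF, hj, genImageN]
  cases hxy with
  | gl x y hxy =>
    refine GlRel.map_eq (E := Op n m) (B := Op n m)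
      (FreeAlgebra.lift ℂ (genImageN n m h p ρ)).toRingHom
      (RingHom.id (Op n m)) (c' := algebraMap ℂ (Op n m) (nPow h 1 + nPow h (-1)))
      (AlgHom.commutes _ _) hH hE hF
      (fun i hi => ?_) (fun y z => glRel_op hn (isBracket_nBracket hq) hρ) hxy
    have h1 : 1 ≤ i ∧ i ≤ n + m := ⟨hi.1, hi.2.le⟩
    have h2 : 1 ≤ i + 1 ∧ i + 1 ≤ n + m := ⟨by omega, hi.2⟩
    have hb : ∀ z : ℂ, (nPow h 1 - nPow h (-1))⁻¹ * (nPow h z - nPow h (-z)) = nBracket h z :=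
      fun z => by rw [nBracket, div_eq_inv_mul]
    change FreeAlgebra.lift ℂ (genImageN n m h p ρ) _ = _
    rw [map_smul]
    split_ifs with hin
    · rw [map_sub, map_mul, map_mul, hK i h1, hK _ h2, hKi i h1, hKi _ h2, diagOp_mul, diagOp_mul,
        diagOp_sub, smul_diagOp]
      congr 1
      funext l
      simp only [Pi.mul_apply, ← nPow_add, cartan, hin, if_true, ← hb]
      rw [neg_add]
    · rw [map_sub, map_mul, map_mul, hK i h1, hK _ h2, hKi i h1, hKi _ h2, diagOp_mul, diagOp_mul,
        diagOp_sub, smul_diagOp]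
      congr 1
      funext l
      simp only [Pi.mul_apply, ← nPow_add, cartan, hin, if_false, ← hb]
      rw [neg_sub, sub_eq_add_neg (weight p i _), neg_add_eq_sub]
  | k_kinv j hj =>
    rw [map_mul, hK j hj, hKi j hj, diagOp_mul, map_one, ← diagOp_one]
    congr 1
    funext l
    rw [Pi.mul_apply, ← nPow_add, add_neg_cancel, nPow_zero]
  | kinv_k j hj =>
    rw [map_mul, hK j hj, hKi j hj, diagOp_mul, map_one, ← diagOp_one]
    congr 1
    funext l
    rw [Pi.mul_apply, ← nPow_add, neg_add_cancel, nPow_zero]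
  | kk i j hi hj => rw [map_mul, map_mul, hK i hi, hK j hj, diagOp_mul, diagOp_mul, mul_comm]
  | kh i j hi hj => rw [map_mul, map_mul, hK i hi, hH j hj, diagOp_mul, diagOp_mul, mul_comm]
  | ke i j hi hj =>
    obtain ⟨a, rfl⟩ : ∃ a, i = a + 1 := ⟨i - 1, by omega⟩
    obtain ⟨b, rfl⟩ : ∃ b, j = b + 1 := ⟨j - 1, by omega⟩
    rw [map_mul, map_smul, map_mul, hK _ hi, hE _ hj, opE]
    refine diagOp_nPow_mul_moveOp p ?_
    simp only [hop, add_tsub_cancel_right, add_left_inj]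
    push_cast
    rfl
  | kf i j hi hj =>
    obtain ⟨a, rfl⟩ : ∃ a, i = a + 1 := ⟨i - 1, by omega⟩
    obtain ⟨b, rfl⟩ : ∃ b, j = b + 1 := ⟨j - 1, by omega⟩
    rw [map_mul, map_smul, map_mul, hK _ hi, hF _ hj, opF]
    refine diagOp_nPow_mul_moveOp p ?_
    simp only [hop, add_tsub_cancel_right, add_left_inj]
    push_cast
    ring

/-- The Holstein-Primakoff representation for a numerical parameter. -/
def repN (hn : 1 ≤ n) (hq : ∀ k : ℕ, 0 < k → nPow h 1 ^ k ≠ 1) {p : ℂ} {ρ : ℕ → ℤ → ℂ}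
    (hρ : IsAmplitude n (nBracket h) p ρ) : UN n m h →ₐ[ℂ] Op n m :=
  RingQuot.liftAlgHom ℂ
    ⟨FreeAlgebra.lift ℂ (genImageN n m h p ρ), fun _ _ hxy => genImageN_rel hn hq hρ hxy⟩

lemma repN_mk (hn : 1 ≤ n) (hq : ∀ k : ℕ, 0 < k → nPow h 1 ^ k ≠ 1) {p : ℂ} {ρ : ℕ → ℤ → ℂ}
    (hρ : IsAmplitude n (nBracket h) p ρ) (x : FreeAlgebra ℂ (GenN n m)) :
    repN hn hq hρ (UN.mk n m h x) = FreeAlgebra.lift ℂ (genImageN n m h p ρ) x :=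
  RingQuot.liftAlgHom_mkAlgHom_apply ..

lemma weight_config (p : ℂ) {j : ℕ} (hj : 1 ≤ j) (l : Occ n m) :
    weight p j l.config = if j = 1 then p - l.total else (l.1 (j - 1) : ℂ) := by
  rw [weight]
  split_ifs with h1
  · subst h1
    rw [Nat.sub_self, l.config_zero]; push_cast; ring
  · rw [l.config_of_ne (by omega)]; simp

lemma isHPN_repN (hn : 1 ≤ n) (hq : ∀ k : ℕ, 0 < k → nPow h 1 ^ k ≠ 1) {p : ℂ} {s : ℤ → ℂ}
    {t : ℕ → ℂ} (hr : IsRoots (nBracket h) p s t) :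
    IsHPN p s t (repN (m := m) hn hq (isAmplitude_hpAmp hn hr)) where
  map_h j hj := by
    rw [UN.h, repN_mk, isRealization_id.hpH_eq p hj.1]
    simp [GenN.hF, hj, genImageN]
  map_k j hj := by
    rw [UN.k, repN_mk]
    simp only [← weight_config p hj.1]
    simp only [GenN.kF, hj, genImageN, and_self, dif_pos, FreeAlgebra.lift_ι_apply]
    rfl
  map_e i hi := by
    rw [UN.e, repN_mk, isRealization_id.hpE_eq s t hi]
    simp [GenN.eF, hi, genImageN]
  map_f i hi := by
    rw [UN.f, repN_mk, isRealization_id.hpF_eq s t hi]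
    simp [GenN.fF, hi, genImageN]

section Generators

variable {p : ℂ} {s : ℤ → ℂ} {t : ℕ → ℂ} {π : UN n m h →ₐ[ℂ] Op n m}

lemma IsHPN.map_h_eq (hπ : IsHPN p s t π) {j : ℕ} (hj : 1 ≤ j ∧ j ≤ n + m) :
    π (UN.h n m h j) = diagOp fun l => weight p j l.config := by
  rw [hπ.map_h j hj, isRealization_id.hpH_eq p hj.1]; rfl

lemma IsHPN.map_k_eq (hπ : IsHPN p s t π) {j : ℕ} (hj : 1 ≤ j ∧ j ≤ n + m) :
    π (UN.k n m h j) = diagOp fun l => nPow h (weight p j l.config) := by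
  rw [hπ.map_k j hj]; simp only [← weight_config p hj.1]; rfl

lemma IsHPN.map_kinv_eq (hπ : IsHPN p s t π) {j : ℕ} (hj : 1 ≤ j ∧ j ≤ n + m) :
    π (UN.kinv n m h j) = diagOp fun l => nPow h (-weight p j l.config) := by
  have h1 : π (UN.kinv n m h j) * π (UN.k n m h j) = 1 := by
    rw [← map_mul, UN.kinv_mul_k hj, map_one]
  have h2 : π (UN.k n m h j) * diagOp (fun l => nPow h (-weight p j l.config)) = 1 := by
    rw [hπ.map_k_eq hj, diagOp_mul, ← diagOp_one]
    congr 1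
    funext l
    rw [Pi.mul_apply, ← nPow_add, add_neg_cancel, nPow_zero]
  exact left_inv_eq_right_inv h1 h2

lemma IsHPN.map_e_eq (hπ : IsHPN p s t π) {i : ℕ} (hi : 1 ≤ i ∧ i < n + m) :
    π (UN.e n m h i) = opE (hpAmp n s t) i := by
  rw [hπ.map_e i hi, isRealization_id.hpE_eq s t hi]; rfl

lemma IsHPN.map_f_eq (hπ : IsHPN p s t π) {i : ℕ} (hi : 1 ≤ i ∧ i < n + m) :
    π (UN.f n m h i) = opF (hpAmp n s t) i := by
  rw [hπ.map_f i hi, isRealization_id.hpF_eq s t hi]; rfl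

lemma IsHPN.unique {π' : UN n m h →ₐ[ℂ] Op n m} (hπ : IsHPN p s t π) (hπ' : IsHPN p s t π') :
    π' = π := by
  refine AlgHom.ext fun a => ?_
  induction a using UN.induction with
  | algebraMap z => rw [AlgHom.commutes, AlgHom.commutes]
  | add a b ha hb => rw [map_add, map_add, ha, hb]
  | mul a b ha hb => rw [map_mul, map_mul, ha, hb]
  | h_h j hj => rw [hπ.map_h j hj, hπ'.map_h j hj]
  | h_k j hj => rw [hπ.map_k j hj, hπ'.map_k j hj]
  | h_kinv j hj => rw [hπ.map_kinv_eq hj, hπ'.map_kinv_eq hj]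
  | h_e i hi => rw [hπ.map_e i hi, hπ'.map_e i hi]
  | h_f i hi => rw [hπ.map_f i hi, hπ'.map_f i hi]

lemma IsHPN.mem_of_generators (hπ : IsHPN p s t π) {S : Subalgebra ℂ (Op n m)}
    (hdiag : ∀ φ, diag φ ∈ S) (he : ∀ i, 1 ≤ i ∧ i < n + m → π (UN.e n m h i) ∈ S)
    (hf : ∀ i, 1 ≤ i ∧ i < n + m → π (UN.f n m h i) ∈ S) (a : UN n m h) : π a ∈ S := by
  induction a using UN.induction with
  | algebraMap z => rw [AlgHom.commutes]; exact S.algebraMap_mem z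
  | add a b ha hb => rw [map_add]; exact add_mem ha hb
  | mul a b ha hb => rw [map_mul]; exact mul_mem ha hb
  | h_h j hj => rw [hπ.map_h_eq hj]; exact hdiag _
  | h_k j hj => rw [hπ.map_k_eq hj]; exact hdiag _
  | h_kinv j hj => rw [hπ.map_kinv_eq hj]; exact hdiag _
  | h_e i hi => exact he i hi
  | h_f i hi => exact hf i hi

lemma IsHPN.mem_W (hπ : IsHPN p s t π) (a : UN n m h) : π a ∈ W n m := by
  refine hπ.mem_of_generators diag_mem_W (fun i hi => ?_) (fun i hi => ?_) a
  · rw [hπ.map_e i hi]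
    exact hpE_mem diag_mem_W (fun _ => Ap_mem_W) (fun _ => Am_mem_W) s t hi
  · rw [hπ.map_f i hi]
    exact hpF_mem diag_mem_W (fun _ => Ap_mem_W) (fun _ => Am_mem_W) s t hi

lemma IsHPN.respectsDegree (hn : 1 ≤ n) (hπ : IsHPN p s t π) :
    RespectsDegree n m (parityOp n m) (fun j => π (UN.h n m h j)) (fun i => π (UN.e n m h i))
      (fun i => π (UN.f n m h i)) := by
  have := HP.respectsDegree (m := m) (B := Op n m) hn p (hpAmp n s t)
    (RingHom.id (Module.End ℂ (Occ n m →₀ ℂ)))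
  refine ⟨fun j hj => ?_, fun i hi => ?_⟩
  · simp only [hπ.map_h_eq hj]
    exact this.1 j hj
  · simp only [hπ.map_e_eq hi, hπ.map_f_eq hi]
    exact this.2 i hi

end Generators

lemma IsHPN.mem_stab (hn : 1 ≤ n) {p : ℕ} {s : ℤ → ℂ} {t : ℕ → ℂ} {π : UN n m h →ₐ[ℂ] Op n m}
    (hr : IsRoots (nBracket h) p s t) (hπ : IsHPN p s t π) (a : UN n m h) :
    π a ∈ stab n m p := by
  have h0 : nBracket h 0 = 0 := by simp [nBracket]
  have hρ := isAmplitude_hpAmp hn hr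
  refine hπ.mem_of_generators (diag_mem_stab p) (fun i hi => ?_) (fun i hi => ?_) a
  · rw [hπ.map_e_eq hi]
    exact moveOp_mem_stab fun l l' hl hw => total_le_iff_of_opE hρ h0 hi.1 hl hw
  · rw [hπ.map_f_eq hi]
    exact moveOp_mem_stab fun l l' hl hw => total_le_iff_of_opF hρ h0 hi.1 hl hw

/-! ### Irreducibility and inequivalence -/

lemma sum_range_config (hn : 1 ≤ n) (l : Occ n m) :
    ∑ k ∈ Finset.range (n + m), l.config k = 0 := by
  rw [Finset.range_eq_Ico, Finset.sum_eq_sum_Ico_succ_bot (by omega), zero_add,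
    l.config_zero_eq_neg_sum, neg_add_cancel]

/-- The number of hops towards the site `0` that lead from `l` to the vacuum. -/
def Occ.height (l : Occ n m) : ℕ := ∑ k ∈ Finset.range (n + m), k * l.1 k

lemma Occ.height_of_hop {l l' : Occ n m} {i : ℕ} (hi : 1 ≤ i ∧ i < n + m)
    (h : l'.config = l.config + hop (i - 1) i) : l'.height + 1 = l.height := by
  have key : ∀ l : Occ n m, (l.height : ℤ) = ∑ k ∈ Finset.range (n + m), k * l.config k := by
    intro l
    rw [Occ.height, Nat.cast_sum]
    refine Finset.sum_congr rfl fun k _ => ?_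
    rcases eq_or_ne k 0 with rfl | hk
    · simp
    · rw [l.config_of_ne hk, Nat.cast_mul]
  have h1 := key l
  have h2 := key l'
  have h3 : ∑ k ∈ Finset.range (n + m), (k : ℤ) * hop (i - 1) i k = -1 := by
    simp only [hop, mul_sub, mul_ite, mul_one, mul_zero, Finset.sum_sub_distrib,
      Finset.sum_ite_eq', Finset.mem_range]
    rw [if_pos (by omega), if_pos hi.2]
    omega
  rw [h] at h2
  simp only [Pi.add_apply, mul_add, Finset.sum_add_distrib, h3] at h2
  omega

section Amplitude

variable {p : ℕ} {ρ : ℕ → ℤ → ℂ}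

lemma IsAmplitude.ne_zero (hq : ∀ k : ℕ, 0 < k → nPow h 1 ^ k ≠ 1) {p : ℂ}
    (hρ : IsAmplitude n (nBracket h) p ρ) {i : ℕ} (hi : 1 ≤ i) {k : ℕ} (hk : 1 ≤ k)
    (hfermi : n ≤ i → k ≤ 1) : ρ i k ≠ 0 := by
  rcases lt_or_ge i n with h1 | h1
  · intro h0
    have h2 := hρ.bose_sq i hi h1 k (by omega)
    rw [h0, zero_pow two_ne_zero, Int.cast_natCast] at h2
    exact nBracket_natCast_ne_zero hq hk h2.symm
  · rw [hρ.fermi i h1, if_pos (by have := hfermi h1; omega)]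
    exact one_ne_zero

lemma IsAmplitude.zero_ne_zero (hq : ∀ k : ℕ, 0 < k → nPow h 1 ^ k ≠ 1)
    (hρ : IsAmplitude n (nBracket h) p ρ) {k : ℕ} (hk : k < p) : ρ 0 (-k) ≠ 0 := by
  intro h0
  have h2 := hρ.zero_sq (-k)
  rw [h0, zero_pow two_ne_zero, Int.cast_neg, Int.cast_natCast, ← sub_eq_add_neg,
    ← Nat.cast_sub hk.le] at h2
  exact nBracket_natCast_ne_zero hq (by omega) h2.symm

/-- Every configuration with `0 < N ≤ p` is connected with a lower one by a pair of operators
`opE`, `opF` with nonzero matrix elements. -/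
lemma exists_lower (hn : 1 ≤ n) (hq : ∀ k : ℕ, 0 < k → nPow h 1 ^ k ≠ 1)
    (hρ : IsAmplitude n (nBracket h) p ρ) {l : Occ n m} (hlp : l.total ≤ p)
    (hl0 : l.height ≠ 0) :
    ∃ (i : ℕ) (l' : Occ n m) (z : ℂ), (1 ≤ i ∧ i < n + m) ∧ l'.total ≤ p ∧
      l'.height < l.height ∧ z ≠ 0 ∧
      opE ρ i (Finsupp.single l 1) = z • Finsupp.single l' 1 ∧
      opF ρ i (Finsupp.single l' 1) = z • Finsupp.single l 1 := by
  have hex : ∃ i, l.1 i ≠ 0 := by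
    by_contra hc
    push Not at hc
    exact hl0 (Finset.sum_eq_zero fun k _ => by rw [hc, mul_zero])
  -- Move a particle from the lowest occupied site `i` to `i - 1`, which is empty or the site `0`.
  classical
  let i := Nat.find hex
  have hi0 : l.1 i ≠ 0 := Nat.find_spec hex
  have hmin : ∀ k < i, l.1 k = 0 := fun k hk => by simpa using Nat.find_min hex hk
  have hi := l.2.1 i hi0
  clear_value i
  obtain ⟨a, rfl⟩ : ∃ a, i = a + 1 := ⟨i - 1, by omega⟩
  have hla := hmin a (by omega)
  have hpos : 1 ≤ l.total := (Nat.one_le_iff_ne_zero.2 hi0).trans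
    (Finset.single_le_sum (f := l.1) (fun _ _ => Nat.zero_le _) (Finset.mem_Ico.2 hi))
  obtain ⟨l', hl'⟩ : ∃ l' : Occ n m, l'.config = l.config + hop a (a + 1) := by
    refine Occ.exists_config_eq_of_add_hop (l := l) (i := a + 1) (j := a) hn hi.2 (by omega)
      (by rw [← neg_hop a, add_neg_cancel_right]) (fun _ => ?_) fun hna => ?_
    · rw [Pi.add_apply, hop_snd, l.config_of_ne (by omega)]
      omega
    · rw [Pi.add_apply, hop_fst, l.config_of_ne (by omega), hla]
      norm_num
  refine ⟨a + 1, l', ρ a (l.config a + 1) * ρ (a + 1) (l.config (a + 1)), hi, ?_, ?_, ?_, ?_, ?_⟩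
  · have := Occ.total_of_hop hl'
    rcases eq_or_ne a 0 with rfl | ha
    · rw [hop_fst] at this; omega
    · rw [hop_of_ne (by omega) (by omega)] at this; omega
  · have := Occ.height_of_hop hi hl'
    omega
  · refine mul_ne_zero ?_ ?_
    · rcases eq_or_ne a 0 with rfl | ha
      · rw [l.config_zero, show -(l.total : ℤ) + 1 = -((l.total - 1 : ℕ) : ℤ) by omega]
        exact hρ.zero_ne_zero hq (by omega)
      · rw [l.config_of_ne ha, hla]
        exact hρ.ne_zero hq (i := a) (k := 1) (by omega) le_rfl fun _ => le_rfl
    · rw [l.config_of_ne (by omega)]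
      exact hρ.ne_zero hq hi.1 (by omega) (l.2.2 (a + 1))
  · rw [opE, moveOp_single, add_tsub_cancel_right, ← hl', ket_config]
  · rw [opF, moveOp_single, add_tsub_cancel_right, hl', ← neg_hop a, add_neg_cancel_right,
      ket_config, Pi.add_apply, Pi.add_apply, hop_fst, hop_snd, neg_add_cancel_right]

end Amplitude

lemma exists_single_mem_F0 (n m p : ℕ) : ∃ l : Occ n m, Finsupp.single l 1 ∈ F0 n m p := by
  obtain ⟨l, hl⟩ : ∃ l : Occ n m, ∀ i, l.1 i = 0 := ⟨⟨0, by simp, by simp⟩, fun _ => rfl⟩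
  exact ⟨l, Submodule.subset_span ⟨l, by simp [Occ.total, hl], rfl⟩⟩

lemma diagOp_apply (φ : Occ n m → ℂ) (x : Fock n m) (l : Occ n m) :
    diagOp φ x l = φ l * x l := by
  induction x using Finsupp.induction_linear with
  | zero => simp
  | add x y hx hy => rw [map_add, Finsupp.add_apply, hx, hy, Finsupp.add_apply, mul_add]
  | single l' z =>
    classical
    rw [diagOp, Finsupp.linearCombination_single, Finsupp.smul_single, smul_eq_mul,
      Finsupp.single_apply, Finsupp.single_apply]
    split_ifs with hl
    · rw [hl, mul_comm]
    · rw [mul_zero]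

section Numerical

variable {p : ℕ} {s : ℤ → ℂ} {t : ℕ → ℂ} {π : UN n m h →ₐ[ℂ] Op n m}

/-- A nonzero vector with the least number of components in an invariant subspace is a basis
vector, since the operators `h_j` separate the configurations. -/
lemma IsHPN.exists_single_mem {p : ℂ} (hπ : IsHPN p s t π) {V : Submodule ℂ (Fock n m)}
    (hV : IsInvariant π V) (hV0 : V ≠ ⊥) : ∃ l, Finsupp.single l 1 ∈ V := by
  classical
  have hex : ∃ k, ∃ x ∈ V, x ≠ 0 ∧ x.support.card = k := by
    obtain ⟨x, hx, hx0⟩ := V.ne_bot_iff.1 hV0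
    exact ⟨_, x, hx, hx0, rfl⟩
  obtain ⟨x, hx, hx0, hcard⟩ := Nat.find_spec hex
  obtain ⟨l, hl⟩ := Finsupp.ne_iff.1 hx0
  rw [Finsupp.zero_apply] at hl
  have hsupp : ∀ l', x l' ≠ 0 → l' = l := by
    intro l' hl'
    by_contra hne
    obtain ⟨j, hj⟩ : ∃ j, l'.1 j ≠ l.1 j := by
      by_contra hc
      push Not at hc
      exact hne (Occ.ext' hc)
    have hj1 : 1 ≤ j ∧ j < n + m := by
      rcases Nat.eq_zero_or_pos (l.1 j) with h0 | h0
      · exact l'.2.1 j (by omega)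
      · exact l.2.1 j (by omega)
    -- `y` has fewer components than `x`: it lacks the one at `l` and keeps the one at `l'`.
    let y := π (UN.h n m h (j + 1)) x - (l.1 j : ℂ) • x
    have hy : ∀ k : Occ n m, y k = ((k.1 j : ℂ) - l.1 j) * x k := fun k => by
      have : weight p (j + 1) k.config = k.1 j := by
        rw [weight_config p (by omega), if_neg (by omega)]; simp
      simp only [y]
      rw [hπ.map_h_eq ⟨by omega, by omega⟩, Finsupp.sub_apply, diagOp_apply, Finsupp.smul_apply,
        this, smul_eq_mul, sub_mul]
    have hy0 : y ≠ 0 := fun h0 => by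
      have h1 := hy l'
      rw [h0, Finsupp.zero_apply, eq_comm, mul_eq_zero, sub_eq_zero] at h1
      exact h1.elim (fun h2 => hj (by exact_mod_cast h2)) hl'
    have hyV : y ∈ V := sub_mem (hV _ x hx) (V.smul_mem _ hx)
    refine Nat.find_min hex (m := y.support.card) ?_ ⟨y, hyV, hy0, rfl⟩
    rw [← hcard]
    refine Finset.card_lt_card ((Finset.ssubset_iff_of_subset fun k hk => ?_).2 ⟨l, ?_, ?_⟩)
    · rw [Finsupp.mem_support_iff] at hk ⊢
      rw [hy] at hk
      exact right_ne_zero_of_mul hk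
    · rwa [Finsupp.mem_support_iff]
    · rw [Finsupp.mem_support_iff, hy, sub_self, zero_mul, not_not]
  refine ⟨l, ?_⟩
  have hxl : x = x l • Finsupp.single l 1 := by
    refine Finsupp.ext fun l' => ?_
    rw [Finsupp.smul_apply, Finsupp.single_apply, smul_eq_mul]
    split_ifs with h1
    · rw [h1, mul_one]
    · rw [mul_zero]
      by_contra h2
      exact h1 (hsupp l' h2).symm
  rw [hxl] at hx
  exact (V.smul_mem_iff hl).1 hx

lemma Occ.eq_of_height_eq_zero {l l' : Occ n m} (h : l.height = 0) (h' : l'.height = 0) :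
    l = l' := by
  have key : ∀ l : Occ n m, l.height = 0 → ∀ i, l.1 i = 0 := fun l h i => by
    by_contra h0
    have hi := l.2.1 i h0
    have := (Finset.sum_eq_zero_iff.1 h) i (Finset.mem_range.2 hi.2)
    rcases mul_eq_zero.1 this with h1 | h1
    · omega
    · exact h0 h1
  exact Occ.ext' fun i => by rw [key l h, key l' h']

/-- A basis vector in an invariant subspace is lowered to the vacuum by the `e_i`, and all basis
vectors of `F0 n m p` are obtained from the vacuum by the `f_i`. -/
lemma IsHPN.isIrreducible (hn : 1 ≤ n) (hq : ∀ k : ℕ, 0 < k → nPow h 1 ^ k ≠ 1)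
    (hr : IsRoots (nBracket h) p s t) (hπ : IsHPN p s t π) : IsIrreducible π (F0 n m p) := by
  have hρ := isAmplitude_hpAmp hn hr
  refine ⟨fun a => (hπ.mem_stab hn hr a).1, ?_, fun V hVle hV => ?_⟩
  · obtain ⟨l, h1⟩ := exists_single_mem_F0 n m p
    intro h0
    rw [h0, Submodule.mem_bot, Finsupp.single_eq_zero] at h1
    exact one_ne_zero h1
  by_cases hV0 : V = ⊥
  · exact .inl hV0
  refine .inr (le_antisymm hVle (Submodule.span_le.2 ?_))
  have hdown : ∀ k, ∀ l : Occ n m, l.height = k → l.total ≤ p → Finsupp.single l 1 ∈ V →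
      ∃ l' : Occ n m, l'.height = 0 ∧ Finsupp.single l' 1 ∈ V := by
    intro k
    induction k using Nat.strong_induction_on with
    | _ k ih =>
      intro l hk hlp hlV
      by_cases h0 : l.height = 0
      · exact ⟨l, h0, hlV⟩
      · obtain ⟨i, l', z, hi, hl'p, hlt, hz, hE, -⟩ := exists_lower hn hq hρ hlp h0
        refine ih l'.height (hk ▸ hlt) l' rfl hl'p ?_
        have := hV (UN.e n m h i) _ hlV
        rw [hπ.map_e_eq hi, hE] at this
        exact (V.smul_mem_iff hz).1 this
  obtain ⟨l₀, hl₀⟩ := hπ.exists_single_mem hV hV0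
  have hl₀p : l₀.total ≤ p := mem_F0_iff.1 (hVle hl₀) l₀ (by simp)
  obtain ⟨v, hv0, hv⟩ := hdown _ l₀ rfl hl₀p hl₀
  have hup : ∀ k, ∀ l : Occ n m, l.height = k → l.total ≤ p → Finsupp.single l 1 ∈ V := by
    intro k
    induction k using Nat.strong_induction_on with
    | _ k ih =>
      intro l hk hlp
      by_cases h0 : l.height = 0
      · rwa [Occ.eq_of_height_eq_zero h0 hv0]
      · obtain ⟨i, l', z, hi, hl'p, hlt, hz, -, hF⟩ := exists_lower hn hq hρ hlp h0
        have := hV (UN.f n m h i) _ (ih l'.height (hk ▸ hlt) l' rfl hl'p)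
        rw [hπ.map_f_eq hi, hF] at this
        exact (V.smul_mem_iff hz).1 this
  rintro _ ⟨l, hl, rfl⟩
  exact hup _ l rfl hl

/-- The central element `h_1 + … + h_{n+m}` acts by the number `p`. -/
lemma IsHPN.map_sum_h (hn : 1 ≤ n) {p : ℂ} (hπ : IsHPN p s t π) (x : Fock n m) :
    π (∑ j ∈ Finset.range (n + m), UN.h n m h (j + 1)) x = p • x := by
  refine Finsupp.ext fun l => ?_
  rw [map_sum, LinearMap.sum_apply, Finsupp.finsetSum_apply, Finsupp.smul_apply, smul_eq_mul]
  have h1 : ∀ j ∈ Finset.range (n + m), (π (UN.h n m h (j + 1)) x) l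
      = (if j = 0 then p * x l else 0) + (l.config j : ℂ) * x l := fun j hj => by
    rw [hπ.map_h_eq ⟨by omega, Finset.mem_range.1 hj⟩, diagOp_apply, weight, add_mul]
    simp
  rw [Finset.sum_congr rfl h1, Finset.sum_add_distrib, ← Finset.sum_mul, ← Int.cast_sum,
    sum_range_config hn, Int.cast_zero, zero_mul, add_zero, Finset.sum_ite_eq',
    if_pos (Finset.mem_range.2 (by omega))]

end Numerical

lemma not_areEquivalent (hn : 1 ≤ n) {p p' : ℕ} {s s' : ℤ → ℂ} {t t' : ℕ → ℂ}
    {π π' : UN n m h →ₐ[ℂ] Op n m} (hπ : IsHPN p s t π) (hπ' : IsHPN p' s' t' π')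
    (hne : p ≠ p') : ¬ AreEquivalent π π' (F0 n m p) (F0 n m p') := by
  rintro ⟨T, hT⟩
  obtain ⟨l, h1⟩ := exists_single_mem_F0 n m p
  let v : F0 n m p := ⟨_, h1⟩
  have hv : v ≠ 0 := fun h0 => by
    have := congrArg Subtype.val h0
    simp [v] at this
  have h2 := hT (∑ j ∈ Finset.range (n + m), UN.h n m h (j + 1)) v ((p : ℂ) • v)
    (by rw [hπ.map_sum_h hn]; rfl)
  rw [hπ'.map_sum_h hn, map_smul, Submodule.coe_smul, ← sub_eq_zero, ← sub_smul, smul_eq_zero,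
    sub_eq_zero] at h2
  rcases h2 with h2 | h2
  · exact hne (by exact_mod_cast h2)
  · exact hv (T.map_eq_zero_iff.1 (by exact_mod_cast h2))

end

/-! ### Continuous extension of homomorphisms to power series -/

section Extend

variable {F A : Type*} [Semiring F] [Semiring A]

/-- Additive maps of power series that commute with `X` are determined by their values on constants,
one coefficient of the value after the other. -/
lemma addMonoidHom_ext_of_map_X_mul {G G' : F⟦X⟧ →+ A⟦X⟧}
    (hC : ∀ x, G (PowerSeries.C x) = G' (PowerSeries.C x))
    (hX : ∀ a, G (PowerSeries.X * a) = PowerSeries.X * G a)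
    (hX' : ∀ a, G' (PowerSeries.X * a) = PowerSeries.X * G' a) : G = G' := by
  have key : ∀ k a, PowerSeries.coeff k (G a) = PowerSeries.coeff k (G' a) := by
    intro k
    induction k with
    | zero =>
      intro a
      rw [PowerSeries.eq_X_mul_shift_add_const a, map_add G, map_add G', hX, hX', hC,
        map_add, map_add, PowerSeries.coeff_zero_X_mul, PowerSeries.coeff_zero_X_mul]
    | succ k ih =>
      intro a
      rw [PowerSeries.eq_X_mul_shift_add_const a, map_add G, map_add G', hX, hX', hC,
        map_add, map_add, PowerSeries.coeff_succ_X_mul, PowerSeries.coeff_succ_X_mul, ih]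
  ext a k
  rw [key]

/-- The `X`-adically continuous additive extension of `φ` with `X ↦ X`. -/
def extendAdd (φ : F →+* A⟦X⟧) : F⟦X⟧ →+ A⟦X⟧ where
  toFun a := PowerSeries.mk fun k => ∑ ij ∈ Finset.HasAntidiagonal.antidiagonal k,
    PowerSeries.coeff ij.2 (φ (PowerSeries.coeff ij.1 a))
  map_zero' := by ext k; simp
  map_add' a b := by ext k; simp [Finset.sum_add_distrib]

lemma coeff_extendAdd (φ : F →+* A⟦X⟧) (a : F⟦X⟧) (k : ℕ) :
    PowerSeries.coeff k (extendAdd φ a) = ∑ ij ∈ Finset.HasAntidiagonal.antidiagonal k,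
      PowerSeries.coeff ij.2 (φ (PowerSeries.coeff ij.1 a)) := by
  simp [extendAdd]

lemma extendAdd_C (φ : F →+* A⟦X⟧) (x : F) : extendAdd φ (PowerSeries.C x) = φ x := by
  ext k
  rw [coeff_extendAdd, Finset.sum_eq_single (0, k)]
  · simp
  · rintro ⟨i, j⟩ hij hne
    rw [Finset.HasAntidiagonal.mem_antidiagonal] at hij
    rcases eq_or_ne i 0 with rfl | hi
    · exact absurd (by simpa using hij) (fun h => hne (by rw [h]))
    · simp [PowerSeries.coeff_C, hi]
  · intro h
    simp at h

lemma extendAdd_X_mul (φ : F →+* A⟦X⟧) (a : F⟦X⟧) :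
    extendAdd φ (PowerSeries.X * a) = PowerSeries.X * extendAdd φ a := by
  ext k
  cases k with
  | zero => rw [coeff_extendAdd]; simp
  | succ k =>
    rw [PowerSeries.coeff_succ_X_mul, coeff_extendAdd, coeff_extendAdd,
      Finset.Nat.sum_antidiagonal_succ]
    simp [PowerSeries.coeff_succ_X_mul]

lemma extendAdd_mul (φ : F →+* A⟦X⟧) (a b : F⟦X⟧) :
    extendAdd φ (a * b) = extendAdd φ a * extendAdd φ b := by
  have h1 : ∀ y a, extendAdd φ (a * PowerSeries.C y)
      = extendAdd φ a * extendAdd φ (PowerSeries.C y) := fun y a => by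
    have := addMonoidHom_ext_of_map_X_mul
      (G := (extendAdd φ).comp (AddMonoidHom.mulRight (PowerSeries.C y)))
      (G' := (AddMonoidHom.mulRight (extendAdd φ (PowerSeries.C y))).comp (extendAdd φ))
      (fun x => by simp [← map_mul, extendAdd_C])
      (fun a => by simp [mul_assoc, extendAdd_X_mul])
      (fun a => by simp [mul_assoc, extendAdd_X_mul])
    exact DFunLike.congr_fun this a
  have := addMonoidHom_ext_of_map_X_mul
    (G := (extendAdd φ).comp (AddMonoidHom.mulLeft a))
    (G' := (AddMonoidHom.mulLeft (extendAdd φ a)).comp (extendAdd φ))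
    (fun y => h1 y a)
    (fun b => by
      have h2 : a * (PowerSeries.X * b) = PowerSeries.X * (a * b) := by
        rw [← mul_assoc, (PowerSeries.commute_X a).eq, mul_assoc]
      simp [h2, extendAdd_X_mul])
    (fun b => by
      have h3 : extendAdd φ a * (PowerSeries.X * extendAdd φ b)
          = PowerSeries.X * (extendAdd φ a * extendAdd φ b) := by
        rw [← mul_assoc, (PowerSeries.commute_X (extendAdd φ a)).eq, mul_assoc]
      simp [h3, extendAdd_X_mul])
  exact DFunLike.congr_fun this b

/-- The `X`-adically continuous extension of `φ` with `X ↦ X`. -/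
def extend (φ : F →+* A⟦X⟧) : F⟦X⟧ →+* A⟦X⟧ :=
  { extendAdd φ with
    map_one' := by
      change extendAdd φ 1 = 1
      rw [← map_one PowerSeries.C, extendAdd_C, map_one]
    map_mul' := extendAdd_mul φ }

lemma extend_C (φ : F →+* A⟦X⟧) (x : F) : extend φ (PowerSeries.C x) = φ x := extendAdd_C φ x

lemma extend_X_mul (φ : F →+* A⟦X⟧) (a : F⟦X⟧) :
    extend φ (PowerSeries.X * a) = PowerSeries.X * extend φ a := extendAdd_X_mul φ a

lemma coeff_extend (φ : F →+* A⟦X⟧) (a : F⟦X⟧) (k : ℕ) :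
    PowerSeries.coeff k (extend φ a) = ∑ ij ∈ Finset.HasAntidiagonal.antidiagonal k,
      PowerSeries.coeff ij.2 (φ (PowerSeries.coeff ij.1 a)) := coeff_extendAdd φ a k

lemma extend_X_pow_mul (φ : F →+* A⟦X⟧) (k : ℕ) (a : F⟦X⟧) :
    extend φ (PowerSeries.X ^ k * a) = PowerSeries.X ^ k * extend φ a := by
  induction k with
  | zero => rw [pow_zero, pow_zero, one_mul, one_mul]
  | succ k ih => rw [pow_succ', pow_succ', mul_assoc, mul_assoc, extend_X_mul, ih]

lemma extend_eq_of_const (φ : F →+* A⟦X⟧) {a : F⟦X⟧} {b : A⟦X⟧}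
    (h : ∀ k, φ (PowerSeries.coeff k a) = PowerSeries.C (PowerSeries.coeff k b)) :
    extend φ a = b := by
  ext k
  rw [coeff_extend, Finset.sum_eq_single (k, 0)]
  · rw [h]; simp
  · rintro ⟨i, j⟩ hij hne
    rw [Finset.HasAntidiagonal.mem_antidiagonal] at hij
    rcases eq_or_ne j 0 with rfl | hj
    · exact absurd (by simpa using hij) (fun h => hne (by rw [h]))
    · simp [h, PowerSeries.coeff_C, hj]
  · intro h
    simp at h

/-- A homomorphism of power series rings with `X ↦ X` is determined by its values on constants. -/
lemma eq_extend (ψ : F⟦X⟧ →+* A⟦X⟧) (hX : ψ PowerSeries.X = PowerSeries.X) :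
    ψ = extend (ψ.comp PowerSeries.C) := by
  have := addMonoidHom_ext_of_map_X_mul
    (G := ψ.toAddMonoidHom) (G' := (extend (ψ.comp PowerSeries.C)).toAddMonoidHom)
    (fun x => by simp [extend_C]) (fun a => by simp [hX]) (fun a => by simp [extend_X_mul])
  exact RingHom.ext fun a => DFunLike.congr_fun this a

variable [Algebra ℂ F] [Algebra ℂ A]

lemma extend_map_algebraMap (φ : F →+* A⟦X⟧)
    (hφ : ∀ z : ℂ, φ (algebraMap ℂ F z) = PowerSeries.C (algebraMap ℂ A z)) (c : ℂ⟦X⟧) :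
    extend φ (PowerSeries.map (algebraMap ℂ F) c) = PowerSeries.map (algebraMap ℂ A) c :=
  extend_eq_of_const _ fun k => by rw [PowerSeries.coeff_map, PowerSeries.coeff_map, hφ]

lemma extend_fBracket {F A : Type*} [Ring F] [Ring A] [Algebra ℂ F] [Algebra ℂ A]
    (φ : F →+* A⟦X⟧) (hφ : ∀ z : ℂ, φ (algebraMap ℂ F z) = PowerSeries.C (algebraMap ℂ A z))
    {x : F} {y : A} (h : φ x = PowerSeries.C y) : extend φ (fBracket x) = fBracket y := by
  rw [fBracket, fBracket, map_mul, extend_map_algebraMap φ hφ]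
  congr 1
  refine extend_eq_of_const _ fun k => ?_
  rw [qSinh, qSinh, PowerSeries.coeff_mk, PowerSeries.coeff_mk]
  split_ifs
  · rw [Algebra.smul_def, Algebra.smul_def, map_mul, map_pow, hφ, h, map_mul, map_pow]
  · rw [map_zero, map_zero]

lemma extend_fBracket_add {F A : Type*} [Ring F] [Ring A] [Algebra ℂ F] [Algebra ℂ A]
    (φ : F →+* A⟦X⟧) (hφ : ∀ z : ℂ, φ (algebraMap ℂ F z) = PowerSeries.C (algebraMap ℂ A z))
    {x x' : F} {y y' : A} (h : φ x = PowerSeries.C y) (h' : φ x' = PowerSeries.C y') :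
    extend φ (fBracket (x + x')) = fBracket (y + y') :=
  extend_fBracket φ hφ (by rw [map_add, h, h', map_add])

lemma extend_fBracket_sub {F A : Type*} [Ring F] [Ring A] [Algebra ℂ F] [Algebra ℂ A]
    (φ : F →+* A⟦X⟧) (hφ : ∀ z : ℂ, φ (algebraMap ℂ F z) = PowerSeries.C (algebraMap ℂ A z))
    {x x' : F} {y y' : A} (h : φ x = PowerSeries.C y) (h' : φ x' = PowerSeries.C y') :
    extend φ (fBracket (x - x')) = fBracket (y - y') :=
  extend_fBracket φ hφ (by rw [map_sub, h, h', map_sub])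

/-- The power series with coefficients in a subalgebra. -/
def coeffSubalgebra (S : Subalgebra ℂ A) : Subalgebra ℂ A⟦X⟧ where
  carrier := {x | ∀ k, PowerSeries.coeff k x ∈ S}
  mul_mem' hx hy k := by
    rw [PowerSeries.coeff_mul]
    exact sum_mem fun ij _ => mul_mem (hx _) (hy _)
  add_mem' hx hy k := by
    rw [map_add]
    exact add_mem (hx k) (hy k)
  algebraMap_mem' c k := by
    rw [PowerSeries.algebraMap_apply, PowerSeries.coeff_C]
    split_ifs
    · exact S.algebraMap_mem c
    · exact zero_mem S

lemma C_mem_coeffSubalgebra {S : Subalgebra ℂ A} {x : A} (hx : x ∈ S) :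
    PowerSeries.C x ∈ coeffSubalgebra S := fun k => by
  rw [PowerSeries.coeff_C]
  split_ifs
  · exact hx
  · exact zero_mem S

end Extend

/-! ### The homomorphism for the formal parameter -/

section UH

variable {A : Type*} [Semiring A] [Algebra ℂ A] [Algebra ℂ⟦X⟧ A⟦X⟧]

/-- A homomorphism of `UH n m` is the continuous extension of its restriction to the free algebra on
the generators. -/
lemma UH.apply_mk (hA : ∀ c : ℂ⟦X⟧, algebraMap ℂ⟦X⟧ A⟦X⟧ c = PowerSeries.map (algebraMap ℂ A) c)
    (π : UH n m →ₐ[ℂ⟦X⟧] A⟦X⟧) (a : FreeH n m) :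
    π (UH.mk n m a)
      = extend (((π.comp (UH.mk n m)).toRingHom).comp PowerSeries.C) a := by
  have hX : (π.comp (UH.mk n m)) PowerSeries.X = PowerSeries.X := by
    have h1 : (PowerSeries.X : FreeH n m) = algebraMap ℂ⟦X⟧ (FreeH n m) PowerSeries.X :=
      (PowerSeries.map_X _).symm
    rw [h1, AlgHom.commutes, hA, PowerSeries.map_X]
  exact DFunLike.congr_fun (eq_extend (π.comp (UH.mk n m)).toRingHom hX) a

lemma UH.apply_mk_algebraMap
    (hA : ∀ c : ℂ⟦X⟧, algebraMap ℂ⟦X⟧ A⟦X⟧ c = PowerSeries.map (algebraMap ℂ A) c)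
    (π : UH n m →ₐ[ℂ⟦X⟧] A⟦X⟧) (z : ℂ) :
    π (UH.mk n m (PowerSeries.C (algebraMap ℂ _ z))) = algebraMap ℂ A⟦X⟧ z := by
  have h1 : PowerSeries.C (algebraMap ℂ (FreeAlgebra ℂ (Gen n m)) z)
      = algebraMap ℂ⟦X⟧ (FreeH n m) (PowerSeries.C z) := (PowerSeries.map_C _ _).symm
  rw [h1, AlgHom.commutes, AlgHom.commutes, hA, PowerSeries.algebraMap_apply, PowerSeries.map_C]

lemma UH.mk_surjective : Function.Surjective (UH.mk n m) := RingQuot.mkAlgHom_surjective ℂ⟦X⟧ _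

lemma UH.algHom_ext (hA : ∀ c : ℂ⟦X⟧, algebraMap ℂ⟦X⟧ A⟦X⟧ c = PowerSeries.map (algebraMap ℂ A) c)
    {π π' : UH n m →ₐ[ℂ⟦X⟧] A⟦X⟧}
    (hh : ∀ j, 1 ≤ j ∧ j ≤ n + m → π (UH.h n m j) = π' (UH.h n m j))
    (he : ∀ i, 1 ≤ i ∧ i < n + m → π (UH.e n m i) = π' (UH.e n m i))
    (hf : ∀ i, 1 ≤ i ∧ i < n + m → π (UH.f n m i) = π' (UH.f n m i)) : π = π' := by
  refine AlgHom.ext fun a => ?_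
  obtain ⟨a, rfl⟩ := UH.mk_surjective a
  rw [UH.apply_mk hA, UH.apply_mk hA]
  congr 1
  congr 1
  refine RingHom.ext fun x => ?_
  change π (UH.mk n m (PowerSeries.C x)) = π' (UH.mk n m (PowerSeries.C x))
  induction x using FreeAlgebra.induction with
  | grade0 z => rw [UH.apply_mk_algebraMap hA, UH.apply_mk_algebraMap hA]
  | grade1 g =>
    cases g with
    | h j hj => simpa [UH.h, Gen.hF, hj] using hh j hj
    | e j hj => simpa [UH.e, Gen.eF, hj] using he j hj
    | f j hj => simpa [UH.f, Gen.fF, hj] using hf j hj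
  | mul a b ha hb => simp only [map_mul, ha, hb]
  | add a b ha hb => simp only [map_add, ha, hb]

lemma UH.coeff_mem (hA : ∀ c : ℂ⟦X⟧, algebraMap ℂ⟦X⟧ A⟦X⟧ c = PowerSeries.map (algebraMap ℂ A) c)
    (π : UH n m →ₐ[ℂ⟦X⟧] A⟦X⟧) (S : Subalgebra ℂ A)
    (hh : ∀ j, 1 ≤ j ∧ j ≤ n + m → π (UH.h n m j) ∈ coeffSubalgebra S)
    (he : ∀ i, 1 ≤ i ∧ i < n + m → π (UH.e n m i) ∈ coeffSubalgebra S)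
    (hf : ∀ i, 1 ≤ i ∧ i < n + m → π (UH.f n m i) ∈ coeffSubalgebra S) (a : UH n m) (k : ℕ) :
    PowerSeries.coeff k (π a) ∈ S := by
  obtain ⟨a, rfl⟩ := UH.mk_surjective a
  rw [UH.apply_mk hA, coeff_extend]
  refine sum_mem fun ij _ => ?_
  generalize PowerSeries.coeff ij.1 a = x
  suffices h : π (UH.mk n m (PowerSeries.C x)) ∈ coeffSubalgebra S from h ij.2
  induction x using FreeAlgebra.induction with
  | grade0 z => rw [UH.apply_mk_algebraMap hA]; exact (coeffSubalgebra S).algebraMap_mem z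
  | grade1 g =>
    cases g with
    | h j hj => simpa [UH.h, Gen.hF, hj] using hh j hj
    | e j hj => simpa [UH.e, Gen.eF, hj] using he j hj
    | f j hj => simpa [UH.f, Gen.fF, hj] using hf j hj
  | mul a b ha hb => simp only [map_mul]; exact mul_mem ha hb
  | add a b ha hb => simp only [map_add]; exact add_mem ha hb

end UH

lemma expand_algebraMap (c : ℂ⟦X⟧) : expand n m (algebraMap ℂ⟦X⟧ _ c)
    = PowerSeries.map (algebraMap ℂ (Op n m)) c := by
  ext k : 1
  rw [coeff_expand, PowerSeries.coeff_map]
  refine op_ext fun l => ?_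
  rw [coeffOp_apply, constMap_single, map_one, Module.algebraMap_end_apply,
    Module.algebraMap_end_apply, ← ket_config, ← ket_config, coeffMap_ket]

lemma diag_pow (φ : Occ n m → ℂ) (k : ℕ) : (diag φ : Op n m) ^ k = diag (φ ^ k) :=
  (map_pow (diagHom ℂ n m) φ k).symm

lemma fBracket_diag (φ : Occ n m → ℂ) :
    fBracket (diag φ : Op n m) = diagH fun l => fBracket (φ l) := by
  have h1 : (fun l => fBracket (φ l) : Occ n m → ℂ⟦X⟧)
      = (fun _ => (qSinh (1 : ℂ))⁻¹) * fun l => qSinh (φ l) := by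
    funext l; simp [fBracket]
  have h2 : diagOp (fun _ : Occ n m => (qSinh (1 : ℂ))⁻¹) = algebraMap ℂ⟦X⟧ _ (qSinh (1 : ℂ))⁻¹ :=
    end_ext fun l => by rw [diagOp_single, Module.algebraMap_end_apply]
  rw [h1, ← expand_diagOp, ← diagOp_mul, map_mul, h2, expand_algebraMap, fBracket, expand_diagOp]
  congr 1
  ext k : 1
  rw [qSinh, diagH, PowerSeries.coeff_mk, PowerSeries.coeff_mk]
  simp only [qSinh, PowerSeries.coeff_mk]
  split_ifs
  · rw [diag_pow]
    exact smul_diagOp _ _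
  · exact ((diagHom ℂ n m).map_zero).symm

/-- The images of the generators. -/
def genImageH (n m : ℕ) (p : ℂ) (ρ : ℕ → ℤ → ℂ⟦X⟧) : Gen n m → (Op n m)⟦X⟧
  | .h j _ => PowerSeries.C (diag fun l => weight p j l.config)
  | .e i _ => expand n m (opE ρ i)
  | .f i _ => expand n m (opF ρ i)

/-- The homomorphism of the free algebra that is determined by the images of the generators. -/
def freeHomH (n m : ℕ) (p : ℂ) (ρ : ℕ → ℤ → ℂ⟦X⟧) :
    FreeAlgebra ℂ (Gen n m) →+* (Op n m)⟦X⟧ :=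
  (FreeAlgebra.lift ℂ (genImageH n m p ρ)).toRingHom

section Formal

variable {p : ℂ} {ρ : ℕ → ℤ → ℂ⟦X⟧}

lemma lift_hF {j : ℕ} (hj : 1 ≤ j ∧ j ≤ n + m) :
    freeHomH n m p ρ (Gen.hF n m j)
      = PowerSeries.C (diag fun l => weight p j l.config) := by
  simp [freeHomH, Gen.hF, hj, genImageH]

lemma lift_eF {i : ℕ} (hi : 1 ≤ i ∧ i < n + m) :
    freeHomH n m p ρ (Gen.eF n m i) = expand n m (opE ρ i) := by
  simp [freeHomH, Gen.eF, hi, genImageH]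

lemma lift_fF {i : ℕ} (hi : 1 ≤ i ∧ i < n + m) :
    freeHomH n m p ρ (Gen.fF n m i) = expand n m (opF ρ i) := by
  simp [freeHomH, Gen.fF, hi, genImageH]

lemma freeHomH_algebraMap (z : ℂ) : freeHomH n m p ρ (algebraMap ℂ _ z)
    = PowerSeries.C (algebraMap ℂ (Op n m) z) :=
  ((FreeAlgebra.lift ℂ (genImageH n m p ρ)).commutes z).trans PowerSeries.algebraMap_apply

lemma extend_freeHomH_fBracket_add {x x' : FreeAlgebra ℂ (Gen n m)} {y y' : Op n m}
    (h : freeHomH n m p ρ x = PowerSeries.C y) (h' : freeHomH n m p ρ x' = PowerSeries.C y') :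
    extend (freeHomH n m p ρ) (fBracket (x + x')) = fBracket (y + y') := by
  have := @extend_fBracket_add (FreeAlgebra ℂ (Gen n m)) (Op n m) _ _ _ _ (freeHomH n m p ρ)
    freeHomH_algebraMap x x' y y' h h'
  exact this

lemma extend_freeHomH_fBracket_sub {x x' : FreeAlgebra ℂ (Gen n m)} {y y' : Op n m}
    (h : freeHomH n m p ρ x = PowerSeries.C y) (h' : freeHomH n m p ρ x' = PowerSeries.C y') :
    extend (freeHomH n m p ρ) (fBracket (x - x')) = fBracket (y - y') := by
  have := @extend_fBracket_sub (FreeAlgebra ℂ (Gen n m)) (Op n m) _ _ _ _ (freeHomH n m p ρ)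
    freeHomH_algebraMap x x' y y' h h'
  exact this

lemma extend_genImageH_rel (hn : 1 ≤ n) (hρ : IsAmplitude n fBracket p ρ) {x y : FreeH n m}
    (hxy : relH n m x y) : extend (freeHomH n m p ρ) x
      = extend (freeHomH n m p ρ) y := by
  refine GlRel.map_eq (B := (Op n m)⟦X⟧) _ (expand n m)
    (c' := algebraMap ℂ⟦X⟧ (Module.End ℂ⟦X⟧ (Occ n m →₀ ℂ⟦X⟧)) (qPow 1 + qPow (-1)))
    ?_ (fun j hj => ?_) (fun i hi => ?_) (fun i hi => ?_) (fun i hi => ?_)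
    (fun y z => glRel_op hn isBracket_fBracket hρ) hxy
  · rw [extend_map_algebraMap _ freeHomH_algebraMap, expand_algebraMap]
  · rw [extend_C, expand_diagOp_const]
    exact lift_hF hj
  · rw [extend_C]
    exact lift_eF hi
  · rw [extend_C]
    exact lift_fF hi
  · have h1 := lift_hF (p := p) (ρ := ρ) (n := n) (m := m) (j := i) ⟨hi.1, hi.2.le⟩
    have h2 := lift_hF (p := p) (ρ := ρ) (n := n) (m := m) (j := i + 1) ⟨by omega, hi.2⟩
    rw [expand_diagOp, ← fBracket_diag]
    split_ifs with hin
    · refine (extend_freeHomH_fBracket_add h1 h2).trans (congrArg fBracket ?_)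
      simp only [cartan, hin, if_true]
      exact ((diagHom ℂ n m).map_add _ _).symm
    · refine (extend_freeHomH_fBracket_sub h1 h2).trans (congrArg fBracket ?_)
      simp only [cartan, hin, if_false]
      exact diagOp_sub _ _

/-- The continuous extension to the completed free algebra, as a `ℂ⟦X⟧`-linear map. -/
def extendGenImageH (n m : ℕ) (p : ℂ) (ρ : ℕ → ℤ → ℂ⟦X⟧) : FreeH n m →ₐ[ℂ⟦X⟧] (Op n m)⟦X⟧ :=
  { extend (freeHomH n m p ρ) with
    commutes' := fun c => extend_map_algebraMap _ freeHomH_algebraMap c }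

/-- The kernel of the continuous extension is closed: the images of two elements that agree modulo
the ideal of the relations and `X ^ (k + 1)` have the same coefficients up to `k`. -/
lemma extendGenImageH_closedRel (hn : 1 ≤ n) (hρ : IsAmplitude n fBracket p ρ) {a b : FreeH n m}
    (hab : closedRelH n m a b) : extendGenImageH n m p ρ a = extendGenImageH n m p ρ b := by
  let Φ := extend (freeHomH n m p ρ)
  change Φ a = Φ b
  have hker : TwoSidedIdeal.span {z | ∃ x y, relH n m x y ∧ z = x - y} ≤ TwoSidedIdeal.ker Φ := by
    rw [TwoSidedIdeal.span_le]
    rintro _ ⟨x, y, hxy, rfl⟩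
    rw [SetLike.mem_coe, TwoSidedIdeal.mem_ker, map_sub, sub_eq_zero]
    exact extend_genImageH_rel hn hρ hxy
  ext k : 1
  obtain ⟨d, hd⟩ := hab (k + 1)
  have h1 := (TwoSidedIdeal.mem_ker Φ).1 (hker hd)
  rw [map_sub, map_sub, sub_eq_zero, extend_X_pow_mul] at h1
  have h2 := congrArg (PowerSeries.coeff k) h1
  rw [map_sub, PowerSeries.X_pow_dvd_iff.1 (Dvd.intro _ rfl) k (Nat.lt_succ_self k),
    sub_eq_zero] at h2
  exact h2

/-- The Holstein-Primakoff homomorphism for the formal parameter. -/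
def repH (hn : 1 ≤ n) (hρ : IsAmplitude n fBracket p ρ) : UH n m →ₐ[ℂ⟦X⟧] (Op n m)⟦X⟧ :=
  RingQuot.liftAlgHom ℂ⟦X⟧
    ⟨extendGenImageH n m p ρ, fun _ _ hab => extendGenImageH_closedRel hn hρ hab⟩

lemma repH_mk_C (hn : 1 ≤ n) (hρ : IsAmplitude n fBracket p ρ) (x : FreeAlgebra ℂ (Gen n m)) :
    repH hn hρ (UH.mk n m (PowerSeries.C x)) = freeHomH n m p ρ x :=
  (RingQuot.liftAlgHom_mkAlgHom_apply ..).trans (extend_C _ _)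

variable {s : ℤ → ℂ⟦X⟧} {t : ℕ → ℂ⟦X⟧}

lemma isHPH_repH (hn : 1 ≤ n) (hr : IsRoots fBracket p s t) :
    IsHPH p s t (repH (m := m) hn (isAmplitude_hpAmp hn hr)) where
  map_h j hj := by
    rw [UH.h, repH_mk_C, lift_hF hj, isRealization_expand.hpH_eq p hj.1, expand_diagOp_const]
  map_e i hi := by rw [UH.e, repH_mk_C, lift_eF hi, isRealization_expand.hpE_eq s t hi]
  map_f i hi := by rw [UH.f, repH_mk_C, lift_fF hi, isRealization_expand.hpF_eq s t hi]

variable {π : UH n m →ₐ[ℂ⟦X⟧] (Op n m)⟦X⟧}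

lemma IsHPH.unique {π' : UH n m →ₐ[ℂ⟦X⟧] (Op n m)⟦X⟧} (hπ : IsHPH p s t π)
    (hπ' : IsHPH p s t π') : π' = π :=
  UH.algHom_ext (fun _ => rfl) (fun j hj => by rw [hπ.map_h j hj, hπ'.map_h j hj])
    (fun i hi => by rw [hπ.map_e i hi, hπ'.map_e i hi])
    (fun i hi => by rw [hπ.map_f i hi, hπ'.map_f i hi])

lemma IsHPH.map_h_mem (hπ : IsHPH p s t π) {S : Subalgebra ℂ (Op n m)} (hdiag : ∀ φ, diag φ ∈ S)
    {j : ℕ} (hj : 1 ≤ j ∧ j ≤ n + m) : π (UH.h n m j) ∈ coeffSubalgebra S := by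
  rw [hπ.map_h j hj, isRealization_expand.hpH_eq p hj.1, expand_diagOp_const]
  exact C_mem_coeffSubalgebra (hdiag _)

lemma diagH_mem_coeffSubalgebra {S : Subalgebra ℂ (Op n m)} (hdiag : ∀ φ, diag φ ∈ S)
    (φ : Occ n m → ℂ⟦X⟧) : diagH φ ∈ coeffSubalgebra S := fun k => by
  rw [diagH, PowerSeries.coeff_mk]
  exact hdiag _

lemma IsHPH.coeff_mem_W (hπ : IsHPH p s t π) (a : UH n m) (k : ℕ) :
    PowerSeries.coeff k (π a) ∈ W n m := by
  have hap : ∀ i, 1 ≤ i ∧ i < n + m → PowerSeries.C (Ap n m i) ∈ coeffSubalgebra (W n m) :=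
    fun _ hi => C_mem_coeffSubalgebra (Ap_mem_W hi)
  have ham : ∀ i, 1 ≤ i ∧ i < n + m → PowerSeries.C (Am n m i) ∈ coeffSubalgebra (W n m) :=
    fun _ hi => C_mem_coeffSubalgebra (Am_mem_W hi)
  refine UH.coeff_mem (fun _ => rfl) π _ (fun j => hπ.map_h_mem diag_mem_W)
    (fun i hi => ?_) (fun i hi => ?_) a k
  · rw [hπ.map_e i hi]
    exact hpE_mem (diagH_mem_coeffSubalgebra diag_mem_W) hap ham s t hi
  · rw [hπ.map_f i hi]
    exact hpF_mem (diagH_mem_coeffSubalgebra diag_mem_W) hap ham s t hi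

lemma IsHPH.coeff_mem_stab (hn : 1 ≤ n) {p : ℕ} (hr : IsRoots (fBracket (A := ℂ)) p s t)
    (hπ : IsHPH p s t π) (a : UH n m) (k : ℕ) : PowerSeries.coeff k (π a) ∈ stab n m p := by
  have h0 := isBracket_fBracket.zero
  have hρ := isAmplitude_hpAmp hn hr
  refine UH.coeff_mem (fun _ => rfl) π _ (fun j => hπ.map_h_mem (diag_mem_stab p))
    (fun i hi k => ?_) (fun i hi k => ?_) a k
  · rw [hπ.map_e i hi, isRealization_expand.hpE_eq s t hi, coeff_expand, opE, coeffOp_moveOp]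
    exact moveOp_mem_stab fun l l' hl hw =>
      total_le_iff_of_opE hρ h0 hi.1 hl fun h => hw (by rw [h, map_zero])
  · rw [hπ.map_f i hi, isRealization_expand.hpF_eq s t hi, coeff_expand, opF, coeffOp_moveOp]
    exact moveOp_mem_stab fun l l' hl hw =>
      total_le_iff_of_opF hρ h0 hi.1 hl fun h => hw (by rw [h, map_zero])

lemma IsHPH.respectsDegree (hn : 1 ≤ n) (hπ : IsHPH p s t π) :
    RespectsDegree n m (PowerSeries.C (parityOp n m)) (fun j => π (UH.h n m j))
      (fun i => π (UH.e n m i)) (fun i => π (UH.f n m i)) := by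
  have := HP.respectsDegree (B := (Op n m)⟦X⟧) (m := m) hn p (hpAmp n s t) (expand n m)
  rw [expand_diagOp_const] at this
  refine ⟨fun j hj => ?_, fun i hi => ?_⟩
  · simp only [hπ.map_h j hj, isRealization_expand.hpH_eq p hj.1]
    exact this.1 j hj
  · simp only [hπ.map_e i hi, hπ.map_f i hi, isRealization_expand.hpE_eq s t hi,
      isRealization_expand.hpF_eq s t hi]
    exact this.2 i hi

end Formal

section

variable {h : ℂ}

/-! ### The antilinear anti-involution -/

section Reverse

variable {A B : Type*} [Ring A] [Ring B] (φ : A →+* Bᵐᵒᵖ) (Ψ : A →+* B)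

/-- Reversing all products turns the Serre relations into themselves. -/
lemma SerreRel.map_reverse {c : A} {x y : ℕ → A} (hc : φ c = .op (Ψ c))
    (hcomm : ∀ a, Commute c a) (hx : ∀ i, 1 ≤ i ∧ i < n + m → φ (x i) = .op (Ψ (y i)))
    (hrel : ∀ a b, SerreRel n m c y a b → Ψ a = Ψ b) {a b : A} (hab : SerreRel n m c x a b) :
    φ a = φ b := by
  have hC : ∀ a, Ψ a * Ψ c = Ψ c * Ψ a := fun a => by
    rw [← map_mul, ← map_mul, (hcomm a).eq]
  refine MulOpposite.unop_injective ?_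
  cases hab with
  | comm i j hi hj hij =>
    have := hrel _ _ (.comm i j hi hj hij)
    simp only [map_mul] at this
    simp only [map_mul, MulOpposite.unop_mul, hx i hi, hx j hj, MulOpposite.unop_op, this]
  | sq hnm =>
    have := hrel _ _ (.sq hnm)
    simp only [map_pow, map_zero] at this
    simp only [map_pow, MulOpposite.unop_pow, hx n hnm, MulOpposite.unop_op, this, map_zero,
      MulOpposite.unop_zero]
  | up i hi hin =>
    have := hrel _ _ (.up i hi hin)
    simp only [map_add, map_sub, map_mul, map_pow, map_zero] at this
    simp only [map_add, map_sub, map_mul, map_pow, map_zero, MulOpposite.unop_add,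
      MulOpposite.unop_sub, MulOpposite.unop_mul, MulOpposite.unop_pow, MulOpposite.unop_zero,
      hx i ⟨hi.1, by omega⟩, hx (i + 1) ⟨by omega, hi.2⟩, hc, MulOpposite.unop_op]
    rw [← map_mul, ← map_mul, hC, map_mul, map_mul, ← mul_assoc (Ψ (y i)), ← this]
    abel
  | down i hi hin =>
    have := hrel _ _ (.down i hi hin)
    simp only [map_add, map_sub, map_mul, map_pow, map_zero] at this
    simp only [map_add, map_sub, map_mul, map_pow, map_zero, MulOpposite.unop_add,
      MulOpposite.unop_sub, MulOpposite.unop_mul, MulOpposite.unop_pow, MulOpposite.unop_zero,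
      hx i ⟨hi.1, by omega⟩, hx (i + 1) ⟨by omega, hi.2⟩, hc, MulOpposite.unop_op]
    rw [← map_mul, ← map_mul, hC, map_mul, map_mul, ← mul_assoc (Ψ (y (i + 1))), ← this]
    abel
  | quartic hn hm =>
    have := hrel _ _ (.quartic hn hm)
    have hbd := hrel _ _ (.comm (n - 1) (n + 1) (by omega) (by omega) (by omega))
    simp only [map_add, map_sub, map_mul, map_zero] at this hbd
    simp only [map_add, map_sub, map_mul, map_zero, MulOpposite.unop_add,
      MulOpposite.unop_sub, MulOpposite.unop_mul, MulOpposite.unop_zero,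
      hx n (by omega), hx (n - 1) (by omega), hx (n + 1) (by omega), hc, MulOpposite.unop_op]
    have h2 : Ψ (y n) * (Ψ (y (n + 1)) * (Ψ (y (n - 1)) * Ψ (y n))) * Ψ c
        = Ψ c * (Ψ (y n) * Ψ (y (n - 1)) * Ψ (y (n + 1)) * Ψ (y n)) := by
      rw [← mul_assoc (Ψ (y (n + 1))), ← hbd]
      simp only [← map_mul, hC]
      simp only [map_mul, mul_assoc]
    rw [h2, ← this]
    simp only [mul_assoc]
    abel

/-- Reversing all products and exchanging `e i` with `f i` turns the defining relations into
themselves. -/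
lemma GlRel.map_reverse {c : A} {h e f b : ℕ → A} (hc : φ c = .op (Ψ c))
    (hcomm : ∀ a, Commute c a) (hh : ∀ j, 1 ≤ j ∧ j ≤ n + m → φ (h j) = .op (Ψ (h j)))
    (he : ∀ i, 1 ≤ i ∧ i < n + m → φ (e i) = .op (Ψ (f i)))
    (hf : ∀ i, 1 ≤ i ∧ i < n + m → φ (f i) = .op (Ψ (e i)))
    (hb : ∀ i, 1 ≤ i ∧ i < n + m → φ (b i) = .op (Ψ (b i)))
    (hrel : ∀ y z, GlRel n m c h e f b y z → Ψ y = Ψ z) {y z : A}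
    (hyz : GlRel n m c h e f b y z) : φ y = φ z := by
  cases hyz with
  | serre_e _ _ hxy =>
    exact hxy.map_reverse φ Ψ hc hcomm he fun y z h => hrel _ _ (.serre_f y z h)
  | serre_f _ _ hxy =>
    exact hxy.map_reverse φ Ψ hc hcomm hf fun y z h => hrel _ _ (.serre_e y z h)
  | hh i j hi hj =>
    have := hrel _ _ (.hh i j hi hj)
    refine MulOpposite.unop_injective ?_
    simp only [map_mul] at this
    simp only [map_mul, MulOpposite.unop_mul, hh i hi, hh j hj, MulOpposite.unop_op, this]
  | he i j hi hj =>
    have := hrel _ _ (.hf i j hi hj)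
    refine MulOpposite.unop_injective ?_
    simp only [map_mul, map_sub] at this
    simp only [map_mul, map_sub, MulOpposite.unop_mul, MulOpposite.unop_sub, hh i hi, he j hj,
      MulOpposite.unop_op]
    rw [← neg_sub, this]
    split_ifs <;> simp
  | hf i j hi hj =>
    have := hrel _ _ (.he i j hi hj)
    refine MulOpposite.unop_injective ?_
    simp only [map_mul, map_sub] at this
    simp only [map_mul, map_sub, MulOpposite.unop_mul, MulOpposite.unop_sub, hh i hi, hf j hj,
      MulOpposite.unop_op]
    rw [← neg_sub, this]
    split_ifs <;> simp
  | ef_ne i j hi hj hij =>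
    have := hrel _ _ (.ef_ne j i hj hi hij.symm)
    refine MulOpposite.unop_injective ?_
    simp only [map_mul, map_sub, map_zero] at this
    simp only [map_mul, map_sub, map_zero, MulOpposite.unop_mul, MulOpposite.unop_sub,
      MulOpposite.unop_zero, he i hi, hf j hj, MulOpposite.unop_op, this]
  | ef_even i hi hin =>
    have := hrel _ _ (.ef_even i hi hin)
    refine MulOpposite.unop_injective ?_
    simp only [map_mul, map_sub] at this
    simp only [map_mul, map_sub, MulOpposite.unop_mul, MulOpposite.unop_sub, he i hi, hf i hi,
      hb i hi, MulOpposite.unop_op, this]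
  | ef_odd hnm =>
    have := hrel _ _ (.ef_odd hnm)
    refine MulOpposite.unop_injective ?_
    simp only [map_mul, map_add] at this
    simp only [map_mul, map_add, MulOpposite.unop_mul, MulOpposite.unop_add, he n hnm, hf n hnm,
      hb n hnm, MulOpposite.unop_op, this]

end Reverse

/-- The opposite algebra with the conjugate complex structure, so that antilinear
anti-homomorphisms into `A` are algebra homomorphisms into `ConjOp A`. -/
def ConjOp (A : Type*) : Type _ := Aᵐᵒᵖ

instance (A : Type*) [Ring A] : Ring (ConjOp A) := inferInstanceAs (Ring Aᵐᵒᵖ)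

instance (A : Type*) [Ring A] [Algebra ℂ A] : Algebra ℂ (ConjOp A) :=
  ((algebraMap ℂ Aᵐᵒᵖ).comp (starRingEnd ℂ)).toAlgebra' fun z a =>
    Algebra.commutes (A := Aᵐᵒᵖ) (conj z) a

lemma nPow_conj (hh : h.im = 0) {x : ℂ} (hx : conj x = x) : conj (nPow h x) = nPow h x := by
  have h1 : conj h = h := Complex.conj_eq_iff_im.2 hh
  rw [nPow, ← Complex.exp_conj, map_div₀, map_mul, h1, hx, map_ofNat]

/-- The images of the generators: `h`, `q ^ h` and `q ^ (-h)` are fixed, `e` and `f` are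
exchanged. -/
def genImageOmega (n m : ℕ) (h : ℂ) : GenN n m → (UN n m h)ᵐᵒᵖ
  | .h j _ => .op (UN.h n m h j)
  | .k j _ => .op (UN.k n m h j)
  | .kinv j _ => .op (UN.kinv n m h j)
  | .e i _ => .op (UN.f n m h i)
  | .f i _ => .op (UN.e n m h i)

/-- The antilinear anti-homomorphism of the free algebra with these values on the generators. -/
def omegaFree (n m : ℕ) (h : ℂ) : FreeAlgebra ℂ (GenN n m) →+* (UN n m h)ᵐᵒᵖ :=
  (FreeAlgebra.lift (A := ConjOp (UN n m h)) ℂ (genImageOmega n m h)).toRingHom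

lemma omegaFree_algebraMap (z : ℂ) :
    omegaFree n m h (algebraMap ℂ _ z) = .op (algebraMap ℂ (UN n m h) (conj z)) :=
  (FreeAlgebra.lift (A := ConjOp (UN n m h)) ℂ (genImageOmega n m h)).commutes z

lemma omegaFree_ι (g : GenN n m) :
    omegaFree n m h (FreeAlgebra.ι ℂ g) = genImageOmega n m h g :=
  FreeAlgebra.lift_ι_apply (A := ConjOp (UN n m h)) (genImageOmega n m h) g

lemma omegaFree_smul (z : ℂ) (x : FreeAlgebra ℂ (GenN n m)) :
    omegaFree n m h (z • x) = .op (conj z • (omegaFree n m h x).unop) := by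
  rw [Algebra.smul_def, map_mul, omegaFree_algebraMap]
  refine MulOpposite.unop_injective ?_
  rw [MulOpposite.unop_mul, MulOpposite.unop_op, MulOpposite.unop_op, Algebra.smul_def]
  exact (Algebra.commutes _ _).symm

lemma UN.k_mul_k {i j : ℕ} (hi : 1 ≤ i ∧ i ≤ n + m) (hj : 1 ≤ j ∧ j ≤ n + m) :
    Commute (UN.k n m h i) (UN.k n m h j) := by
  rw [Commute, SemiconjBy, UN.k, UN.k, ← map_mul, ← map_mul, UN.mk_eq_of_rel (.kk i j hi hj)]

lemma commute_of_mul_eq_one {A : Type*} [Ring A] {k k' a : A} (h : k * k' = 1) (h' : k' * k = 1)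
    (hk : Commute k a) : Commute k' a := by
  have : k' * (k * a) * k' = k' * (a * k) * k' := by rw [hk.eq]
  rw [← mul_assoc, h', one_mul, mul_assoc, mul_assoc a, h, mul_one] at this
  exact this.symm

lemma UN.kinv_commute {j : ℕ} (hj : 1 ≤ j ∧ j ≤ n + m) {a : UN n m h}
    (ha : Commute (UN.k n m h j) a) : Commute (UN.kinv n m h j) a :=
  commute_of_mul_eq_one (UN.k_mul_kinv hj) (UN.kinv_mul_k hj) ha

lemma mul_eq_nPow_smul_mul {A : Type*} [Ring A] [Algebra ℂ A] {k a : A} {c d : ℂ} (hcd : c + d = 0)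
    (hka : k * a = nPow h d • (a * k)) : a * k = nPow h c • (k * a) := by
  rw [hka, smul_smul, ← nPow_add, hcd, nPow_zero, one_smul]

lemma omegaFree_rel (hh : h.im = 0) {x y : FreeAlgebra ℂ (GenN n m)} (hxy : relN n m h x y) :
    omegaFree n m h x = omegaFree n m h y := by
  have hH : ∀ j, 1 ≤ j ∧ j ≤ n + m → omegaFree n m h (GenN.hF n m j) = .op (UN.h n m h j) :=
    fun j hj => by simp [GenN.hF, hj, omegaFree_ι, genImageOmega]
  have hK : ∀ j, 1 ≤ j ∧ j ≤ n + m → omegaFree n m h (GenN.kF n m j) = .op (UN.k n m h j) :=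
    fun j hj => by simp [GenN.kF, hj, omegaFree_ι, genImageOmega]
  have hKi : ∀ j, 1 ≤ j ∧ j ≤ n + m →
      omegaFree n m h (GenN.kinvF n m j) = .op (UN.kinv n m h j) :=
    fun j hj => by simp [GenN.kinvF, hj, omegaFree_ι, genImageOmega]
  have hE : ∀ i, 1 ≤ i ∧ i < n + m → omegaFree n m h (GenN.eF n m i) = .op (UN.f n m h i) :=
    fun i hi => by simp [GenN.eF, hi, omegaFree_ι, genImageOmega]
  have hF : ∀ i, 1 ≤ i ∧ i < n + m → omegaFree n m h (GenN.fF n m i) = .op (UN.e n m h i) :=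
    fun i hi => by simp [GenN.fF, hi, omegaFree_ι, genImageOmega]
  have hpow : ∀ z : ℂ, conj z = z → conj (nPow h z) = nPow h z := fun z => nPow_conj hh
  cases hxy with
  | gl x y hxy =>
    refine GlRel.map_reverse (omegaFree n m h) (UN.mk n m h).toRingHom ?_
      (fun a => Algebra.commute_algebraMap_left _ _) hH hE hF (fun i hi => ?_)
      (fun y z hyz => UN.mk_eq_of_rel (.gl y z hyz)) hxy
    · rw [omegaFree_algebraMap, map_add, hpow 1 (map_one _), hpow (-1) (by simp)]
      exact congrArg _ ((UN.mk n m h).commutes _).symm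
    · have h1 : 1 ≤ i ∧ i ≤ n + m := ⟨hi.1, hi.2.le⟩
      have h2 : 1 ≤ i + 1 ∧ i + 1 ≤ n + m := ⟨by omega, hi.2⟩
      change _ = MulOpposite.op (UN.mk n m h _)
      rw [omegaFree_smul, map_smul, map_inv₀, map_sub, hpow 1 (map_one _), hpow (-1) (by simp)]
      refine congrArg (fun a => MulOpposite.op (_ • a)) ?_
      have hkk := UN.k_mul_k (h := h) h1 h2
      have hik := UN.kinv_commute h1 hkk
      have hki := (UN.kinv_commute h2 hkk.symm).symm
      have hii := UN.kinv_commute h1 hki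
      split_ifs with hin
      · rw [map_sub, map_mul, map_mul, map_sub, map_mul, map_mul, hK i h1, hK _ h2, hKi i h1,
          hKi _ h2]
        exact congrArg₂ (fun a b => a - b) hkk.eq.symm hii.eq.symm
      · rw [map_sub, map_mul, map_mul, map_sub, map_mul, map_mul, hK i h1, hK _ h2, hKi i h1,
          hKi _ h2]
        exact congrArg₂ (fun a b => a - b) hki.eq.symm hik.eq.symm
  | k_kinv j hj =>
    rw [map_mul, hK j hj, hKi j hj, map_one, ← MulOpposite.op_mul, UN.kinv_mul_k hj,
      MulOpposite.op_one]
  | kinv_k j hj =>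
    rw [map_mul, hK j hj, hKi j hj, map_one, ← MulOpposite.op_mul, UN.k_mul_kinv hj,
      MulOpposite.op_one]
  | kk i j hi hj =>
    rw [map_mul, map_mul, hK i hi, hK j hj, ← MulOpposite.op_mul, ← MulOpposite.op_mul,
      (UN.k_mul_k hi hj).eq]
  | kh i j hi hj =>
    have := UN.mk_eq_of_rel (h := h) (.kh i j hi hj)
    rw [map_mul, map_mul] at this
    rw [map_mul, map_mul, hK i hi, hH j hj]
    exact congrArg _ this.symm
  | ke i j hi hj =>
    have := UN.mk_eq_of_rel (h := h) (.kf i j hi hj)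
    rw [map_mul, map_smul, map_mul] at this
    rw [map_mul, omegaFree_smul, map_mul, hK i hi, hE j hj, hpow _ (by split_ifs <;> simp)]
    exact congrArg MulOpposite.op (mul_eq_nPow_smul_mul (by ring) this)
  | kf i j hi hj =>
    have := UN.mk_eq_of_rel (h := h) (.ke i j hi hj)
    rw [map_mul, map_smul, map_mul] at this
    rw [map_mul, omegaFree_smul, map_mul, hK i hi, hF j hj, hpow _ (by split_ifs <;> simp)]
    exact congrArg MulOpposite.op (mul_eq_nPow_smul_mul (by ring) this)

/-- The antilinear anti-involution for real `h`. -/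
def omega (n m : ℕ) (hh : h.im = 0) (a : UN n m h) : UN n m h :=
  (RingQuot.lift ⟨omegaFree n m h, fun _ _ hxy => omegaFree_rel hh hxy⟩ a).unop

section Omega

variable (hh : h.im = 0)

lemma omega_mk (x : FreeAlgebra ℂ (GenN n m)) :
    omega n m hh (UN.mk n m h x) = (omegaFree n m h x).unop := by
  rw [omega, UN.mk, ← AlgHom.coe_toRingHom, RingQuot.mkAlgHom_coe, RingQuot.lift_mkRingHom_apply]

lemma omega_add (a b : UN n m h) : omega n m hh (a + b) = omega n m hh a + omega n m hh b := by
  rw [omega, map_add]; rfl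

lemma omega_mul (a b : UN n m h) : omega n m hh (a * b) = omega n m hh b * omega n m hh a := by
  rw [omega, map_mul]; rfl

lemma omega_algebraMap (z : ℂ) : omega n m hh (algebraMap ℂ _ z) = algebraMap ℂ _ (conj z) := by
  rw [← (UN.mk n m h).commutes, omega_mk, omegaFree_algebraMap, MulOpposite.unop_op]

lemma omega_h {j : ℕ} (hj : 1 ≤ j ∧ j ≤ n + m) :
    omega n m hh (UN.h n m h j) = UN.h n m h j := by
  rw [UN.h, omega_mk]; simp [GenN.hF, hj, omegaFree_ι, genImageOmega, UN.h]

lemma omega_k {j : ℕ} (hj : 1 ≤ j ∧ j ≤ n + m) :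
    omega n m hh (UN.k n m h j) = UN.k n m h j := by
  rw [UN.k, omega_mk]; simp [GenN.kF, hj, omegaFree_ι, genImageOmega, UN.k]

lemma omega_kinv {j : ℕ} (hj : 1 ≤ j ∧ j ≤ n + m) :
    omega n m hh (UN.kinv n m h j) = UN.kinv n m h j := by
  rw [UN.kinv, omega_mk]; simp [GenN.kinvF, hj, omegaFree_ι, genImageOmega, UN.kinv]

lemma omega_e {i : ℕ} (hi : 1 ≤ i ∧ i < n + m) :
    omega n m hh (UN.e n m h i) = UN.f n m h i := by
  rw [UN.e, omega_mk]; simp [GenN.eF, hi, omegaFree_ι, genImageOmega]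

lemma omega_f {i : ℕ} (hi : 1 ≤ i ∧ i < n + m) :
    omega n m hh (UN.f n m h i) = UN.e n m h i := by
  rw [UN.f, omega_mk]; simp [GenN.fF, hi, omegaFree_ι, genImageOmega]

lemma isAntiInvolution_omega : IsAntiInvolution (omega n m hh) where
  map_add := omega_add hh
  map_smul c a := by
    rw [Algebra.smul_def, omega_mul, omega_algebraMap, Algebra.smul_def]
    exact (Algebra.commutes _ _).symm
  map_mul := omega_mul hh
  invol a := by
    induction a using UN.induction with
    | algebraMap z => rw [omega_algebraMap, omega_algebraMap, Complex.conj_conj]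
    | add a b ha hb => rw [omega_add, omega_add, ha, hb]
    | mul a b ha hb => rw [omega_mul, omega_mul, ha, hb]
    | h_h j hj => rw [omega_h hh hj, omega_h hh hj]
    | h_k j hj => rw [omega_k hh hj, omega_k hh hj]
    | h_kinv j hj => rw [omega_kinv hh hj, omega_kinv hh hj]
    | h_e i hi => rw [omega_e hh hi, omega_f hh hi]
    | h_f i hi => rw [omega_f hh hi, omega_e hh hi]
  map_h _ := omega_h hh
  map_k _ := omega_k hh
  map_e _ := omega_e hh

end Omega

/-! ### Unitarity -/

section Inner

lemma fockInner_add_left (x x' y : Fock n m) :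
    fockInner (x + x') y = fockInner x y + fockInner x' y :=
  Finsupp.sum_add_index' (fun _ => by rw [map_zero, zero_mul])
    fun _ _ _ => by rw [map_add, add_mul]

lemma fockInner_smul_left (z : ℂ) (x y : Fock n m) :
    fockInner (z • x) y = conj z * fockInner x y := by
  rw [fockInner, Finsupp.sum_smul_index fun _ => by rw [map_zero, zero_mul], fockInner,
    Finsupp.mul_sum]
  simp only [map_mul, mul_assoc]

lemma fockInner_zero_left (y : Fock n m) : fockInner 0 y = 0 := Finsupp.sum_zero_index

lemma fockInner_add_right (x y y' : Fock n m) :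
    fockInner x (y + y') = fockInner x y + fockInner x y' := by
  simp only [fockInner, Finsupp.add_apply, mul_add, Finsupp.sum_add]

lemma fockInner_smul_right (z : ℂ) (x y : Fock n m) :
    fockInner x (z • y) = z * fockInner x y := by
  simp only [fockInner, Finsupp.smul_apply, smul_eq_mul, Finsupp.mul_sum]
  exact Finsupp.sum_congr fun _ _ => by ring

lemma fockInner_zero_right (x : Fock n m) : fockInner x 0 = 0 := by
  simp [fockInner]

lemma fockInner_single_left (l : Occ n m) (y : Fock n m) :
    fockInner (Finsupp.single l 1) y = y l := by
  rw [fockInner, Finsupp.sum_single_index (by rw [map_zero, zero_mul]), map_one, one_mul]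

lemma fockInner_single_right (l : Occ n m) (x : Fock n m) :
    fockInner x (Finsupp.single l 1) = conj (x l) := by
  induction x using Finsupp.induction_linear with
  | zero => rw [fockInner_zero_left, Finsupp.zero_apply, map_zero]
  | add x y hx hy => rw [fockInner_add_left, hx, hy, Finsupp.add_apply, map_add]
  | single l' z =>
    classical
    rw [fockInner, Finsupp.sum_single_index (by rw [map_zero, zero_mul]), Finsupp.single_apply,
      Finsupp.single_apply]
    simp only [eq_comm (a := l)]
    split_ifs <;> simp

/-- `S` is adjoint to `T` on `F0 n m p` if this holds for the matrix elements. -/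
lemma fockInner_eq_of_single {p : ℕ} {S T : Op n m}
    (hST : ∀ l l' : Occ n m, l.total ≤ p → l'.total ≤ p →
      conj (T (Finsupp.single l 1) l') = S (Finsupp.single l' 1) l) {x y : Fock n m}
    (hx : x ∈ F0 n m p) (hy : y ∈ F0 n m p) : fockInner (T x) y = fockInner x (S y) := by
  induction hx using Submodule.span_induction with
  | zero => rw [map_zero, fockInner_zero_left, fockInner_zero_left]
  | add x x' _ _ hx hx' => rw [map_add, fockInner_add_left, hx, hx', fockInner_add_left]
  | smul z x _ hx => rw [map_smul, fockInner_smul_left, hx, fockInner_smul_left]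
  | mem x hx =>
    obtain ⟨l, hl, rfl⟩ := hx
    induction hy using Submodule.span_induction with
    | zero => rw [map_zero, fockInner_zero_right, fockInner_zero_right]
    | add y y' _ _ hy hy' => rw [map_add, fockInner_add_right, hy, hy', fockInner_add_right]
    | smul z y _ hy => rw [map_smul, fockInner_smul_right, hy, fockInner_smul_right]
    | mem y hy =>
      obtain ⟨l', hl', rfl⟩ := hy
      rw [fockInner_single_right, fockInner_single_left, hST l l' hl hl']

end Inner

open Classical in
/-- The matrix elements of a displacement. -/
lemma moveOp_single_apply {v : ℕ → ℤ} {w : (ℕ → ℤ) → ℂ} (l l' : Occ n m) :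
    moveOp v w (Finsupp.single l 1) l' = if l'.config = l.config + v then w l.config else 0 := by
  rw [moveOp_single, Finsupp.smul_apply, smul_eq_mul]
  split_ifs with hl
  · rw [← hl, ket_config, Finsupp.single_eq_same, mul_one]
  · by_cases hex : ∃ l₁ : Occ n m, l₁.config = l.config + v
    · obtain ⟨l₁, h₁⟩ := hex
      rw [← h₁, ket_config, Finsupp.single_eq_of_ne, mul_zero]
      rintro rfl
      exact hl h₁
    · rw [ket_eq_zero fun l₁ h₁ => hex ⟨l₁, h₁⟩, Finsupp.zero_apply, mul_zero]

lemma nBracket_natCast_succ (hq : ∀ k : ℕ, 0 < k → nPow h 1 ^ k ≠ 1) (k : ℕ) :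
    nBracket h (k + 1 : ℕ) = nPow h (-1) * nBracket h k + nPow h k := by
  have h0 := nPow_one_sub_ne_zero hq
  rw [nBracket, nBracket]
  field_simp
  push_cast
  rw [neg_add, nPow_add, nPow_add]
  ring

/-- For real `h` the numbers `[k]` are nonnegative. -/
lemma exists_nonneg_nBracket (hh : h.im = 0) (hq : ∀ k : ℕ, 0 < k → nPow h 1 ^ k ≠ 1) (k : ℕ) :
    ∃ r : ℝ, 0 ≤ r ∧ nBracket h k = r := by
  have hpow : ∀ x : ℝ, nPow h x = (Real.exp (h.re * x / 2) : ℝ) := fun x => by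
    rw [nPow, Complex.ofReal_exp]
    push_cast
    rw [Complex.conj_eq_iff_re.1 (Complex.conj_eq_iff_im.2 hh)]
  induction k with
  | zero => exact ⟨0, le_rfl, by simp [nBracket]⟩
  | succ k ih =>
    obtain ⟨r, hr, hk⟩ := ih
    have h1 := hpow (-1)
    have h2 := hpow k
    rw [Complex.ofReal_neg, Complex.ofReal_one] at h1
    rw [Complex.ofReal_natCast] at h2
    refine ⟨Real.exp (h.re * (-1) / 2) * r + Real.exp (h.re * k / 2), by positivity, ?_⟩
    rw [nBracket_natCast_succ hq, hk, h1, h2]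
    push_cast
    rfl

lemma conj_eq_of_sq_eq {z : ℂ} {r : ℝ} (hr : 0 ≤ r) (hz : z ^ 2 = r) : conj z = z := by
  have h1 : z ^ 2 = ((Real.sqrt r : ℝ) : ℂ) ^ 2 := by
    rw [hz, ← Complex.ofReal_pow, Real.sq_sqrt hr]
  rcases sq_eq_sq_iff_eq_or_eq_neg.1 h1 with h2 | h2 <;> simp [h2]

section Adjoint

variable {p : ℕ} {ρ : ℕ → ℤ → ℂ}

/-- The amplitudes are real, at the site `0` as long as there are at most `p` particles. -/
lemma IsAmplitude.conj_eq (hh : h.im = 0) (hq : ∀ k : ℕ, 0 < k → nPow h 1 ^ k ≠ 1)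
    (hρ : IsAmplitude n (nBracket h) p ρ) {i : ℕ} {k : ℤ} (hk : i = 0 → -(p : ℤ) ≤ k) :
    conj (ρ i k) = ρ i k := by
  rcases Nat.eq_zero_or_pos i with rfl | hi
  · obtain ⟨c, hc⟩ := Int.eq_ofNat_of_zero_le (a := p + k) (by have := hk rfl; omega)
    obtain ⟨r, hr, h1⟩ := exists_nonneg_nBracket hh hq c
    refine conj_eq_of_sq_eq hr ?_
    rw [hρ.zero_sq, ← h1]
    congr 1
    exact_mod_cast hc
  · rcases lt_or_ge i n with hin | hin
    · rcases le_or_gt k 0 with hk | hk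
      · rw [hρ.bose_of_nonpos i hi hin k hk, map_zero]
      · obtain ⟨c, rfl⟩ := Int.eq_ofNat_of_zero_le hk.le
        obtain ⟨r, hr, h1⟩ := exists_nonneg_nBracket hh hq c
        refine conj_eq_of_sq_eq hr ?_
        rw [hρ.bose_sq i hi hin _ hk.le, ← h1, Int.cast_natCast]
    · rw [hρ.fermi i hin]
      split_ifs <;> simp

lemma conj_opE_single_apply (hh : h.im = 0) (hq : ∀ k : ℕ, 0 < k → nPow h 1 ^ k ≠ 1)
    (hρ : IsAmplitude n (nBracket h) p ρ) {i : ℕ} (hi : 1 ≤ i) {l l' : Occ n m}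
    (hl' : l'.total ≤ p) : conj (opE ρ i (Finsupp.single l 1) l')
      = opF ρ i (Finsupp.single l' 1) l := by
  rw [opE, opF, moveOp_single_apply, moveOp_single_apply]
  have hiff : l'.config = l.config + hop (i - 1) i ↔ l.config = l'.config + hop i (i - 1) := by
    rw [← neg_hop i (i - 1), ← sub_eq_add_neg, eq_sub_iff_add_eq, eq_comm]
  by_cases hl : l'.config = l.config + hop (i - 1) i
  · rw [if_pos hl, if_pos (hiff.1 hl)]
    have h1 : l.config (i - 1) + 1 = l'.config (i - 1) := by
      rw [hl, Pi.add_apply]; simp [hop]; omega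
    have h2 : l'.config i + 1 = l.config i := by
      rw [hl, Pi.add_apply]; simp [hop]; omega
    rw [h1, h2, map_mul, hρ.conj_eq hh hq fun h0 => ?_, hρ.conj_eq hh hq fun h0 => by omega]
    rw [h0, l'.config_zero]
    omega
  · rw [if_neg hl, if_neg fun h => hl (hiff.2 h), map_zero]

lemma fockInner_diagOp {φ : Occ n m → ℂ} (hφ : ∀ l, conj (φ l) = φ l) {x y : Fock n m}
    (hx : x ∈ F0 n m p) (hy : y ∈ F0 n m p) :
    fockInner (diagOp φ x) y = fockInner x (diagOp φ y) :=
  fockInner_eq_of_single (fun l l' _ _ => by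
    rw [diagOp_apply, diagOp_apply, map_mul, hφ]
    rcases eq_or_ne l l' with rfl | hll
    · rw [Finsupp.single_eq_same, map_one]
    · rw [Finsupp.single_eq_of_ne hll, Finsupp.single_eq_of_ne hll.symm, map_zero, mul_zero,
        mul_zero]) hx hy

lemma conj_weight (p : ℕ) (j : ℕ) (x : ℕ → ℤ) : conj (weight p j x) = weight p j x := by
  rw [weight]
  split_ifs <;> simp

/-- For real `h` the representation in `F0 n m p` is a `*`-representation. -/
lemma IsHPN.fockInner_eq (hn : 1 ≤ n) (hh : h.im = 0)
    (hq : ∀ k : ℕ, 0 < k → nPow h 1 ^ k ≠ 1) {s : ℤ → ℂ} {t : ℕ → ℂ}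
    {π : UN n m h →ₐ[ℂ] Op n m} (hr : IsRoots (nBracket h) p s t) (hπ : IsHPN p s t π)
    (a : UN n m h) {x y : Fock n m} (hx : x ∈ F0 n m p) (hy : y ∈ F0 n m p) :
    fockInner (π a x) y = fockInner x (π (omega n m hh a) y) := by
  have hρ := isAmplitude_hpAmp hn hr
  induction a using UN.induction generalizing x y with
  | algebraMap z =>
    rw [omega_algebraMap, AlgHom.commutes, AlgHom.commutes, Module.algebraMap_end_apply,
      Module.algebraMap_end_apply, fockInner_smul_left, fockInner_smul_right]
  | add a b ha hb =>
    rw [omega_add, map_add, map_add, LinearMap.add_apply, LinearMap.add_apply, fockInner_add_left,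
      fockInner_add_right, ha hx hy, hb hx hy]
  | mul a b ha hb =>
    -- The adjointness of `a` is needed at `π b x`, which lies in `F0 n m p` by invariance.
    rw [omega_mul, map_mul, map_mul, Module.End.mul_apply, Module.End.mul_apply,
      ha ((hπ.mem_stab hn hr b).1 x hx) hy, hb hx ((hπ.mem_stab hn hr _).1 y hy)]
  | h_h j hj =>
    rw [omega_h hh hj, hπ.map_h_eq hj]
    exact fockInner_diagOp (fun l => conj_weight p j _) hx hy
  | h_k j hj =>
    rw [omega_k hh hj, hπ.map_k_eq hj]
    exact fockInner_diagOp (fun l => nPow_conj hh (conj_weight p j _)) hx hy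
  | h_kinv j hj =>
    rw [omega_kinv hh hj, hπ.map_kinv_eq hj]
    exact fockInner_diagOp (fun l => nPow_conj hh (by rw [map_neg, conj_weight])) hx hy
  | h_e i hi =>
    rw [omega_e hh hi, hπ.map_e_eq hi, hπ.map_f_eq hi]
    exact fockInner_eq_of_single
      (fun l l' _ hl' => conj_opE_single_apply hh hq hρ hi.1 hl') hx hy
  | h_f i hi =>
    rw [omega_f hh hi, hπ.map_e_eq hi, hπ.map_f_eq hi]
    exact fockInner_eq_of_single (fun l l' hl _ => by
      rw [← conj_opE_single_apply hh hq hρ hi.1 hl, Complex.conj_conj]) hx hy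

end Adjoint

end

end HP

end

open HP in
theorem proposition2 (n m : ℕ) (hn : 1 ≤ n) :
    -- formal parameter: the homomorphism over the power series in `h`
    (∀ p : ℂ,
      (∃ s t, IsRoots (fBracket (A := ℂ)) p s t) ∧
      ∀ (s : ℤ → PowerSeries ℂ) (t : ℕ → PowerSeries ℂ), IsRoots (fBracket (A := ℂ)) p s t →
        ∃ π : UH n m →ₐ[PowerSeries ℂ] PowerSeries (Op n m),
          IsHPH p s t π ∧
          (∀ π' : UH n m →ₐ[PowerSeries ℂ] PowerSeries (Op n m), IsHPH p s t π' → π' = π) ∧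
          (∀ a k, PowerSeries.coeff k (π a) ∈ W n m) ∧
          RespectsDegree n m (PowerSeries.C (parityOp n m))
            (fun j => π (UH.h n m j)) (fun i => π (UH.e n m i)) (fun i => π (UH.f n m i)) ∧
          ∀ p' : ℕ, p = p' → ∀ a k,
            (∀ x ∈ F0 n m p', PowerSeries.coeff k (π a) x ∈ F0 n m p') ∧
            (∀ x ∈ F1 n m p', PowerSeries.coeff k (π a) x ∈ F1 n m p')) ∧
    -- numerical parameter, `q = exp (h/2)` not a root of unity
    (∀ h : ℂ, (∀ k : ℕ, 0 < k → nPow h 1 ^ k ≠ 1) →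
      -- the homomorphism
      (∀ p : ℂ,
        (∃ s t, IsRoots (nBracket h) p s t) ∧
        ∀ (s : ℤ → ℂ) (t : ℕ → ℂ), IsRoots (nBracket h) p s t →
          ∃ π : UN n m h →ₐ[ℂ] Op n m,
            IsHPN p s t π ∧
            (∀ π' : UN n m h →ₐ[ℂ] Op n m, IsHPN p s t π' → π' = π) ∧
            (∀ a, π a ∈ W n m) ∧
            RespectsDegree n m (parityOp n m)
              (fun j => π (UN.h n m h j)) (fun i => π (UN.e n m h i))
              (fun i => π (UN.f n m h i))) ∧
      -- the invariant subspaces and the irreducible representation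
      (∀ (p : ℕ) (s : ℤ → ℂ) (t : ℕ → ℂ) (π : UN n m h →ₐ[ℂ] Op n m),
        IsRoots (nBracket h) p s t → IsHPN p s t π →
          IsCompl (F0 n m p) (F1 n m p) ∧
          IsInvariant π (F0 n m p) ∧ IsInvariant π (F1 n m p) ∧
          Module.Finite ℂ (F0 n m p) ∧ IsIrreducible π (F0 n m p)) ∧
      -- unitarizability for real `h`
      (h.im = 0 →
        ∃ ω : UN n m h → UN n m h, IsAntiInvolution ω ∧
          ∀ (p : ℕ) (s : ℤ → ℂ) (t : ℕ → ℂ) (π : UN n m h →ₐ[ℂ] Op n m),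
            IsRoots (nBracket h) p s t → IsHPN p s t π →
              ∀ a, ∀ x ∈ F0 n m p, ∀ y ∈ F0 n m p,
                fockInner (π a x) y = fockInner x (π (ω a) y)) ∧
      -- inequivalence
      (∀ (p p' : ℕ) (s s' : ℤ → ℂ) (t t' : ℕ → ℂ) (π π' : UN n m h →ₐ[ℂ] Op n m),
        IsRoots (nBracket h) p s t → IsHPN p s t π →
        IsRoots (nBracket h) p' s' t' → IsHPN p' s' t' π' →
          p ≠ p' → ¬ AreEquivalent π π' (F0 n m p) (F0 n m p'))) := by
  refine ⟨fun p => ⟨exists_isRoots_fBracket p, fun s t hr =>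
    ⟨repH hn (isAmplitude_hpAmp hn hr), isHPH_repH hn hr, ?_, ?_, ?_, ?_⟩⟩, fun h hq =>
    ⟨fun p => ⟨exists_isRoots_nBracket h p, fun s t hr =>
      ⟨repN hn hq (isAmplitude_hpAmp hn hr), isHPN_repN hn hq hr, ?_, ?_, ?_⟩⟩,
    fun p s t π hr hπ => ⟨isCompl_F0_F1 p, fun a => (hπ.mem_stab hn hr a).1,
      fun a => (hπ.mem_stab hn hr a).2, finite_F0 p, hπ.isIrreducible hn hq hr⟩,
    fun hh => ⟨omega n m hh, isAntiInvolution_omega hh, fun p s t π hr hπ a x hx y hy =>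
      hπ.fockInner_eq hn hh hq hr a hx hy⟩,
    fun p p' s s' t t' π π' _ hπ _ hπ' hne => not_areEquivalent hn hπ hπ' hne⟩⟩
  · exact fun π' hπ' => (isHPH_repH hn hr).unique hπ'
  · exact (isHPH_repH hn hr).coeff_mem_W
  · exact (isHPH_repH hn hr).respectsDegree hn
  · rintro p' rfl a k
    exact (isHPH_repH hn hr).coeff_mem_stab hn hr a k
  · exact fun π' hπ' => (isHPN_repN hn hq hr).unique hπ'
  · exact (isHPN_repN hn hq hr).mem_W
  · exact (isHPN_repN hn hq hr).respectsDegree hn
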